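/- **Notation.** All matrices are over $\mathbb F_2$. For $a,b,c\in\mathbb F_2$ let $\mathrm{circ}(a,b)=\begin{pmatrix}a&b\\b&a\end{pmatrix}$ and $\mathrm{persym}(a,b,c)=\begin{pmatrix}a&b\\c&a\end{pmatrix}$. For $2\times2$ blocks $X_1,\dots,X_n$, let $\mathrm{CIRC}(X_1,\dots,X_n)$ and $\mathrm{REVCIRC}(X_1,\dots,X_n)$ be the block matrices with first block row $X_1,\dots,X_n$ in which each block row is the previous one shifted cyclically by one block to the right, respectively to the left. For a group $G$ with listing $g_1,\dots,g_n$ and $v=\sum_t A_t g_t$ in the group matrix ring $M_2(\mathbb F_2)G$, write $A_{g_t}=A_t$ and let $\tau_2(v)$ be the $2n\times 2n$ matrix over $\mathbb F_2$ whose $(i,j)$ block is $A_{g_i^{-1}g_j}$. Given $2\times 2$ blocks $A_1,\dots,A_{18}$ over $\mathbb F_2$, define $36\times36$ matrices as follows. - $M_1=\begin{pmatrix}A&B\\B&A\end{pmatrix}$, $A=\mathrm{CIRC}(A_1,\dots,A_9)$, $B=\mathrm{REVCIRC}(A_{10},\dots,A_{18})$. - $M_2=\begin{pmatrix}A&B\\B^T&A^T\end{pmatrix}$,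 $A=\mathrm{CIRC}(A_1,\dots,A_9)$, $B=\mathrm{CIRC}(A_{10},\dots,A_{18})$, with ${}^T$ the ordinary transpose of the $18\times 18$ matrices over $\mathbb F_2$. - $M_3=\begin{pmatrix}A&B&C&D&E&F\\F'&A&B&C&D&E\\E'&F'&A&B&C&D\\D'&E'&F'&A&B&C\\C'&D'&E'&F'&A&B\\B'&C'&D'&E'&F'&A\end{pmatrix}$, where $A,B,C,D,E,F$ are $\mathrm{CIRC}(A_{3s+1},A_{3s+2},A_{3s+3})$ for $s=0,1,\dots,5$, respectively, and $B',C',D',E',F'$ are $\mathrm{CIRC}(A_{3s+3},A_{3s+1},A_{3s+2})$ for $s=1,\dots,5$, respectively. - $M_4=\begin{pmatrix}A&B&C\\C&A&B\\B&C&A\end{pmatrix}$, $A=\mathrm{CIRC}(A_1,\dots,A_6)$, $B=\mathrm{CIRC}(A_7,\dots,A_{12})$, $C=\mathrm{CIRC}(A_{13},\dots,A_{18})$. The kinds $\mathcal G_1,\mathcal G_1',\mathcal G_1'',\mathcal G_1''',\mathcal G_1''''$ use $M_1$; the kinds $\mathcal G_2,\mathcal G_2',\mathcal G_2''$ use $M_2$;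 the kind $\mathcal G_3$ uses $M_3$; the kinds $\mathcal G_4,\mathcal G_4'$ use $M_4$. In the kinds $\mathcal G_1,\mathcal G_2,\mathcal G_3,\mathcal G_4$ all blocks $A_t$ are of the form circ; in $\mathcal G_1'$ exactly the $A_t$ with $t\ge 10$, in $\mathcal G_1''$ exactly those with $t$ even, in $\mathcal G_1''',\mathcal G_2',\mathcal G_4'$ exactly those with $t\le 9$, and in $\mathcal G_1'''',\mathcal G_2''$ all are of the form persym; the remaining ones are of the form circ. A table row lists, for $t=1,\dots,18$, the parameters of $A_t$ (two bits for circ, three for persym). **Theorem.** (a) For all blocks $A_1,\dots,A_{18}\in M_2(\mathbb F_2)$: - $M_1=\tau_2(v_1)$, where $v_1=\sum_{i=0}^{8}\sum_{j=0}^{1}A_{1+i+9j}\,y^jx^i\in M_2(\mathbb F_2)D_{18}$ and $D_{18}=\langle x,y\mid x^9=y^2=1,\ x^y=x^{-1}\rangle$ is listed by $g_{1+i+9j}=y^jx^i$; - if all $A_t$ are symmetric (in particular if they are of the form circ), $M_2=\tau_2(v_2)$, where $v_2=\sum_{i=0}^{8}\sum_{j=0}^{1}A_{1+i+9j}\,x^iy^j\in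 M_2(\mathbb F_2)D_{18}$ and $D_{18}$ is listed by $g_{1+i+9j}=x^iy^j$; - $M_3=\tau_2(v_3)$, where $v_3=\sum_{i=0}^{2}\sum_{j=0}^{5}A_{1+i+3j}\,x^{6i+j}\in M_2(\mathbb F_2)C_{18}$ and $C_{18}=\langle x\mid x^{18}=1\rangle$ is listed by $g_{1+i+3j}=x^{6i+j}$; - $M_4=\tau_2(v_4)$, where $v_4=\sum_{i=0}^{5}\sum_{j=0}^{2}A_{1+i+6j}\,x^iy^j\in M_2(\mathbb F_2)(C_3\times C_6)$ and $C_3\times C_6=\langle x,y\mid x^6=y^3=1,\ xy=yx\rangle$ is listed by $g_{1+i+6j}=x^iy^j$. (b) For each of the 134 rows of the table below, let $M$ be the corresponding matrix $M_1,M_2,M_3$ or $M_4$. The rows of $[I_{36}\mid M]$ generate a binary self-dual code $C$ of length $72$, dimension $36$ and minimum distance $12$, which is of Type I (some codeword has weight not divisible by $4$), whose weight enumerator has the form $$W_{72,1}=1+2\beta y^{12}+(8640-64\gamma)y^{14}+(124281-24\beta+384\gamma)y^{16}+\cdots$$ (the dots standing for terms of degree at least $18$) with the listed values of $\gamma$ and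 $\beta$, and for which the group of coordinate permutations mapping $C$ onto itself has the listed order $\alpha=|\mathrm{Aut}(C)|$. Kind $\mathcal G_1$: - $C_{1}$: 00 00 01 10 00 01 11 00 00 01 10 01 01 11 10 11 10 11; $(\gamma,\beta,\alpha)=(0,93,36)$ - $C_{2}$: 01 10 10 01 00 00 10 10 00 10 01 10 00 11 00 11 00 00; $(\gamma,\beta,\alpha)=(0,111,36)$ - $C_{3}$: 01 01 01 10 10 00 01 11 11 11 00 11 00 01 00 10 00 10; $(\gamma,\beta,\alpha)=(0,132,36)$ - $C_{4}$: 00 00 11 01 10 01 11 00 10 01 00 10 10 10 00 10 00 00; $(\gamma,\beta,\alpha)=(0,138,36)$ - $C_{5}$: 00 11 01 01 01 10 01 01 00 10 00 11 01 01 11 00 00 11; $(\gamma,\beta,\alpha)=(0,144,36)$ - $C_{6}$: 01 00 11 10 10 01 00 01 00 01 11 10 01 11 11 00 00 01; $(\gamma,\beta,\alpha)=(0,150,36)$ - $C_{7}$: 01 00 10 00 00 11 00 01 11 10 10 00 11 10 11 01 10 01; $(\gamma,\beta,\alpha)=(0,174,36)$ - $C_{8}$: 01 11 11 01 00 01 11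 00 00 10 01 01 11 00 01 10 10 00; $(\gamma,\beta,\alpha)=(0,198,36)$ - $C_{9}$: 00 11 00 01 10 10 00 01 10 01 11 01 11 11 00 01 00 10; $(\gamma,\beta,\alpha)=(0,309,36)$ - $C_{10}$: 01 11 01 11 11 00 11 01 01 01 10 11 01 00 10 10 11 00; $(\gamma,\beta,\alpha)=(0,345,36)$ - $C_{11}$: 11 01 10 10 00 11 00 01 00 11 01 10 01 11 10 11 11 01; $(\gamma,\beta,\alpha)=(0,366,36)$ - $C_{12}$: 10 11 00 00 11 11 01 11 01 00 01 10 01 10 00 01 00 01; $(\gamma,\beta,\alpha)=(0,378,36)$ - $C_{13}$: 10 10 10 11 01 00 01 01 00 10 10 11 00 00 10 11 11 00; $(\gamma,\beta,\alpha)=(0,411,36)$ - $C_{14}$: 11 10 11 01 11 10 01 01 10 01 01 11 11 11 11 11 10 00; $(\gamma,\beta,\alpha)=(0,444,36)$ - $C_{15}$: 10 10 00 10 10 11 01 00 10 01 01 11 11 11 10 00 00 00; $(\gamma,\beta,\alpha)=(0,453,36)$ - $C_{16}$: 00 01 11 11 11 01 01 00 10 00 01 10 01 10 00 00 01 11; $(\gamma,\beta,\alpha)=(18,228,36)$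 - $C_{17}$: 10 01 00 11 11 01 10 01 01 10 00 11 00 00 01 01 11 00; $(\gamma,\beta,\alpha)=(18,243,36)$ - $C_{18}$: 11 10 01 11 10 01 10 11 11 11 10 11 00 00 10 00 01 01; $(\gamma,\beta,\alpha)=(18,252,36)$ - $C_{19}$: 10 01 11 10 01 00 00 01 10 11 00 00 11 00 10 10 10 11; $(\gamma,\beta,\alpha)=(18,255,36)$ - $C_{20}$: 01 10 00 01 00 11 00 10 11 11 10 10 01 11 00 00 10 01; $(\gamma,\beta,\alpha)=(18,267,36)$ - $C_{21}$: 10 10 01 11 01 11 10 11 01 11 00 10 00 10 01 11 00 11; $(\gamma,\beta,\alpha)=(18,282,36)$ - $C_{22}$: 01 11 01 00 01 01 00 11 10 11 11 11 01 11 10 10 01 00; $(\gamma,\beta,\alpha)=(18,291,36)$ - $C_{23}$: 11 01 01 01 01 10 00 10 11 11 01 00 10 00 10 00 00 11; $(\gamma,\beta,\alpha)=(18,294,36)$ - $C_{24}$: 11 10 01 01 01 00 01 00 00 01 11 10 00 00 01 01 11 11; $(\gamma,\beta,\alpha)=(18,303,36)$ - $C_{25}$: 01 01 11 10 10 00 10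 11 10 11 10 00 00 11 01 10 00 00; $(\gamma,\beta,\alpha)=(18,312,36)$ - $C_{26}$: 01 00 10 10 01 00 10 01 11 01 11 11 00 10 00 00 11 01; $(\gamma,\beta,\alpha)=(18,318,36)$ - $C_{27}$: 00 11 10 10 11 01 11 01 10 01 01 01 00 10 11 00 11 11; $(\gamma,\beta,\alpha)=(18,321,36)$ - $C_{28}$: 10 10 01 11 01 11 01 11 10 01 00 10 10 11 00 00 00 00; $(\gamma,\beta,\alpha)=(18,330,36)$ - $C_{29}$: 00 10 01 10 01 11 01 00 10 01 00 10 10 11 00 00 00 00; $(\gamma,\beta,\alpha)=(18,333,36)$ - $C_{30}$: 01 11 10 11 00 10 10 11 00 01 10 01 11 10 11 00 11 01; $(\gamma,\beta,\alpha)=(18,339,36)$ - $C_{31}$: 00 01 00 10 00 10 10 01 10 10 01 00 11 11 00 11 01 11; $(\gamma,\beta,\alpha)=(18,348,36)$ - $C_{32}$: 11 00 01 10 10 10 10 10 00 11 11 01 11 11 00 11 01 10; $(\gamma,\beta,\alpha)=(18,351,36)$ - $C_{33}$: 10 01 11 11 11 01 10 10 01 10 00 11 10 11 00 11 00 10; $(\gamma,\beta,\alpha)=(18,360,36)$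 - $C_{34}$: 01 10 10 00 10 11 10 00 10 00 00 10 00 01 01 00 00 11; $(\gamma,\beta,\alpha)=(18,363,36)$ - $C_{35}$: 10 11 11 10 11 11 01 01 01 11 10 00 01 01 00 00 11 10; $(\gamma,\beta,\alpha)=(18,366,36)$ - $C_{36}$: 01 01 01 11 01 11 01 00 01 00 11 00 10 00 01 01 00 11; $(\gamma,\beta,\alpha)=(18,369,36)$ - $C_{37}$: 01 00 10 00 11 11 11 10 00 10 10 01 10 10 00 10 00 11; $(\gamma,\beta,\alpha)=(18,372,36)$ - $C_{38}$: 01 00 00 01 10 00 00 01 11 10 10 00 01 00 00 11 10 10; $(\gamma,\beta,\alpha)=(18,381,36)$ - $C_{39}$: 10 01 10 10 00 01 00 00 10 11 01 00 10 11 11 00 11 10; $(\gamma,\beta,\alpha)=(18,384,36)$ - $C_{40}$: 00 10 00 00 01 00 01 01 10 11 01 11 11 00 01 01 01 11; $(\gamma,\beta,\alpha)=(18,390,36)$ - $C_{41}$: 01 00 10 00 11 00 11 01 10 00 01 00 10 10 11 11 10 01; $(\gamma,\beta,\alpha)=(18,399,36)$ - $C_{42}$: 11 10 01 00 11 11 10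 00 10 00 01 01 10 10 00 00 01 11; $(\gamma,\beta,\alpha)=(18,402,36)$ - $C_{43}$: 00 10 00 11 01 10 10 01 00 11 10 01 00 11 00 01 11 01; $(\gamma,\beta,\alpha)=(18,408,36)$ - $C_{44}$: 00 11 11 01 10 00 01 01 11 01 11 10 01 01 11 11 01 00; $(\gamma,\beta,\alpha)=(18,411,36)$ - $C_{45}$: 00 11 10 00 10 00 11 10 10 10 10 11 10 11 11 11 10 01; $(\gamma,\beta,\alpha)=(18,414,36)$ - $C_{46}$: 01 10 10 10 11 11 01 00 00 00 10 11 01 00 10 01 00 11; $(\gamma,\beta,\alpha)=(18,417,36)$ - $C_{47}$: 01 11 00 10 11 01 00 00 10 00 11 01 00 10 01 10 10 11; $(\gamma,\beta,\alpha)=(18,423,36)$ - $C_{48}$: 10 11 00 11 11 10 00 01 10 11 01 00 01 10 00 00 10 10; $(\gamma,\beta,\alpha)=(18,426,36)$ - $C_{49}$: 11 00 10 10 10 11 11 00 11 01 11 00 01 10 10 10 11 10; $(\gamma,\beta,\alpha)=(18,438,36)$ - $C_{50}$: 00 01 00 11 01 10 10 01 00 11 10 01 00 11 00 01 11 01; $(\gamma,\beta,\alpha)=(18,444,36)$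 - $C_{51}$: 10 00 01 11 10 01 10 11 11 01 00 10 01 11 11 11 00 01; $(\gamma,\beta,\alpha)=(18,450,36)$ - $C_{52}$: 10 01 01 00 11 11 11 00 00 10 11 11 01 10 10 01 11 01; $(\gamma,\beta,\alpha)=(18,462,36)$ - $C_{53}$: 00 00 01 01 11 10 11 10 01 11 00 00 00 10 10 10 11 10; $(\gamma,\beta,\alpha)=(18,471,36)$ - $C_{54}$: 00 10 01 10 01 11 10 01 00 11 00 11 01 10 01 11 11 11; $(\gamma,\beta,\alpha)=(18,474,36)$ - $C_{55}$: 01 10 11 01 11 10 10 01 11 10 00 11 00 01 10 11 11 00; $(\gamma,\beta,\alpha)=(18,480,36)$ - $C_{56}$: 00 10 10 00 11 11 11 10 00 01 01 01 10 00 00 11 10 10; $(\gamma,\beta,\alpha)=(18,486,36)$ - $C_{57}$: 10 00 01 01 01 00 01 11 00 11 11 01 00 00 10 01 01 11; $(\gamma,\beta,\alpha)=(18,489,36)$ - $C_{58}$: 00 10 10 00 11 10 00 11 00 11 01 10 10 10 01 10 11 00; $(\gamma,\beta,\alpha)=(18,498,36)$ - $C_{59}$: 11 10 01 00 00 11 01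 10 10 11 00 10 00 10 10 00 10 11; $(\gamma,\beta,\alpha)=(18,507,36)$ - $C_{60}$: 10 11 00 00 00 01 11 01 11 01 00 01 10 10 10 01 00 11; $(\gamma,\beta,\alpha)=(18,516,36)$ - $C_{61}$: 10 10 10 11 01 11 00 10 01 00 00 10 00 10 11 10 11 00; $(\gamma,\beta,\alpha)=(18,525,36)$ - $C_{62}$: 10 10 10 01 01 11 00 00 01 01 10 11 11 10 00 00 11 00; $(\gamma,\beta,\alpha)=(18,540,36)$ - $C_{63}$: 00 01 00 00 11 10 10 01 01 00 00 01 10 00 11 10 00 10; $(\gamma,\beta,\alpha)=(36,393,36)$ - $C_{64}$: 11 11 01 00 00 10 10 11 11 00 00 01 10 10 01 01 01 00; $(\gamma,\beta,\alpha)=(36,399,36)$ - $C_{65}$: 11 01 00 00 01 01 10 00 00 11 01 11 00 01 11 10 01 01; $(\gamma,\beta,\alpha)=(36,402,36)$ - $C_{66}$: 10 10 01 00 11 01 01 01 11 10 00 01 00 00 11 10 00 11; $(\gamma,\beta,\alpha)=(36,444,36)$ - $C_{67}$: 01 10 01 11 00 11 10 11 11 00 10 00 01 10 01 00 10 00; $(\gamma,\beta,\alpha)=(36,453,72)$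 - $C_{68}$: 11 00 10 01 00 00 00 01 11 00 10 10 01 11 10 01 11 10; $(\gamma,\beta,\alpha)=(36,462,36)$ - $C_{69}$: 01 11 01 00 11 11 10 10 01 11 01 01 00 00 01 11 10 11; $(\gamma,\beta,\alpha)=(36,477,36)$ - $C_{70}$: 00 00 01 01 11 01 10 11 11 00 01 01 10 11 00 10 00 01; $(\gamma,\beta,\alpha)=(36,489,36)$ - $C_{71}$: 11 01 10 10 01 11 01 01 00 11 00 10 01 01 00 00 00 11; $(\gamma,\beta,\alpha)=(36,507,36)$ - $C_{72}$: 00 00 00 10 01 10 11 01 10 00 01 10 00 01 11 11 11 01; $(\gamma,\beta,\alpha)=(36,516,36)$ - $C_{73}$: 11 00 10 11 11 00 00 10 10 10 10 01 11 00 00 10 01 01; $(\gamma,\beta,\alpha)=(36,525,36)$ - $C_{74}$: 11 11 00 10 01 11 11 11 10 10 00 10 00 01 01 10 11 01; $(\gamma,\beta,\alpha)=(36,534,36)$ - $C_{75}$: 01 10 11 00 01 11 01 11 00 00 11 00 10 10 01 01 00 10; $(\gamma,\beta,\alpha)=(36,582,36)$ - $C_{76}$: 00 01 11 10 01 00 00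 01 10 11 10 00 11 00 11 10 10 01; $(\gamma,\beta,\alpha)=(36,588,36)$ - $C_{77}$: 11 10 00 00 00 01 10 01 10 01 00 00 10 11 10 11 11 10; $(\gamma,\beta,\alpha)=(36,600,36)$ - $C_{78}$: 00 01 11 00 00 01 10 01 10 11 00 10 11 01 00 11 10 10; $(\gamma,\beta,\alpha)=(36,606,36)$ - $C_{79}$: 00 11 11 01 10 10 11 01 11 11 01 01 00 11 01 01 00 01; $(\gamma,\beta,\alpha)=(36,624,36)$ - $C_{80}$: 00 10 00 00 11 10 10 01 00 11 10 01 01 11 10 00 11 01; $(\gamma,\beta,\alpha)=(36,663,36)$ - $C_{81}$: 01 11 00 01 10 01 10 11 01 01 10 00 00 11 00 11 00 10; $(\gamma,\beta,\alpha)=(54,651,36)$ - $C_{82}$: 00 10 11 11 10 00 00 11 01 01 00 10 01 01 00 11 10 10; $(\gamma,\beta,\alpha)=(54,657,36)$ Kind $\mathcal G_1'$: - $C_{83}$: 10 01 10 10 00 11 10 00 11 101 011 000 000 101 001 110 110 010; $(\gamma,\beta,\alpha)=(0,282,18)$ - $C_{84}$: 00 00 11 01 00 11 01 00 01 101 001 100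 110 110 111 101 010 000; $(\gamma,\beta,\alpha)=(9,192,18)$ - $C_{85}$: 01 10 00 01 10 10 00 01 11 101 100 101 001 111 110 001 011 101; $(\gamma,\beta,\alpha)=(9,210,18)$ - $C_{86}$: 00 10 10 11 10 11 00 11 11 111 010 010 111 110 101 011 001 001; $(\gamma,\beta,\alpha)=(9,225,18)$ - $C_{87}$: 00 11 11 01 10 11 00 01 01 010 011 001 110 000 110 001 011 001; $(\gamma,\beta,\alpha)=(9,228,18)$ - $C_{88}$: 01 00 11 01 00 11 00 01 01 100 110 001 000 110 101 011 001 110; $(\gamma,\beta,\alpha)=(9,255,18)$ - $C_{89}$: 10 10 01 00 00 00 10 10 01 001 011 101 001 111 110 110 011 110; $(\gamma,\beta,\alpha)=(9,258,18)$ - $C_{90}$: 10 01 00 10 10 10 11 01 01 010 101 011 001 110 111 110 101 111; $(\gamma,\beta,\alpha)=(9,261,18)$ - $C_{91}$: 10 10 01 00 11 01 01 11 11 010 100 101 101 000 110 010 111 101; $(\gamma,\beta,\alpha)=(9,270,18)$ - $C_{92}$: 00 00 11 11 11 10 10 10 01 111 010 101 100 010 101 011 101 110; $(\gamma,\beta,\alpha)=(9,282,18)$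 - $C_{93}$: 01 00 11 00 01 11 00 01 01 001 011 001 110 100 101 110 000 110; $(\gamma,\beta,\alpha)=(9,318,18)$ - $C_{94}$: 10 01 10 00 10 00 10 10 11 101 111 101 001 011 110 001 100 101; $(\gamma,\beta,\alpha)=(9,336,18)$ - $C_{95}$: 11 10 10 10 11 00 01 01 10 011 010 101 100 101 101 000 001 101; $(\gamma,\beta,\alpha)=(18,393,18)$ Kind $\mathcal G_1''$: - $C_{96}$: 00 101 11 000 10 000 10 110 00 110 01 011 10 111 10 101 10 000; $(\gamma,\beta,\alpha)=(9,252,18)$ Kind $\mathcal G_1'''$: - $C_{97}$: 011 101 110 111 101 010 100 101 010 01 00 10 01 00 11 00 01 00; $(\gamma,\beta,\alpha)=(9,291,18)$ - $C_{98}$: 110 100 010 010 000 110 010 111 001 01 01 00 00 11 11 01 11 11; $(\gamma,\beta,\alpha)=(9,300,18)$ Kind $\mathcal G_1''''$: - $C_{99}$: 111 110 011 111 110 011 100 110 110 111 010 011 111 001 110 001 010 101; $(\gamma,\beta,\alpha)=(9,213,18)$ - $C_{100}$: 011 011 101 000 000 110 100 010 001 011 101 110 100 000 011 100 110 101; $(\gamma,\beta,\alpha)=(9,246,18)$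 - $C_{101}$: 010 000 000 001 010 101 010 110 010 111 100 101 010 100 010 100 010 101; $(\gamma,\beta,\alpha)=(9,279,18)$ - $C_{102}$: 101 101 110 101 110 000 101 011 011 100 001 111 010 100 100 100 001 001; $(\gamma,\beta,\alpha)=(9,288,18)$ - $C_{103}$: 111 100 010 111 100 001 010 111 100 111 111 010 001 111 010 001 111 001; $(\gamma,\beta,\alpha)=(9,315,18)$ - $C_{104}$: 011 010 000 001 011 100 111 111 111 010 000 100 011 010 000 101 101 011; $(\gamma,\beta,\alpha)=(9,324,18)$ - $C_{105}$: 010 010 110 000 010 000 010 011 101 111 101 000 110 111 110 101 110 101; $(\gamma,\beta,\alpha)=(9,354,18)$ - $C_{106}$: 000 110 110 001 101 100 101 111 010 010 011 111 000 111 011 001 111 111; $(\gamma,\beta,\alpha)=(9,357,18)$ - $C_{107}$: 000 110 011 111 101 110 111 000 110 111 001 001 001 010 100 000 011 000; $(\gamma,\beta,\alpha)=(27,354,18)$ - $C_{108}$: 011 011 101 011 001 011 111 110 100 100 011 010 001 000 100 100 010 100; $(\gamma,\beta,\alpha)=(27,405,18)$ - $C_{109}$: 001 010 011 010 010 110 000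 000 110 001 001 000 110 101 100 001 100 001; $(\gamma,\beta,\alpha)=(27,444,18)$ Kind $\mathcal G_2$: - $C_{110}$: 00 10 01 01 00 10 10 10 00 11 01 00 00 00 01 00 11 10; $(\gamma,\beta,\alpha)=(0,270,36)$ - $C_{111}$: 01 11 11 00 10 11 01 10 11 10 10 00 00 11 01 01 10 11; $(\gamma,\beta,\alpha)=(18,216,36)$ - $C_{112}$: 01 01 00 11 10 00 00 11 10 10 01 10 00 01 11 00 10 11; $(\gamma,\beta,\alpha)=(18,249,36)$ - $C_{113}$: 00 00 01 10 11 11 01 00 10 01 01 01 11 10 11 11 11 10; $(\gamma,\beta,\alpha)=(18,309,36)$ - $C_{114}$: 11 10 10 10 10 00 01 11 01 11 10 10 00 11 00 00 00 01; $(\gamma,\beta,\alpha)=(18,315,36)$ - $C_{115}$: 10 00 00 01 01 00 01 11 01 10 01 10 11 11 11 00 10 00; $(\gamma,\beta,\alpha)=(18,327,36)$ - $C_{116}$: 00 01 10 10 11 01 11 10 10 11 11 00 01 01 00 00 00 01; $(\gamma,\beta,\alpha)=(18,354,36)$ - $C_{117}$: 01 01 00 11 10 00 00 11 10 10 10 10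 00 01 11 00 10 11; $(\gamma,\beta,\alpha)=(18,435,36)$ - $C_{118}$: 11 11 00 11 00 01 11 10 10 11 01 10 01 10 11 10 00 10; $(\gamma,\beta,\alpha)=(18,468,36)$ - $C_{119}$: 10 10 00 11 11 01 11 10 10 11 00 10 10 00 00 01 00 10; $(\gamma,\beta,\alpha)=(36,420,36)$ - $C_{120}$: 11 01 00 11 00 11 11 10 10 11 01 11 01 10 10 10 00 10; $(\gamma,\beta,\alpha)=(36,567,36)$ - $C_{121}$: 10 00 11 01 11 10 10 10 01 10 11 10 00 10 11 00 00 00; $(\gamma,\beta,\alpha)=(36,615,36)$ - $C_{122}$: 10 01 01 10 10 11 01 11 11 00 00 00 00 10 00 01 11 10; $(\gamma,\beta,\alpha)=(54,642,36)$ Kind $\mathcal G_2'$: - $C_{123}$: 110 100 101 101 111 001 010 100 110 00 10 00 00 11 10 00 11 00; $(\gamma,\beta,\alpha)=(9,273,18)$ - $C_{124}$: 110 110 100 001 010 111 001 001 000 11 11 00 01 01 00 01 01 01; $(\gamma,\beta,\alpha)=(9,297,18)$ - $C_{125}$: 110 011 010 001 000 110 010 000 010 10 00 01 00 11 11 01 00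 11; $(\gamma,\beta,\alpha)=(9,306,18)$ - $C_{126}$: 010 110 111 001 101 100 001 010 100 10 00 00 10 01 10 10 11 10; $(\gamma,\beta,\alpha)=(9,309,18)$ Kind $\mathcal G_2''$: - $C_{127}$: 001 101 100 111 100 110 110 101 110 100 000 101 011 100 100 100 111 010; $(\gamma,\beta,\alpha)=(0,465,36)$ - $C_{128}$: 110 001 000 101 000 011 000 110 100 011 111 100 010 000 110 010 010 100; $(\gamma,\beta,\alpha)=(9,342,18)$ - $C_{129}$: 000 100 000 011 000 111 011 100 011 011 010 110 111 110 110 111 001 110; $(\gamma,\beta,\alpha)=(9,345,18)$ - $C_{130}$: 000 100 101 111 101 011 100 010 110 101 110 111 001 100 110 111 001 010; $(\gamma,\beta,\alpha)=(9,375,18)$ Kind $\mathcal G_3$: - $C_{131}$: 10 00 11 01 11 01 10 11 10 10 00 10 01 10 00 11 11 11; $(\gamma,\beta,\alpha)=(0,135,72)$ Kind $\mathcal G_4$: - $C_{132}$: 11 11 01 11 00 00 01 01 00 10 11 01 10 01 11 10 11 01; $(\gamma,\beta,\alpha)=(0,165,72)$ Kind $\mathcal G_4'$: - $C_{133}$: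 010 101 010 000 100 100 101 110 101 10 10 00 00 10 11 01 11 00; $(\gamma,\beta,\alpha)=(18,297,36)$ - $C_{134}$: 110 000 011 001 001 010 000 001 110 01 11 00 10 10 11 01 10 11; $(\gamma,\beta,\alpha)=(36,378,36)$ -/

import Mathlib

open Matrix Polynomial

namespace SelfDual72

/-! ### Binary linear codes -/

/-- The Euclidean dual of a binary linear code of length `n`. -/
def dualCode {n : ℕ} (C : Submodule (ZMod 2) (Fin n → ZMod 2)) :
    Submodule (ZMod 2) (Fin n → ZMod 2) where
  carrier := {x | ∀ y ∈ C, x ⬝ᵥ y = 0}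
  add_mem' := by
    intro a b ha hb y hy
    rw [add_dotProduct, ha y hy, hb y hy, add_zero]
  zero_mem' := by
    intro y _
    exact zero_dotProduct y
  smul_mem' := by
    intro c x hx y hy
    rw [smul_dotProduct, hx y hy, smul_zero]

def IsSelfDual {n : ℕ} (C : Submodule (ZMod 2) (Fin n → ZMod 2)) : Prop :=
  dualCode C = C

/-- Singly-even (Type I) self-dual code: some codeword has weight not divisible by four. -/
def IsTypeI {n : ℕ} (C : Submodule (ZMod 2) (Fin n → ZMod 2)) : Prop :=
  IsSelfDual C ∧ ∃ c ∈ C, ¬ 4 ∣ hammingNorm c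

/-- `C` has minimum Hamming distance `d`. -/
def HasMinDistance {n : ℕ} (C : Submodule (ZMod 2) (Fin n → ZMod 2)) (d : ℕ) : Prop :=
  IsLeast {e : ℕ | ∃ x ∈ C, ∃ y ∈ C, x ≠ y ∧ hammingDist x y = e} d

open Classical in
/-- The weight enumerator `∑_{c ∈ C} y ^ wt(c)`. -/
noncomputable def weightEnumerator {n : ℕ} (C : Submodule (ZMod 2) (Fin n → ZMod 2)) : ℤ[X] :=
  ∑ c ∈ Finset.univ.filter (fun c => c ∈ C), X ^ hammingNorm c

/-- `C` has a weight enumerator of the form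
`1 + 2β y^12 + (8640 - 64γ) y^14 + (124281 - 24β + 384γ) y^16 + ⋯`,
the dots standing for terms of degree at least `18`. -/
def HasWeightEnumeratorW721 (C : Submodule (ZMod 2) (Fin 72 → ZMod 2)) (γ β : ℤ) : Prop :=
  ∃ Q : ℤ[X], weightEnumerator C =
    1 + Polynomial.C (2 * β) * X ^ 12 + Polynomial.C (8640 - 64 * γ) * X ^ 14
      + Polynomial.C (124281 - 24 * β + 384 * γ) * X ^ 16 + X ^ 18 * Q

/-- The (permutation) automorphism group of a binary code: the coordinate permutations
which map the code onto itself. -/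
def automorphismGroup {n : ℕ} (C : Submodule (ZMod 2) (Fin n → ZMod 2)) :
    Subgroup (Equiv.Perm (Fin n)) where
  carrier := {σ | ∀ c : Fin n → ZMod 2, c ∘ σ ∈ C ↔ c ∈ C}
  mul_mem' := by
    intro σ ρ hσ hρ c
    exact (hρ (c ∘ σ)).trans (hσ c)
  one_mem' := fun _ => Iff.rfl
  inv_mem' := by
    intro σ hσ c
    have h := hσ (c ∘ (σ⁻¹ : Equiv.Perm (Fin n)))
    have e : (c ∘ (σ⁻¹ : Equiv.Perm (Fin n))) ∘ σ = c := by
      funext i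
      simp
    rw [e] at h
    exact h.symm

/-- The code spanned by the rows of `[I_m | T]`. -/
def codeOf {m : ℕ} (T : Matrix (Fin m) (Fin m) (ZMod 2)) :
    Submodule (ZMod 2) (Fin (m + m) → ZMod 2) :=
  Submodule.span (ZMod 2) (Set.range
    (Matrix.reindex (Equiv.refl (Fin m)) finSumFinEquiv
      (Matrix.fromCols (1 : Matrix (Fin m) (Fin m) (ZMod 2)) T)).row)

/-! ### Block matrices and the map `τ_k` -/

/-- A `p × p` matrix of `q × q` matrices, read as a `pq × pq` matrix. -/
def assemble {α : Type*} {p q : ℕ} (L : Matrix (Fin p) (Fin p) (Matrix (Fin q) (Fin q) α)) :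
    Matrix (Fin (p * q)) (Fin (p * q)) α :=
  Matrix.reindex finProdFinEquiv finProdFinEquiv (Matrix.comp _ _ _ _ _ L)

/-- `σ_k(v)`, the block matrix with blocks `A_{g_i⁻¹ g_j}`, for the listing `g` of the group
and `v = ∑ A_g g` in the group matrix ring `M_k(R)G`. -/
def sigma {R G : Type*} [CommRing R] [Group G] {k n : ℕ} (g : Fin n ≃ G)
    (v : MonoidAlgebra (Matrix (Fin k) (Fin k) R) G) :
    Matrix (Fin n) (Fin n) (Matrix (Fin k) (Fin k) R) :=
  Matrix.of fun i j => v.coeff ((g i)⁻¹ * g j)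

/-- `τ_k(v)`, the `kn × kn` matrix over `R` obtained from `σ_k(v)`. -/
def tau {R G : Type*} [CommRing R] [Group G] {k n : ℕ} (g : Fin n ≃ G)
    (v : MonoidAlgebra (Matrix (Fin k) (Fin k) R) G) :
    Matrix (Fin (n * k)) (Fin (n * k)) R :=
  assemble (sigma g v)

/-- The element `A_1 g_1 + ⋯ + A_n g_n` of `M_k(R)G`. -/
noncomputable def groupElement {R G : Type*} [CommRing R] [Group G] {k n : ℕ} (g : Fin n ≃ G)
    (A : ℕ → Matrix (Fin k) (Fin k) R) : MonoidAlgebra (Matrix (Fin k) (Fin k) R) G :=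
  ∑ t : Fin n, MonoidAlgebra.single (g t) (A (t + 1))

/-- The circulant matrix with first row `a 0, …, a (n - 1)`. -/
def CIRC {α : Type*} {n : ℕ} [NeZero n] (a : Fin n → α) : Matrix (Fin n) (Fin n) α :=
  Matrix.of fun i j => a (j - i)

/-- The reverse circulant matrix with first row `a 0, …, a (n - 1)`. -/
def REVCIRC {α : Type*} {n : ℕ} [NeZero n] (a : Fin n → α) : Matrix (Fin n) (Fin n) α :=
  Matrix.of fun i j => a (i + j)

def circ {α : Type*} (a b : α) : Matrix (Fin 2) (Fin 2) α := !![a, b; b, a]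

def persym {α : Type*} (a b c : α) : Matrix (Fin 2) (Fin 2) α := !![a, b; c, a]

/-- The ordinary transpose of a matrix given in blocks: blocks are permuted and each of them
is transposed. -/
def blockTranspose {α : Type*} {p k : ℕ} (B : Matrix (Fin p) (Fin p) (Matrix (Fin k) (Fin k) α)) :
    Matrix (Fin p) (Fin p) (Matrix (Fin k) (Fin k) α) :=
  Matrix.of fun i j => (B j i)ᵀ

/-! ### The four groups, listed -/

/-- `D_18`, listed by `g_{1+i+9j} = y^j x^i`, with `x = r 1` and `y = sr 0`. -/
noncomputable def listingI : Fin 18 ≃ DihedralGroup 9 :=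
  Equiv.ofBijective (fun t => DihedralGroup.sr 0 ^ (t.val / 9) * DihedralGroup.r 1 ^ (t.val % 9))
    (by decide)

/-- `D_18`, listed by `g_{1+i+9j} = x^i y^j`. -/
noncomputable def listingII : Fin 18 ≃ DihedralGroup 9 :=
  Equiv.ofBijective (fun t => DihedralGroup.r 1 ^ (t.val % 9) * DihedralGroup.sr 0 ^ (t.val / 9))
    (by decide)

/-- `C_18`, listed by `g_{1+i+3j} = x^{6i+j}`. -/
noncomputable def listingIII : Fin 18 ≃ Multiplicative (ZMod 18) :=
  Equiv.ofBijective (fun t => Multiplicative.ofAdd 1 ^ (6 * (t.val % 3) + t.val / 3))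
    (by decide)

/-- `C_6 × C_3`, listed by `g_{1+i+6j} = x^i y^j`. -/
noncomputable def listingIV : Fin 18 ≃ Multiplicative (ZMod 6) × Multiplicative (ZMod 3) :=
  Equiv.ofBijective
    (fun t => (Multiplicative.ofAdd 1, 1) ^ (t.val % 6) * (1, Multiplicative.ofAdd 1) ^ (t.val / 6))
    (by decide)

/-! ### The block patterns, in terms of the blocks `A 1, …, A 18` -/

def patternI {M : Type*} (A : ℕ → M) : Matrix (Fin 18) (Fin 18) M :=
  let a : Matrix (Fin 9) (Fin 9) M := CIRC fun i => A (1 + i)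
  let b : Matrix (Fin 9) (Fin 9) M := REVCIRC fun i => A (10 + i)
  assemble !![a, b; b, a]

def patternII {R : Type*} (A : ℕ → Matrix (Fin 2) (Fin 2) R) :
    Matrix (Fin 18) (Fin 18) (Matrix (Fin 2) (Fin 2) R) :=
  let a : Matrix (Fin 9) (Fin 9) (Matrix (Fin 2) (Fin 2) R) := CIRC fun i => A (1 + i)
  let b : Matrix (Fin 9) (Fin 9) (Matrix (Fin 2) (Fin 2) R) := CIRC fun i => A (10 + i)
  assemble !![a, b; blockTranspose b, blockTranspose a]

def patternIII {M : Type*} (A : ℕ → M) : Matrix (Fin 18) (Fin 18) M :=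
  let a := CIRC ![A 1, A 2, A 3]
  let b := CIRC ![A 4, A 5, A 6]
  let b' := CIRC ![A 6, A 4, A 5]
  let c := CIRC ![A 7, A 8, A 9]
  let c' := CIRC ![A 9, A 7, A 8]
  let d := CIRC ![A 10, A 11, A 12]
  let d' := CIRC ![A 12, A 10, A 11]
  let e := CIRC ![A 13, A 14, A 15]
  let e' := CIRC ![A 15, A 13, A 14]
  let f := CIRC ![A 16, A 17, A 18]
  let f' := CIRC ![A 18, A 16, A 17]
  assemble !![a, b, c, d, e, f;
              f', a, b, c, d, e;
              e', f', a, b, c, d;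
              d', e', f', a, b, c;
              c', d', e', f', a, b;
              b', c', d', e', f', a]

def patternIV {M : Type*} (A : ℕ → M) : Matrix (Fin 18) (Fin 18) M :=
  let a : Matrix (Fin 6) (Fin 6) M := CIRC fun i => A (1 + i)
  let b : Matrix (Fin 6) (Fin 6) M := CIRC fun i => A (7 + i)
  let c : Matrix (Fin 6) (Fin 6) M := CIRC fun i => A (13 + i)
  assemble !![a, b, c; c, a, b; b, c, a]

/-! ### The eleven kinds of generator matrices -/

/-- The kinds `𝒢₁, 𝒢₁', 𝒢₁'', 𝒢₁''', 𝒢₁'''', 𝒢₂, 𝒢₂', 𝒢₂'', 𝒢₃, 𝒢₄, 𝒢₄'`;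
each `p` stands for a prime. -/
inductive Kind
  | G1 | G1p | G1pp | G1ppp | G1pppp | G2 | G2p | G2pp | G3 | G4 | G4p

/-- Whether the block `A_t`, `1 ≤ t ≤ 18`, is persymmetric; otherwise it is circulant. -/
def Kind.isPersym : Kind → ℕ → Bool
  | .G1, _ | .G2, _ | .G3, _ | .G4, _ => false
  | .G1p, t => decide (10 ≤ t)
  | .G1pp, t => decide (t % 2 = 0)
  | .G1ppp, t | .G2p, t | .G4p, t => decide (t ≤ 9)
  | .G1pppp, _ | .G2pp, _ => true

/-- The binary digit of `w` with weight `2 ^ i`, as an element of `𝔽_2`. -/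
def bit (w i : ℕ) : ZMod 2 := if w.testBit i then 1 else 0

/-- The block `A_t` with the parameters `(a, b)` or `(a, b, c)` written as the two or three
binary digits of `w`, from left to right. -/
def Kind.block (κ : Kind) (t w : ℕ) : Matrix (Fin 2) (Fin 2) (ZMod 2) :=
  if κ.isPersym t then persym (bit w 2) (bit w 1) (bit w 0) else circ (bit w 1) (bit w 0)

def Kind.pattern {R : Type*} (κ : Kind) (A : ℕ → Matrix (Fin 2) (Fin 2) R) :
    Matrix (Fin 18) (Fin 18) (Matrix (Fin 2) (Fin 2) R) :=
  match κ with
  | .G1 | .G1p | .G1pp | .G1ppp | .G1pppp => patternI A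
  | .G2 | .G2p | .G2pp => patternII A
  | .G3 => patternIII A
  | .G4 | .G4p => patternIV A

/-! ### The table of codes -/

structure TableRow where
  kind : Kind
  /-- The parameters of `A_1, …, A_18`: the two (circulant block) or three (persymmetric block)
  parameters of a block are the binary digits of one number, leading zeros being kept. -/
  params : List ℕ
  γ : ℕ
  β : ℕ
  autOrder : ℕ

/-- The block `A_t`, `1 ≤ t ≤ 18`. -/
def TableRow.block (r : TableRow) (t : ℕ) : Matrix (Fin 2) (Fin 2) (ZMod 2) :=
  r.kind.block t (r.params.getD (t - 1) 0)

/-- The binary `36 × 36` matrix on the right of the identity in the generator matrix. -/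
def TableRow.rightHalf (r : TableRow) : Matrix (Fin 36) (Fin 36) (ZMod 2) :=
  assemble (r.kind.pattern r.block)

/-- The binary code generated by the rows of `[I_36 | rightHalf]`. -/
def TableRow.code (r : TableRow) : Submodule (ZMod 2) (Fin 72 → ZMod 2) :=
  codeOf r.rightHalf

/-- The codes `C_1, …, C_134`, in this order. -/
def codeTable : List TableRow :=
  [ ⟨.G1, [0b00, 0b00, 0b01, 0b10, 0b00, 0b01, 0b11, 0b00, 0b00,
      0b01, 0b10, 0b01, 0b01, 0b11, 0b10, 0b11, 0b10, 0b11], 0, 93, 36⟩,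
    ⟨.G1, [0b01, 0b10, 0b10, 0b01, 0b00, 0b00, 0b10, 0b10, 0b00,
      0b10, 0b01, 0b10, 0b00, 0b11, 0b00, 0b11, 0b00, 0b00], 0, 111, 36⟩,
    ⟨.G1, [0b01, 0b01, 0b01, 0b10, 0b10, 0b00, 0b01, 0b11, 0b11,
      0b11, 0b00, 0b11, 0b00, 0b01, 0b00, 0b10, 0b00, 0b10], 0, 132, 36⟩,
    ⟨.G1, [0b00, 0b00, 0b11, 0b01, 0b10, 0b01, 0b11, 0b00, 0b10,
      0b01, 0b00, 0b10, 0b10, 0b10, 0b00, 0b10, 0b00, 0b00], 0, 138, 36⟩,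
    ⟨.G1, [0b00, 0b11, 0b01, 0b01, 0b01, 0b10, 0b01, 0b01, 0b00,
      0b10, 0b00, 0b11, 0b01, 0b01, 0b11, 0b00, 0b00, 0b11], 0, 144, 36⟩,
    ⟨.G1, [0b01, 0b00, 0b11, 0b10, 0b10, 0b01, 0b00, 0b01, 0b00,
      0b01, 0b11, 0b10, 0b01, 0b11, 0b11, 0b00, 0b00, 0b01], 0, 150, 36⟩,
    ⟨.G1, [0b01, 0b00, 0b10, 0b00, 0b00, 0b11, 0b00, 0b01, 0b11,
      0b10, 0b10, 0b00, 0b11, 0b10, 0b11, 0b01, 0b10, 0b01], 0, 174, 36⟩,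
    ⟨.G1, [0b01, 0b11, 0b11, 0b01, 0b00, 0b01, 0b11, 0b00, 0b00,
      0b10, 0b01, 0b01, 0b11, 0b00, 0b01, 0b10, 0b10, 0b00], 0, 198, 36⟩,
    ⟨.G1, [0b00, 0b11, 0b00, 0b01, 0b10, 0b10, 0b00, 0b01, 0b10,
      0b01, 0b11, 0b01, 0b11, 0b11, 0b00, 0b01, 0b00, 0b10], 0, 309, 36⟩,
    ⟨.G1, [0b01, 0b11, 0b01, 0b11, 0b11, 0b00, 0b11, 0b01, 0b01,
      0b01, 0b10, 0b11, 0b01, 0b00, 0b10, 0b10, 0b11, 0b00], 0, 345, 36⟩,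
    ⟨.G1, [0b11, 0b01, 0b10, 0b10, 0b00, 0b11, 0b00, 0b01, 0b00,
      0b11, 0b01, 0b10, 0b01, 0b11, 0b10, 0b11, 0b11, 0b01], 0, 366, 36⟩,
    ⟨.G1, [0b10, 0b11, 0b00, 0b00, 0b11, 0b11, 0b01, 0b11, 0b01,
      0b00, 0b01, 0b10, 0b01, 0b10, 0b00, 0b01, 0b00, 0b01], 0, 378, 36⟩,
    ⟨.G1, [0b10, 0b10, 0b10, 0b11, 0b01, 0b00, 0b01, 0b01, 0b00,
      0b10, 0b10, 0b11, 0b00, 0b00, 0b10, 0b11, 0b11, 0b00], 0, 411, 36⟩,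
    ⟨.G1, [0b11, 0b10, 0b11, 0b01, 0b11, 0b10, 0b01, 0b01, 0b10,
      0b01, 0b01, 0b11, 0b11, 0b11, 0b11, 0b11, 0b10, 0b00], 0, 444, 36⟩,
    ⟨.G1, [0b10, 0b10, 0b00, 0b10, 0b10, 0b11, 0b01, 0b00, 0b10,
      0b01, 0b01, 0b11, 0b11, 0b11, 0b10, 0b00, 0b00, 0b00], 0, 453, 36⟩,
    ⟨.G1, [0b00, 0b01, 0b11, 0b11, 0b11, 0b01, 0b01, 0b00, 0b10,
      0b00, 0b01, 0b10, 0b01, 0b10, 0b00, 0b00, 0b01, 0b11], 18, 228, 36⟩,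
    ⟨.G1, [0b10, 0b01, 0b00, 0b11, 0b11, 0b01, 0b10, 0b01, 0b01,
      0b10, 0b00, 0b11, 0b00, 0b00, 0b01, 0b01, 0b11, 0b00], 18, 243, 36⟩,
    ⟨.G1, [0b11, 0b10, 0b01, 0b11, 0b10, 0b01, 0b10, 0b11, 0b11,
      0b11, 0b10, 0b11, 0b00, 0b00, 0b10, 0b00, 0b01, 0b01], 18, 252, 36⟩,
    ⟨.G1, [0b10, 0b01, 0b11, 0b10, 0b01, 0b00, 0b00, 0b01, 0b10,
      0b11, 0b00, 0b00, 0b11, 0b00, 0b10, 0b10, 0b10, 0b11], 18, 255, 36⟩,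
    ⟨.G1, [0b01, 0b10, 0b00, 0b01, 0b00, 0b11, 0b00, 0b10, 0b11,
      0b11, 0b10, 0b10, 0b01, 0b11, 0b00, 0b00, 0b10, 0b01], 18, 267, 36⟩,
    ⟨.G1, [0b10, 0b10, 0b01, 0b11, 0b01, 0b11, 0b10, 0b11, 0b01,
      0b11, 0b00, 0b10, 0b00, 0b10, 0b01, 0b11, 0b00, 0b11], 18, 282, 36⟩,
    ⟨.G1, [0b01, 0b11, 0b01, 0b00, 0b01, 0b01, 0b00, 0b11, 0b10,
      0b11, 0b11, 0b11, 0b01, 0b11, 0b10, 0b10, 0b01, 0b00], 18, 291, 36⟩,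
    ⟨.G1, [0b11, 0b01, 0b01, 0b01, 0b01, 0b10, 0b00, 0b10, 0b11,
      0b11, 0b01, 0b00, 0b10, 0b00, 0b10, 0b00, 0b00, 0b11], 18, 294, 36⟩,
    ⟨.G1, [0b11, 0b10, 0b01, 0b01, 0b01, 0b00, 0b01, 0b00, 0b00,
      0b01, 0b11, 0b10, 0b00, 0b00, 0b01, 0b01, 0b11, 0b11], 18, 303, 36⟩,
    ⟨.G1, [0b01, 0b01, 0b11, 0b10, 0b10, 0b00, 0b10, 0b11, 0b10,
      0b11, 0b10, 0b00, 0b00, 0b11, 0b01, 0b10, 0b00, 0b00], 18, 312, 36⟩,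
    ⟨.G1, [0b01, 0b00, 0b10, 0b10, 0b01, 0b00, 0b10, 0b01, 0b11,
      0b01, 0b11, 0b11, 0b00, 0b10, 0b00, 0b00, 0b11, 0b01], 18, 318, 36⟩,
    ⟨.G1, [0b00, 0b11, 0b10, 0b10, 0b11, 0b01, 0b11, 0b01, 0b10,
      0b01, 0b01, 0b01, 0b00, 0b10, 0b11, 0b00, 0b11, 0b11], 18, 321, 36⟩,
    ⟨.G1, [0b10, 0b10, 0b01, 0b11, 0b01, 0b11, 0b01, 0b11, 0b10,
      0b01, 0b00, 0b10, 0b10, 0b11, 0b00, 0b00, 0b00, 0b00], 18, 330, 36⟩,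
    ⟨.G1, [0b00, 0b10, 0b01, 0b10, 0b01, 0b11, 0b01, 0b00, 0b10,
      0b01, 0b00, 0b10, 0b10, 0b11, 0b00, 0b00, 0b00, 0b00], 18, 333, 36⟩,
    ⟨.G1, [0b01, 0b11, 0b10, 0b11, 0b00, 0b10, 0b10, 0b11, 0b00,
      0b01, 0b10, 0b01, 0b11, 0b10, 0b11, 0b00, 0b11, 0b01], 18, 339, 36⟩,
    ⟨.G1, [0b00, 0b01, 0b00, 0b10, 0b00, 0b10, 0b10, 0b01, 0b10,
      0b10, 0b01, 0b00, 0b11, 0b11, 0b00, 0b11, 0b01, 0b11], 18, 348, 36⟩,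
    ⟨.G1, [0b11, 0b00, 0b01, 0b10, 0b10, 0b10, 0b10, 0b10, 0b00,
      0b11, 0b11, 0b01, 0b11, 0b11, 0b00, 0b11, 0b01, 0b10], 18, 351, 36⟩,
    ⟨.G1, [0b10, 0b01, 0b11, 0b11, 0b11, 0b01, 0b10, 0b10, 0b01,
      0b10, 0b00, 0b11, 0b10, 0b11, 0b00, 0b11, 0b00, 0b10], 18, 360, 36⟩,
    ⟨.G1, [0b01, 0b10, 0b10, 0b00, 0b10, 0b11, 0b10, 0b00, 0b10,
      0b00, 0b00, 0b10, 0b00, 0b01, 0b01, 0b00, 0b00, 0b11], 18, 363, 36⟩,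
    ⟨.G1, [0b10, 0b11, 0b11, 0b10, 0b11, 0b11, 0b01, 0b01, 0b01,
      0b11, 0b10, 0b00, 0b01, 0b01, 0b00, 0b00, 0b11, 0b10], 18, 366, 36⟩,
    ⟨.G1, [0b01, 0b01, 0b01, 0b11, 0b01, 0b11, 0b01, 0b00, 0b01,
      0b00, 0b11, 0b00, 0b10, 0b00, 0b01, 0b01, 0b00, 0b11], 18, 369, 36⟩,
    ⟨.G1, [0b01, 0b00, 0b10, 0b00, 0b11, 0b11, 0b11, 0b10, 0b00,
      0b10, 0b10, 0b01, 0b10, 0b10, 0b00, 0b10, 0b00, 0b11], 18, 372, 36⟩,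
    ⟨.G1, [0b01, 0b00, 0b00, 0b01, 0b10, 0b00, 0b00, 0b01, 0b11,
      0b10, 0b10, 0b00, 0b01, 0b00, 0b00, 0b11, 0b10, 0b10], 18, 381, 36⟩,
    ⟨.G1, [0b10, 0b01, 0b10, 0b10, 0b00, 0b01, 0b00, 0b00, 0b10,
      0b11, 0b01, 0b00, 0b10, 0b11, 0b11, 0b00, 0b11, 0b10], 18, 384, 36⟩,
    ⟨.G1, [0b00, 0b10, 0b00, 0b00, 0b01, 0b00, 0b01, 0b01, 0b10,
      0b11, 0b01, 0b11, 0b11, 0b00, 0b01, 0b01, 0b01, 0b11], 18, 390, 36⟩,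
    ⟨.G1, [0b01, 0b00, 0b10, 0b00, 0b11, 0b00, 0b11, 0b01, 0b10,
      0b00, 0b01, 0b00, 0b10, 0b10, 0b11, 0b11, 0b10, 0b01], 18, 399, 36⟩,
    ⟨.G1, [0b11, 0b10, 0b01, 0b00, 0b11, 0b11, 0b10, 0b00, 0b10,
      0b00, 0b01, 0b01, 0b10, 0b10, 0b00, 0b00, 0b01, 0b11], 18, 402, 36⟩,
    ⟨.G1, [0b00, 0b10, 0b00, 0b11, 0b01, 0b10, 0b10, 0b01, 0b00,
      0b11, 0b10, 0b01, 0b00, 0b11, 0b00, 0b01, 0b11, 0b01], 18, 408, 36⟩,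
    ⟨.G1, [0b00, 0b11, 0b11, 0b01, 0b10, 0b00, 0b01, 0b01, 0b11,
      0b01, 0b11, 0b10, 0b01, 0b01, 0b11, 0b11, 0b01, 0b00], 18, 411, 36⟩,
    ⟨.G1, [0b00, 0b11, 0b10, 0b00, 0b10, 0b00, 0b11, 0b10, 0b10,
      0b10, 0b10, 0b11, 0b10, 0b11, 0b11, 0b11, 0b10, 0b01], 18, 414, 36⟩,
    ⟨.G1, [0b01, 0b10, 0b10, 0b10, 0b11, 0b11, 0b01, 0b00, 0b00,
      0b00, 0b10, 0b11, 0b01, 0b00, 0b10, 0b01, 0b00, 0b11], 18, 417, 36⟩,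
    ⟨.G1, [0b01, 0b11, 0b00, 0b10, 0b11, 0b01, 0b00, 0b00, 0b10,
      0b00, 0b11, 0b01, 0b00, 0b10, 0b01, 0b10, 0b10, 0b11], 18, 423, 36⟩,
    ⟨.G1, [0b10, 0b11, 0b00, 0b11, 0b11, 0b10, 0b00, 0b01, 0b10,
      0b11, 0b01, 0b00, 0b01, 0b10, 0b00, 0b00, 0b10, 0b10], 18, 426, 36⟩,
    ⟨.G1, [0b11, 0b00, 0b10, 0b10, 0b10, 0b11, 0b11, 0b00, 0b11,
      0b01, 0b11, 0b00, 0b01, 0b10, 0b10, 0b10, 0b11, 0b10], 18, 438, 36⟩,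
    ⟨.G1, [0b00, 0b01, 0b00, 0b11, 0b01, 0b10, 0b10, 0b01, 0b00,
      0b11, 0b10, 0b01, 0b00, 0b11, 0b00, 0b01, 0b11, 0b01], 18, 444, 36⟩,
    ⟨.G1, [0b10, 0b00, 0b01, 0b11, 0b10, 0b01, 0b10, 0b11, 0b11,
      0b01, 0b00, 0b10, 0b01, 0b11, 0b11, 0b11, 0b00, 0b01], 18, 450, 36⟩,
    ⟨.G1, [0b10, 0b01, 0b01, 0b00, 0b11, 0b11, 0b11, 0b00, 0b00,
      0b10, 0b11, 0b11, 0b01, 0b10, 0b10, 0b01, 0b11, 0b01], 18, 462, 36⟩,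
    ⟨.G1, [0b00, 0b00, 0b01, 0b01, 0b11, 0b10, 0b11, 0b10, 0b01,
      0b11, 0b00, 0b00, 0b00, 0b10, 0b10, 0b10, 0b11, 0b10], 18, 471, 36⟩,
    ⟨.G1, [0b00, 0b10, 0b01, 0b10, 0b01, 0b11, 0b10, 0b01, 0b00,
      0b11, 0b00, 0b11, 0b01, 0b10, 0b01, 0b11, 0b11, 0b11], 18, 474, 36⟩,
    ⟨.G1, [0b01, 0b10, 0b11, 0b01, 0b11, 0b10, 0b10, 0b01, 0b11,
      0b10, 0b00, 0b11, 0b00, 0b01, 0b10, 0b11, 0b11, 0b00], 18, 480, 36⟩,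
    ⟨.G1, [0b00, 0b10, 0b10, 0b00, 0b11, 0b11, 0b11, 0b10, 0b00,
      0b01, 0b01, 0b01, 0b10, 0b00, 0b00, 0b11, 0b10, 0b10], 18, 486, 36⟩,
    ⟨.G1, [0b10, 0b00, 0b01, 0b01, 0b01, 0b00, 0b01, 0b11, 0b00,
      0b11, 0b11, 0b01, 0b00, 0b00, 0b10, 0b01, 0b01, 0b11], 18, 489, 36⟩,
    ⟨.G1, [0b00, 0b10, 0b10, 0b00, 0b11, 0b10, 0b00, 0b11, 0b00,
      0b11, 0b01, 0b10, 0b10, 0b10, 0b01, 0b10, 0b11, 0b00], 18, 498, 36⟩,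
    ⟨.G1, [0b11, 0b10, 0b01, 0b00, 0b00, 0b11, 0b01, 0b10, 0b10,
      0b11, 0b00, 0b10, 0b00, 0b10, 0b10, 0b00, 0b10, 0b11], 18, 507, 36⟩,
    ⟨.G1, [0b10, 0b11, 0b00, 0b00, 0b00, 0b01, 0b11, 0b01, 0b11,
      0b01, 0b00, 0b01, 0b10, 0b10, 0b10, 0b01, 0b00, 0b11], 18, 516, 36⟩,
    ⟨.G1, [0b10, 0b10, 0b10, 0b11, 0b01, 0b11, 0b00, 0b10, 0b01,
      0b00, 0b00, 0b10, 0b00, 0b10, 0b11, 0b10, 0b11, 0b00], 18, 525, 36⟩,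
    ⟨.G1, [0b10, 0b10, 0b10, 0b01, 0b01, 0b11, 0b00, 0b00, 0b01,
      0b01, 0b10, 0b11, 0b11, 0b10, 0b00, 0b00, 0b11, 0b00], 18, 540, 36⟩,
    ⟨.G1, [0b00, 0b01, 0b00, 0b00, 0b11, 0b10, 0b10, 0b01, 0b01,
      0b00, 0b00, 0b01, 0b10, 0b00, 0b11, 0b10, 0b00, 0b10], 36, 393, 36⟩,
    ⟨.G1, [0b11, 0b11, 0b01, 0b00, 0b00, 0b10, 0b10, 0b11, 0b11,
      0b00, 0b00, 0b01, 0b10, 0b10, 0b01, 0b01, 0b01, 0b00], 36, 399, 36⟩,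
    ⟨.G1, [0b11, 0b01, 0b00, 0b00, 0b01, 0b01, 0b10, 0b00, 0b00,
      0b11, 0b01, 0b11, 0b00, 0b01, 0b11, 0b10, 0b01, 0b01], 36, 402, 36⟩,
    ⟨.G1, [0b10, 0b10, 0b01, 0b00, 0b11, 0b01, 0b01, 0b01, 0b11,
      0b10, 0b00, 0b01, 0b00, 0b00, 0b11, 0b10, 0b00, 0b11], 36, 444, 36⟩,
    ⟨.G1, [0b01, 0b10, 0b01, 0b11, 0b00, 0b11, 0b10, 0b11, 0b11,
      0b00, 0b10, 0b00, 0b01, 0b10, 0b01, 0b00, 0b10, 0b00], 36, 453, 72⟩,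
    ⟨.G1, [0b11, 0b00, 0b10, 0b01, 0b00, 0b00, 0b00, 0b01, 0b11,
      0b00, 0b10, 0b10, 0b01, 0b11, 0b10, 0b01, 0b11, 0b10], 36, 462, 36⟩,
    ⟨.G1, [0b01, 0b11, 0b01, 0b00, 0b11, 0b11, 0b10, 0b10, 0b01,
      0b11, 0b01, 0b01, 0b00, 0b00, 0b01, 0b11, 0b10, 0b11], 36, 477, 36⟩,
    ⟨.G1, [0b00, 0b00, 0b01, 0b01, 0b11, 0b01, 0b10, 0b11, 0b11,
      0b00, 0b01, 0b01, 0b10, 0b11, 0b00, 0b10, 0b00, 0b01], 36, 489, 36⟩,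
    ⟨.G1, [0b11, 0b01, 0b10, 0b10, 0b01, 0b11, 0b01, 0b01, 0b00,
      0b11, 0b00, 0b10, 0b01, 0b01, 0b00, 0b00, 0b00, 0b11], 36, 507, 36⟩,
    ⟨.G1, [0b00, 0b00, 0b00, 0b10, 0b01, 0b10, 0b11, 0b01, 0b10,
      0b00, 0b01, 0b10, 0b00, 0b01, 0b11, 0b11, 0b11, 0b01], 36, 516, 36⟩,
    ⟨.G1, [0b11, 0b00, 0b10, 0b11, 0b11, 0b00, 0b00, 0b10, 0b10,
      0b10, 0b10, 0b01, 0b11, 0b00, 0b00, 0b10, 0b01, 0b01], 36, 525, 36⟩,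
    ⟨.G1, [0b11, 0b11, 0b00, 0b10, 0b01, 0b11, 0b11, 0b11, 0b10,
      0b10, 0b00, 0b10, 0b00, 0b01, 0b01, 0b10, 0b11, 0b01], 36, 534, 36⟩,
    ⟨.G1, [0b01, 0b10, 0b11, 0b00, 0b01, 0b11, 0b01, 0b11, 0b00,
      0b00, 0b11, 0b00, 0b10, 0b10, 0b01, 0b01, 0b00, 0b10], 36, 582, 36⟩,
    ⟨.G1, [0b00, 0b01, 0b11, 0b10, 0b01, 0b00, 0b00, 0b01, 0b10,
      0b11, 0b10, 0b00, 0b11, 0b00, 0b11, 0b10, 0b10, 0b01], 36, 588, 36⟩,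
    ⟨.G1, [0b11, 0b10, 0b00, 0b00, 0b00, 0b01, 0b10, 0b01, 0b10,
      0b01, 0b00, 0b00, 0b10, 0b11, 0b10, 0b11, 0b11, 0b10], 36, 600, 36⟩,
    ⟨.G1, [0b00, 0b01, 0b11, 0b00, 0b00, 0b01, 0b10, 0b01, 0b10,
      0b11, 0b00, 0b10, 0b11, 0b01, 0b00, 0b11, 0b10, 0b10], 36, 606, 36⟩,
    ⟨.G1, [0b00, 0b11, 0b11, 0b01, 0b10, 0b10, 0b11, 0b01, 0b11,
      0b11, 0b01, 0b01, 0b00, 0b11, 0b01, 0b01, 0b00, 0b01], 36, 624, 36⟩,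
    ⟨.G1, [0b00, 0b10, 0b00, 0b00, 0b11, 0b10, 0b10, 0b01, 0b00,
      0b11, 0b10, 0b01, 0b01, 0b11, 0b10, 0b00, 0b11, 0b01], 36, 663, 36⟩,
    ⟨.G1, [0b01, 0b11, 0b00, 0b01, 0b10, 0b01, 0b10, 0b11, 0b01,
      0b01, 0b10, 0b00, 0b00, 0b11, 0b00, 0b11, 0b00, 0b10], 54, 651, 36⟩,
    ⟨.G1, [0b00, 0b10, 0b11, 0b11, 0b10, 0b00, 0b00, 0b11, 0b01,
      0b01, 0b00, 0b10, 0b01, 0b01, 0b00, 0b11, 0b10, 0b10], 54, 657, 36⟩,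
    ⟨.G1p, [0b10, 0b01, 0b10, 0b10, 0b00, 0b11, 0b10, 0b00, 0b11,
      0b101, 0b011, 0b000, 0b000, 0b101, 0b001, 0b110, 0b110, 0b010], 0, 282, 18⟩,
    ⟨.G1p, [0b00, 0b00, 0b11, 0b01, 0b00, 0b11, 0b01, 0b00, 0b01,
      0b101, 0b001, 0b100, 0b110, 0b110, 0b111, 0b101, 0b010, 0b000], 9, 192, 18⟩,
    ⟨.G1p, [0b01, 0b10, 0b00, 0b01, 0b10, 0b10, 0b00, 0b01, 0b11,
      0b101, 0b100, 0b101, 0b001, 0b111, 0b110, 0b001, 0b011, 0b101], 9, 210, 18⟩,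
    ⟨.G1p, [0b00, 0b10, 0b10, 0b11, 0b10, 0b11, 0b00, 0b11, 0b11,
      0b111, 0b010, 0b010, 0b111, 0b110, 0b101, 0b011, 0b001, 0b001], 9, 225, 18⟩,
    ⟨.G1p, [0b00, 0b11, 0b11, 0b01, 0b10, 0b11, 0b00, 0b01, 0b01,
      0b010, 0b011, 0b001, 0b110, 0b000, 0b110, 0b001, 0b011, 0b001], 9, 228, 18⟩,
    ⟨.G1p, [0b01, 0b00, 0b11, 0b01, 0b00, 0b11, 0b00, 0b01, 0b01,
      0b100, 0b110, 0b001, 0b000, 0b110, 0b101, 0b011, 0b001, 0b110], 9, 255, 18⟩,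
    ⟨.G1p, [0b10, 0b10, 0b01, 0b00, 0b00, 0b00, 0b10, 0b10, 0b01,
      0b001, 0b011, 0b101, 0b001, 0b111, 0b110, 0b110, 0b011, 0b110], 9, 258, 18⟩,
    ⟨.G1p, [0b10, 0b01, 0b00, 0b10, 0b10, 0b10, 0b11, 0b01, 0b01,
      0b010, 0b101, 0b011, 0b001, 0b110, 0b111, 0b110, 0b101, 0b111], 9, 261, 18⟩,
    ⟨.G1p, [0b10, 0b10, 0b01, 0b00, 0b11, 0b01, 0b01, 0b11, 0b11,
      0b010, 0b100, 0b101, 0b101, 0b000, 0b110, 0b010, 0b111, 0b101], 9, 270, 18⟩,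
    ⟨.G1p, [0b00, 0b00, 0b11, 0b11, 0b11, 0b10, 0b10, 0b10, 0b01,
      0b111, 0b010, 0b101, 0b100, 0b010, 0b101, 0b011, 0b101, 0b110], 9, 282, 18⟩,
    ⟨.G1p, [0b01, 0b00, 0b11, 0b00, 0b01, 0b11, 0b00, 0b01, 0b01,
      0b001, 0b011, 0b001, 0b110, 0b100, 0b101, 0b110, 0b000, 0b110], 9, 318, 18⟩,
    ⟨.G1p, [0b10, 0b01, 0b10, 0b00, 0b10, 0b00, 0b10, 0b10, 0b11,
      0b101, 0b111, 0b101, 0b001, 0b011, 0b110, 0b001, 0b100, 0b101], 9, 336, 18⟩,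
    ⟨.G1p, [0b11, 0b10, 0b10, 0b10, 0b11, 0b00, 0b01, 0b01, 0b10,
      0b011, 0b010, 0b101, 0b100, 0b101, 0b101, 0b000, 0b001, 0b101], 18, 393, 18⟩,
    ⟨.G1pp, [0b00, 0b101, 0b11, 0b000, 0b10, 0b000, 0b10, 0b110, 0b00,
      0b110, 0b01, 0b011, 0b10, 0b111, 0b10, 0b101, 0b10, 0b000], 9, 252, 18⟩,
    ⟨.G1ppp, [0b011, 0b101, 0b110, 0b111, 0b101, 0b010, 0b100, 0b101, 0b010,
      0b01, 0b00, 0b10, 0b01, 0b00, 0b11, 0b00, 0b01, 0b00], 9, 291, 18⟩,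
    ⟨.G1ppp, [0b110, 0b100, 0b010, 0b010, 0b000, 0b110, 0b010, 0b111, 0b001,
      0b01, 0b01, 0b00, 0b00, 0b11, 0b11, 0b01, 0b11, 0b11], 9, 300, 18⟩,
    ⟨.G1pppp, [0b111, 0b110, 0b011, 0b111, 0b110, 0b011, 0b100, 0b110, 0b110,
      0b111, 0b010, 0b011, 0b111, 0b001, 0b110, 0b001, 0b010, 0b101], 9, 213, 18⟩,
    ⟨.G1pppp, [0b011, 0b011, 0b101, 0b000, 0b000, 0b110, 0b100, 0b010, 0b001,
      0b011, 0b101, 0b110, 0b100, 0b000, 0b011, 0b100, 0b110, 0b101], 9, 246, 18⟩,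
    ⟨.G1pppp, [0b010, 0b000, 0b000, 0b001, 0b010, 0b101, 0b010, 0b110, 0b010,
      0b111, 0b100, 0b101, 0b010, 0b100, 0b010, 0b100, 0b010, 0b101], 9, 279, 18⟩,
    ⟨.G1pppp, [0b101, 0b101, 0b110, 0b101, 0b110, 0b000, 0b101, 0b011, 0b011,
      0b100, 0b001, 0b111, 0b010, 0b100, 0b100, 0b100, 0b001, 0b001], 9, 288, 18⟩,
    ⟨.G1pppp, [0b111, 0b100, 0b010, 0b111, 0b100, 0b001, 0b010, 0b111, 0b100,
      0b111, 0b111, 0b010, 0b001, 0b111, 0b010, 0b001, 0b111, 0b001], 9, 315, 18⟩,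
    ⟨.G1pppp, [0b011, 0b010, 0b000, 0b001, 0b011, 0b100, 0b111, 0b111, 0b111,
      0b010, 0b000, 0b100, 0b011, 0b010, 0b000, 0b101, 0b101, 0b011], 9, 324, 18⟩,
    ⟨.G1pppp, [0b010, 0b010, 0b110, 0b000, 0b010, 0b000, 0b010, 0b011, 0b101,
      0b111, 0b101, 0b000, 0b110, 0b111, 0b110, 0b101, 0b110, 0b101], 9, 354, 18⟩,
    ⟨.G1pppp, [0b000, 0b110, 0b110, 0b001, 0b101, 0b100, 0b101, 0b111, 0b010,
      0b010, 0b011, 0b111, 0b000, 0b111, 0b011, 0b001, 0b111, 0b111], 9, 357, 18⟩,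
    ⟨.G1pppp, [0b000, 0b110, 0b011, 0b111, 0b101, 0b110, 0b111, 0b000, 0b110,
      0b111, 0b001, 0b001, 0b001, 0b010, 0b100, 0b000, 0b011, 0b000], 27, 354, 18⟩,
    ⟨.G1pppp, [0b011, 0b011, 0b101, 0b011, 0b001, 0b011, 0b111, 0b110, 0b100,
      0b100, 0b011, 0b010, 0b001, 0b000, 0b100, 0b100, 0b010, 0b100], 27, 405, 18⟩,
    ⟨.G1pppp, [0b001, 0b010, 0b011, 0b010, 0b010, 0b110, 0b000, 0b000, 0b110,
      0b001, 0b001, 0b000, 0b110, 0b101, 0b100, 0b001, 0b100, 0b001], 27, 444, 18⟩,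
    ⟨.G2, [0b00, 0b10, 0b01, 0b01, 0b00, 0b10, 0b10, 0b10, 0b00,
      0b11, 0b01, 0b00, 0b00, 0b00, 0b01, 0b00, 0b11, 0b10], 0, 270, 36⟩,
    ⟨.G2, [0b01, 0b11, 0b11, 0b00, 0b10, 0b11, 0b01, 0b10, 0b11,
      0b10, 0b10, 0b00, 0b00, 0b11, 0b01, 0b01, 0b10, 0b11], 18, 216, 36⟩,
    ⟨.G2, [0b01, 0b01, 0b00, 0b11, 0b10, 0b00, 0b00, 0b11, 0b10,
      0b10, 0b01, 0b10, 0b00, 0b01, 0b11, 0b00, 0b10, 0b11], 18, 249, 36⟩,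
    ⟨.G2, [0b00, 0b00, 0b01, 0b10, 0b11, 0b11, 0b01, 0b00, 0b10,
      0b01, 0b01, 0b01, 0b11, 0b10, 0b11, 0b11, 0b11, 0b10], 18, 309, 36⟩,
    ⟨.G2, [0b11, 0b10, 0b10, 0b10, 0b10, 0b00, 0b01, 0b11, 0b01,
      0b11, 0b10, 0b10, 0b00, 0b11, 0b00, 0b00, 0b00, 0b01], 18, 315, 36⟩,
    ⟨.G2, [0b10, 0b00, 0b00, 0b01, 0b01, 0b00, 0b01, 0b11, 0b01,
      0b10, 0b01, 0b10, 0b11, 0b11, 0b11, 0b00, 0b10, 0b00], 18, 327, 36⟩,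
    ⟨.G2, [0b00, 0b01, 0b10, 0b10, 0b11, 0b01, 0b11, 0b10, 0b10,
      0b11, 0b11, 0b00, 0b01, 0b01, 0b00, 0b00, 0b00, 0b01], 18, 354, 36⟩,
    ⟨.G2, [0b01, 0b01, 0b00, 0b11, 0b10, 0b00, 0b00, 0b11, 0b10,
      0b10, 0b10, 0b10, 0b00, 0b01, 0b11, 0b00, 0b10, 0b11], 18, 435, 36⟩,
    ⟨.G2, [0b11, 0b11, 0b00, 0b11, 0b00, 0b01, 0b11, 0b10, 0b10,
      0b11, 0b01, 0b10, 0b01, 0b10, 0b11, 0b10, 0b00, 0b10], 18, 468, 36⟩,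
    ⟨.G2, [0b10, 0b10, 0b00, 0b11, 0b11, 0b01, 0b11, 0b10, 0b10,
      0b11, 0b00, 0b10, 0b10, 0b00, 0b00, 0b01, 0b00, 0b10], 36, 420, 36⟩,
    ⟨.G2, [0b11, 0b01, 0b00, 0b11, 0b00, 0b11, 0b11, 0b10, 0b10,
      0b11, 0b01, 0b11, 0b01, 0b10, 0b10, 0b10, 0b00, 0b10], 36, 567, 36⟩,
    ⟨.G2, [0b10, 0b00, 0b11, 0b01, 0b11, 0b10, 0b10, 0b10, 0b01,
      0b10, 0b11, 0b10, 0b00, 0b10, 0b11, 0b00, 0b00, 0b00], 36, 615, 36⟩,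
    ⟨.G2, [0b10, 0b01, 0b01, 0b10, 0b10, 0b11, 0b01, 0b11, 0b11,
      0b00, 0b00, 0b00, 0b00, 0b10, 0b00, 0b01, 0b11, 0b10], 54, 642, 36⟩,
    ⟨.G2p, [0b110, 0b100, 0b101, 0b101, 0b111, 0b001, 0b010, 0b100, 0b110,
      0b00, 0b10, 0b00, 0b00, 0b11, 0b10, 0b00, 0b11, 0b00], 9, 273, 18⟩,
    ⟨.G2p, [0b110, 0b110, 0b100, 0b001, 0b010, 0b111, 0b001, 0b001, 0b000,
      0b11, 0b11, 0b00, 0b01, 0b01, 0b00, 0b01, 0b01, 0b01], 9, 297, 18⟩,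
    ⟨.G2p, [0b110, 0b011, 0b010, 0b001, 0b000, 0b110, 0b010, 0b000, 0b010,
      0b10, 0b00, 0b01, 0b00, 0b11, 0b11, 0b01, 0b00, 0b11], 9, 306, 18⟩,
    ⟨.G2p, [0b010, 0b110, 0b111, 0b001, 0b101, 0b100, 0b001, 0b010, 0b100,
      0b10, 0b00, 0b00, 0b10, 0b01, 0b10, 0b10, 0b11, 0b10], 9, 309, 18⟩,
    ⟨.G2pp, [0b001, 0b101, 0b100, 0b111, 0b100, 0b110, 0b110, 0b101, 0b110,
      0b100, 0b000, 0b101, 0b011, 0b100, 0b100, 0b100, 0b111, 0b010], 0, 465, 36⟩,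
    ⟨.G2pp, [0b110, 0b001, 0b000, 0b101, 0b000, 0b011, 0b000, 0b110, 0b100,
      0b011, 0b111, 0b100, 0b010, 0b000, 0b110, 0b010, 0b010, 0b100], 9, 342, 18⟩,
    ⟨.G2pp, [0b000, 0b100, 0b000, 0b011, 0b000, 0b111, 0b011, 0b100, 0b011,
      0b011, 0b010, 0b110, 0b111, 0b110, 0b110, 0b111, 0b001, 0b110], 9, 345, 18⟩,
    ⟨.G2pp, [0b000, 0b100, 0b101, 0b111, 0b101, 0b011, 0b100, 0b010, 0b110,
      0b101, 0b110, 0b111, 0b001, 0b100, 0b110, 0b111, 0b001, 0b010], 9, 375, 18⟩,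
    ⟨.G3, [0b10, 0b00, 0b11, 0b01, 0b11, 0b01, 0b10, 0b11, 0b10,
      0b10, 0b00, 0b10, 0b01, 0b10, 0b00, 0b11, 0b11, 0b11], 0, 135, 72⟩,
    ⟨.G4, [0b11, 0b11, 0b01, 0b11, 0b00, 0b00, 0b01, 0b01, 0b00,
      0b10, 0b11, 0b01, 0b10, 0b01, 0b11, 0b10, 0b11, 0b01], 0, 165, 72⟩,
    ⟨.G4p, [0b010, 0b101, 0b010, 0b000, 0b100, 0b100, 0b101, 0b110, 0b101,
      0b10, 0b10, 0b00, 0b00, 0b10, 0b11, 0b01, 0b11, 0b00], 18, 297, 36⟩,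
    ⟨.G4p, [0b110, 0b000, 0b011, 0b001, 0b001, 0b010, 0b000, 0b001, 0b110,
      0b01, 0b11, 0b00, 0b10, 0b10, 0b11, 0b01, 0b10, 0b11], 36, 378, 36⟩ ]

end SelfDual72

namespace SelfDual72

noncomputable section

/-! ### Bit-sliced enumeration of the vectors of small weight -/

/-! Part (a) is a comparison of indices: the block at `(i, j)` of `τ₂(v)` is `A_t` for the `t` with
`g_i g_t = g_j`, and `blockIndex` computes this `t`. For `M₂` the blocks of the lower half are
transposed, which symmetry of the blocks makes harmless.

For (b) one argument serves all rows; its finite part is the Boolean `checkRow`, and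
`rowClaim_of_checkRow` turns it into the claim.

If the rows of `[I | M]` have even weights and even overlaps, then `M Mᵀ = 1`, the code is self-dual
(`isSelfDual_codeOf`), and `[Mᵀ | I]` generates it as well. Both halves of the coordinates are
therefore information sets. A word of weight at most 11 has at most 5 ones in one half, so encoding
the 443704 messages of weight at most 5 from either side decides whether the minimum weight is at
least 12 (`twelve_le_norm`). Similarly, a word of weight at most 12 through a coordinate has in that
coordinate's half at most 5 further ones, or else at most 5 ones in the other half (`mem_wordList`).
Messages of weight at most 4 suffice to find the shadow vectors of weight at most 8
(`card_shadowWords`).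

Let `A_i` and `B_i` be the weight distributions of the code and of its shadow, the set of vectors
whose products with the codewords are the half weights modulo 2. The MacWilliams identity, plain and
twisted by half weights (`macwilliams`), gives `∑ A_i K_j(i) = |C| A_j` and `∑ (-1)^(i/2) A_i K_j(i)
= |C| B_j`. Two combinations of these for `j ≤ 10` are chosen so that nearly all unknown `A_i` drop
out, leaving `A₁₄` and `A₁₆` in terms of `A₁₂` and `γ = B₈` (`weightCount_fourteen`,
`weightCount_sixteen`). The value `A₁₂ = 2β` comes from counting incidences of words and
coordinates, one representative per orbit being enough (`twelve_mul_weightCount`).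

The visible symmetries of `M` generate a group having orbits of `α` coordinates each. For the upper
bound, the words of weight at most 12 through a coordinate `i` define hash values of all
coordinates, and automorphisms respect them. If the values attached to coordinate 0 are distinct,
only the identity fixes it; if the other representatives have a different hash value at themselves,
the full orbit of 0 is the known one. So the order is exactly `α` (`card_automorphismGroup`).

The enumerations are bit-sliced: for each coordinate, one large natural number holds its values at
all members of a family, so that a few bitwise operations treat the whole family at once. -/

structure Level where
  size : ℕ
  slices : List ℕ

/-- Bit `p` of a slice belongs to the `p`-th vector of the family, so concatenating families shifts
the second slice by the size `s` of the first. -/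
def appendSlices (s : ℕ) : List ℕ → List ℕ → List ℕ
  | a :: l, b :: l' => (a + b <<< s) :: appendSlices s l l'
  | _, _ => []

/-- The list runs through the weight bounds downwards to 0. With one more position, the vectors
avoiding it come first, followed by those using it, which may have one fewer one elsewhere. Hence
the new slice is a block of ones above a block of zeros. -/
def nextLevels : List Level → List Level
  | [] => []
  | [d] => [⟨1, 0 :: d.slices⟩]
  | d₁ :: d₀ :: ds =>
    ⟨d₁.size + d₀.size, ((1 <<< d₀.size - 1) <<< d₁.size) ::
      appendSlices d₁.size d₁.slices d₀.slices⟩ :: nextLevels (d₀ :: ds)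

def levels (k : ℕ) : ℕ → List Level
  | 0 => List.replicate (k + 1) ⟨1, []⟩
  | n + 1 => nextLevels (levels k n)

/-- The points at which masks are split in `sumTree`, one table for each number of remaining
positions; the reversal makes the weight bound the index. -/
def sizes (k : ℕ) : ℕ → List (List ℕ)
  | 0 => []
  | n + 1 => ((levels k n).map Level.size).reverse :: sizes k n

/-- Applied to slices, this evaluates one linear form at all members of a family. Here and below,
explicit recursors and bare `Nat` operations serve evaluation by the kernel. -/
def xorSelect (bs : List Bool) : List ℕ → ℕ → ℕ :=
  List.rec (motive := fun _ => List ℕ → ℕ → ℕ) (fun _ acc => acc)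
    (fun b _ ih xs acc => List.rec (motive := fun _ => ℕ) acc
      (fun x xs _ => ih xs (Bool.rec acc (Nat.xor acc x) b)) xs) bs

/-- The slices of `m N + u`: each column of `N` selects the slices of `m` to be added, and a bit 1
of `u` starts from the constant slice of ones. -/
def otherSlices (own : List ℕ) (ones : ℕ) : List (List Bool) → List Bool → List ℕ
  | c :: cs, b :: bs => xorSelect c own (cond b ones 0) :: otherSlices own ones cs bs
  | _, _ => []

/-- A chain of full adders acting on all members in parallel; the carries, of double weight, are
collected in the last list. -/
def carrySave : ℕ → List ℕ → List ℕ → ℕ × List ℕ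
  | s, b :: b' :: l, c =>
    carrySave (Nat.xor (Nat.xor s b) b') l
      (Nat.lor (Nat.land s b) (Nat.land (Nat.xor s b) b') :: c)
  | s, [b], c => (Nat.xor s b, Nat.land s b :: c)
  | s, [], c => (s, c)

/-- Each round yields one binary digit of the number of ones and roughly halves the number of
slices; the first argument bounds the number of rounds. -/
def counter : ℕ → List ℕ → List ℕ
  | f + 1, a :: l => (carrySave a l []).1 :: counter f (carrySave a l []).2
  | _, _ => []

/-- Comparison with `c` from the lowest digit upwards: the accumulator records whether the digits
read so far form a number not exceeding the corresponding digits of `c`. A digit where the two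
differ overrides it, and so does a nonzero rest of `c` after the last slice. -/
def leMask (ones : ℕ) : List ℕ → ℕ → ℕ → ℕ
  | [], c, acc => cond (Nat.beq c 0) acc ones
  | x :: l, c, acc => leMask ones l (c / 2)
      (cond (Nat.beq (c % 2) 0) (Nat.land (Nat.xor ones x) acc) (Nat.lor (Nat.xor ones x) acc))

def nth (l : List ℕ) : ℕ → ℕ :=
  List.rec (motive := fun _ => ℕ → ℕ) (fun _ => 0)
    (fun a _ ih n => Nat.rec (motive := fun _ => ℕ) a (fun m _ => ih m) n) l

/-- The recursive structure of the enumeration of sums of few generators. -/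
inductive SumTree
  | leaf
  | node (size gen : ℕ) (lower upper : SumTree)

def sumTree (gs : List ℕ) : List (List ℕ) → ℕ → SumTree :=
  List.rec (motive := fun _ => List (List ℕ) → ℕ → SumTree) (fun _ _ => .leaf)
    (fun x _ ih sss k => Nat.rec (motive := fun _ => SumTree) .leaf
      (fun k _ => .node (nth (sss.headD []) (Nat.succ k)) x (ih sss.tail (Nat.succ k))
        (ih sss.tail k)) k) gs

/-- The low `s` bits of the mask concern the sums without the generator, the others those with it.
Branches with zero mask are cut off, so the work follows the few selected members rather than the
whole family. -/
def extractTree (t : SumTree) : ℕ → ℕ → List ℕ → List ℕ :=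
  SumTree.rec (motive := fun _ => ℕ → ℕ → List ℕ → List ℕ)
    (fun m acc r => Bool.rec (acc :: r) r (Nat.beq m 0))
    (fun s x _ _ ih ih' m acc r => Bool.rec
      (ih (Nat.mod m (Nat.shiftLeft 1 s)) acc (ih' (Nat.shiftRight m s) (Nat.xor acc x) r)) r
        (Nat.beq m 0)) t

def extract (gs : List ℕ) (sss : List (List ℕ)) (k m acc : ℕ) (r : List ℕ) : List ℕ :=
  extractTree (sumTree gs sss k) m acc r

/-! ### Packed words -/

def packBits (bs : List Bool) : ℕ :=
  List.rec (motive := fun _ => ℕ) 0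
    (fun b _ ih => Nat.add (Bool.rec 0 1 b) (Nat.mul 16777216 ih)) bs

/-- Since `2 ^ 24 ≡ 1` modulo `2 ^ 24 - 1`, reduction yields the sum of the base `2 ^ 24` digits of
the bitwise product; for packed binary vectors this is the overlap. -/
def dot (x y : ℕ) : ℕ := Nat.mod (Nat.land x y) 16777215

/-- Any function would do for invariance. Values below `2 ^ 16` let 256 of them add up inside one
digit. -/
def hash (s : ℕ) : ℕ := Nat.mod (Nat.mul s s) 65521

/-- The product of `w` with `2 ^ 24 - 1` has full digits on the support of `w`, so `dot` sums the
digits of `v` there. The hash of this sum is then credited to every coordinate of the support. -/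
def refine (W : List ℕ) (v : ℕ) : ℕ :=
  List.rec (motive := fun _ => ℕ) 0
    (fun w _ ih => Nat.add (Nat.mul w (hash (dot v (Nat.mul w 16777215)))) ih) W

def onesVec (n : ℕ) : ℕ := packBits (List.replicate n true)

def invariant (W : List ℕ) : ℕ := refine W (refine W (refine W (onesVec 72)))

def digit (v i : ℕ) : ℕ := Nat.mod (Nat.shiftRight v (Nat.mul 24 i)) 16777216

def digitList (v : ℕ) (n : ℕ) : List ℕ := (List.range n).map (digit v)

def memb (a : ℕ) (l : List ℕ) : Bool :=
  List.rec (motive := fun _ => Bool) false (fun b _ ih => Bool.rec ih true (Nat.beq a b)) l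

def distinct (l : List ℕ) : Bool :=
  List.rec (motive := fun _ => Bool) true (fun a l ih => Bool.rec ih false (memb a l)) l

/-! ### Families of vectors -/

/-- A family of vectors in bit-sliced form: their number, and for each coordinate the number whose
binary digits are the values of that coordinate. -/
structure Family where
  size : ℕ
  slices : List ℕ

def Family.ones (F : Family) : ℕ := Nat.pred (1 <<< F.size)

/-- The vectors of length `n` with at most `k` ones. -/
def ball (n k : ℕ) : Family :=
  ⟨((levels k n).headD ⟨0, []⟩).size, ((levels k n).headD ⟨0, []⟩).slices⟩

def insertSlice (i : ℕ) (F : Family) : Family := ⟨F.size, F.slices.insertIdx i F.ones⟩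

def Family.other (F : Family) (cols : List (List Bool)) (off : List Bool) : List ℕ :=
  otherSlices F.slices F.ones cols off

/-- The members for which the number with the given bits is at most `c`. -/
def Family.le (F : Family) (bits : List ℕ) (c : ℕ) : ℕ := leMask F.ones bits c F.ones

/-- The data of one half of a systematic generator matrix: the packed generators, and the columns
of the complementary half. -/
structure Half where
  gens : List ℕ
  cols : List (List Bool)

def zeros : List Bool := List.replicate 36 false

def total (F : Family) (oth : List ℕ) : List ℕ := counter 7 (F.slices ++ oth)

/-- The zero vector heads the enumeration, so the value 1 means that it is the only member found. -/
def noLight (H : Half) : Bool :=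
  Nat.beq ((ball 36 5).le (total (ball 36 5) ((ball 36 5).other H.cols zeros)) 11) 1

/-- The words with at most 6 ones in the half containing `i`: the generator at `i` plus at most five
others. -/
def ownWords (H : Half) (i : ℕ) (F : Family) (r : List ℕ) : List ℕ :=
  extract (H.gens.eraseIdx i) (sizes 5 35) 5 (F.le (total F (F.other H.cols zeros)) 12)
    (nth H.gens i) r

/-- The complementary case: more than 6 ones in the half containing `i`, hence at most 5 in the half
from which these words are encoded. -/
def otherWords (H : Half) (i : ℕ) (F : Family) (oth : List ℕ) : List ℕ :=
  extract H.gens (sizes 5 36) 5 (Nat.land (nth oth i) (Nat.land (F.le (total F oth) 12)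
    (Nat.xor F.ones (F.le (counter 6 oth) 6)))) 0 []

def words (H H' : Half) (i : ℕ) : List ℕ :=
  ownWords H i (insertSlice i (ball 35 5))
    (otherWords H' i (ball 36 5) ((ball 36 5).other H'.cols zeros))

def shadowHeavy (F : Family) (oth : List ℕ) : Bool := Nat.beq (F.le (total F oth) 7) 0

/-- A vector of weight at most 8 with at most 4 ones in the first half is found from there; the
remaining ones, with more than 4 there, from the second half. The translation by a shadow vector is
omitted from the extracted words, since only their number is used. -/
def shadowWords (H H' : Half) (F : Family) (oth oth' : List ℕ) : List ℕ :=
  extract H.gens (sizes 4 36) 4 (F.le (total F oth) 8) 0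
    (extract H'.gens (sizes 4 36) 4 (Nat.land (F.le (total F oth') 8)
      (Nat.xor F.ones (F.le (counter 6 oth') 4))) 0 [])

/-! ### The generator matrices -/

def tab {α : Type} (f : ℕ → α) (n : ℕ) : List α :=
  Nat.rec (motive := fun _ => List α → List α) (fun l => l) (fun k ih l => ih (f k :: l)) n []

/-- The residue of `j - i` modulo `n`, arranged to avoid truncated subtraction. -/
def cyc (n i j : ℕ) : ℕ := Nat.mod (Nat.add j (Nat.sub n (Nat.mod i n))) n

/-- The block at `(I, J)` is the one with this number, counted from zero, or its transpose. -/
def blockIndex (κ : Kind) : ℕ → ℕ → ℕ :=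
  match κ with
  | .G1 | .G1p | .G1pp | .G1ppp | .G1pppp => fun I J =>
    cond (Nat.beq (Nat.div I 9) (Nat.div J 9)) (cyc 9 I J) (Nat.add 9 (Nat.mod (Nat.add I J) 9))
  | .G2 | .G2p | .G2pp => fun I J =>
    Nat.add (cond (Nat.beq (Nat.div I 9) (Nat.div J 9)) 0 9)
      (cond (Nat.ble 9 I) (cyc 9 J I) (cyc 9 I J))
  | .G3 => fun I J =>
    cond (Nat.ble (Nat.div I 3) (Nat.div J 3))
      (Nat.add (Nat.mul 3 (Nat.sub (Nat.div J 3) (Nat.div I 3))) (cyc 3 I J))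
      (Nat.add (Nat.mul 3 (Nat.sub (Nat.add 6 (Nat.div J 3)) (Nat.div I 3))) (cyc 3 (Nat.succ I) J))
  | .G4 | .G4p => fun I J => Nat.add (Nat.mul 6 (cyc 3 (Nat.div I 6) (Nat.div J 6))) (cyc 6 I J)

/-- The blocks in the lower half of `M₂` come from `Bᵀ` and `Aᵀ` and are transposed. -/
def blockFlip (κ : Kind) : ℕ → Bool :=
  match κ with
  | .G2 | .G2p | .G2pp => fun I => Nat.ble 9 I
  | _ => fun _ => false

def persymFlag (κ : Kind) : ℕ → Bool :=
  match κ with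
  | .G1 | .G2 | .G3 | .G4 => fun _ => false
  | .G1p => fun t => Nat.ble 9 t
  | .G1pp => fun t => Nat.beq (Nat.mod t 2) 1
  | .G1ppp | .G2p | .G4p => fun t => Nat.ble t 8
  | .G1pppp | .G2pp => fun _ => true

/-- The number of the binary digit which is the entry at `(a, b)` of a block. -/
def bitIndex (persym : Bool) (a b : ℕ) : ℕ :=
  Bool.rec (Bool.rec 0 1 (Nat.beq a b)) (Bool.rec (Bool.rec 0 1 (Nat.ble a b)) 2 (Nat.beq a b))
    persym

def bitAt (κ : Kind) (params : List ℕ) (flip : Bool) (a b t : ℕ) : Bool :=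
  Nat.beq (Nat.mod (Nat.shiftRight (nth params t)
    (Bool.rec (bitIndex (persymFlag κ t) a b) (bitIndex (persymFlag κ t) b a) flip)) 2) 1

def entry (κ : Kind) (params : List ℕ) (i j : ℕ) : Bool :=
  bitAt κ params (blockFlip κ (Nat.div i 2)) (Nat.mod i 2) (Nat.mod j 2)
    (blockIndex κ (Nat.div i 2) (Nat.div j 2))

def rowBits (κ : Kind) (params : List ℕ) (i : ℕ) : List Bool := tab (entry κ params i) 36

def columnBits (κ : Kind) (params : List ℕ) (j : ℕ) : List Bool :=
  tab (fun i => entry κ params i j) 36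

/-- The rows of `[I | M]`; the second half starts at bit `864 = 24 * 36`. -/
def leftHalf (κ : Kind) (params : List ℕ) : Half :=
  ⟨tab (fun i => Nat.add (Nat.shiftLeft 1 (Nat.mul 24 i))
    (Nat.mul (Nat.shiftLeft 1 864) (packBits (rowBits κ params i)))) 36, tab (columnBits κ params) 36⟩

/-- The rows of `[Mᵀ | I]`, which generate the same code once `M Mᵀ = 1`. -/
def rightHalf (κ : Kind) (params : List ℕ) : Half :=
  ⟨tab (fun j => Nat.add (packBits (columnBits κ params j))
    (Nat.mul (Nat.shiftLeft 1 864) (Nat.shiftLeft 1 (Nat.mul 24 j)))) 36,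
    tab (rowBits κ params) 36⟩

/-! ### The Boolean tests for one row of the table -/

def allEven (a : ℕ) (l : List ℕ) : Bool :=
  List.rec (motive := fun _ => Bool) true
    (fun b _ ih => Bool.rec ih false (Nat.beq (Nat.mod (dot a b) 2) 1)) l

/-- Any two members of the list, equal or not, have even intersection. -/
def selfOrthogonal (l : List ℕ) : Bool :=
  List.rec (motive := fun _ => Bool) true
    (fun a l ih => Bool.rec false ih (allEven a (a :: l))) l

/-- The generators with weight not divisible by four. -/
def oddHalves (l : List ℕ) : List Bool := l.map fun g => Nat.beq (Nat.mod (dot g g) 4) 2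

def rightBits (x : ℕ) : List Bool := tab (fun i => Nat.beq (digit x (Nat.add 36 i)) 1) 36

/-- In use, `q` is the vector of half weights of the rows of `[I | M]` and `u = q M`, so that `(q,
0)` and `(0, u)` lie in the shadow. All shadow weights agree modulo 4 with that of `u`. -/
def checkShadow (H H' : Half) (F : Family) (q u : List Bool) (γ : ℕ) : Bool :=
  Nat.beq (Nat.mod (dot (packBits u) (packBits u)) 4) 0 &&
  (shadowHeavy F (F.other H.cols u) && (shadowHeavy F (F.other H'.cols q) &&
    Nat.beq (shadowWords H H' F (F.other H.cols u) (F.other H'.cols q)).length γ))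

/-- Distinguishes the coordinate `i` from coordinate 0, whose own hash value is `v₀`. The bound 256
prevents carries between digits. -/
def checkLater (v₀ i : ℕ) (W : List ℕ) : Bool :=
  Nat.ble W.length 256 && !Nat.beq (digit (invariant W) i) v₀

def checkFirst (W : List ℕ) : Bool :=
  Nat.ble W.length 256 && distinct (digitList (invariant W) 72)

/-- The lists belong to the coordinates 0, 1, 36, 37; for `α = 72`, `36`, `18` the representatives
are 0, then 0 and 36, then all four. The numerical equation says that the incidences between
coordinates and words of weight 12 number `12 * A₁₂ = 24 * β`. -/
def checkWords (α β : ℕ) (W W₁ W' W'₁ : List ℕ) : Bool :=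
  checkFirst W &&
    bif Nat.beq α 72 then Nat.beq (72 * W.length) (24 * β)
    else checkLater (digit (invariant W) 0) 36 W' &&
      bif Nat.beq α 36 then Nat.beq (36 * (W.length + W'.length)) (24 * β)
      else checkLater (digit (invariant W) 0) 1 W₁ && (checkLater (digit (invariant W) 0) 37 W'₁ &&
        Nat.beq (18 * (W.length + W₁.length + W'.length + W'₁.length)) (24 * β))

def checkHalves (H H' : Half) (γ β α : ℕ) : Bool :=
  selfOrthogonal H.gens && (noLight H && (noLight H' &&
    (checkShadow H H' (ball 36 4) (oddHalves H.gens)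
      (rightBits (xorSelect (oddHalves H.gens) H.gens 0)) γ &&
    checkWords α β (words H H' 0) (words H H' 1) (words H' H 0) (words H' H 1))))

def check (r : TableRow) : Bool :=
  checkHalves (leftHalf r.kind r.params) (rightHalf r.kind r.params) r.γ r.β r.autOrder

end


/-! ### Masks -/

/-- The bit vector of the values of `p` along a list. -/
def maskOf {α : Type*} (p : α → Bool) : List α → ℕ
  | [] => 0
  | a :: l => Nat.bit (p a) (maskOf p l)

section Mask

variable {α β : Type*} (p q : α → Bool)

theorem testBit_maskOf (l : List α) (i : ℕ) : (maskOf p l).testBit i = (l[i]?).any p := by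
  induction l generalizing i with
  | nil => simp [maskOf]
  | cons a l ih => cases i with
    | zero => simp [maskOf]
    | succ i => simp [maskOf, Nat.testBit_bit_succ, ih]

theorem maskOf_congr {p q : α → Bool} {l : List α} (h : ∀ a ∈ l, p a = q a) :
    maskOf p l = maskOf q l := by
  induction l with
  | nil => rfl
  | cons a l ih =>
    simp only [maskOf, h a List.mem_cons_self, ih fun b hb => h b (List.mem_cons_of_mem a hb)]

theorem maskOf_map (f : β → α) (l : List β) : maskOf p (l.map f) = maskOf (p ∘ f) l := by
  induction l with
  | nil => rfl
  | cons a l ih => simp [maskOf, ih]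

theorem maskOf_lt (l : List α) : maskOf p l < 2 ^ l.length := by
  induction l with
  | nil => simp [maskOf]
  | cons a l ih =>
    simp only [maskOf, Nat.bit_val, List.length_cons, pow_succ]
    have := Bool.toNat_le (p a)
    omega

theorem maskOf_append (l l' : List α) :
    maskOf p (l ++ l') = maskOf p l + maskOf p l' <<< l.length := by
  induction l with
  | nil => simp [maskOf]
  | cons a l ih =>
    simp only [List.cons_append, maskOf, ih, Nat.bit_val, List.length_cons, Nat.shiftLeft_eq,
      pow_succ]
    ring

theorem maskOf_append_mod (l l' : List α) :
    maskOf p (l ++ l') % 1 <<< l.length = maskOf p l := by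
  rw [maskOf_append, Nat.shiftLeft_eq, Nat.shiftLeft_eq, one_mul, Nat.add_mul_mod_self_right,
    Nat.mod_eq_of_lt (maskOf_lt p l)]

theorem maskOf_append_shiftRight (l l' : List α) :
    maskOf p (l ++ l') >>> l.length = maskOf p l' := by
  rw [maskOf_append, Nat.shiftLeft_eq, Nat.shiftRight_eq_div_pow,
    Nat.add_mul_div_right _ _ (by positivity), Nat.div_eq_of_lt (maskOf_lt p l), zero_add]

theorem maskOf_xor (l : List α) :
    Nat.xor (maskOf p l) (maskOf q l) = maskOf (fun a => p a ^^ q a) l := by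
  apply Nat.eq_of_testBit_eq
  intro i
  change (maskOf p l ^^^ maskOf q l).testBit i = _
  rw [Nat.testBit_xor]
  simp only [testBit_maskOf]
  cases l[i]? <;> simp

theorem maskOf_land (l : List α) :
    Nat.land (maskOf p l) (maskOf q l) = maskOf (fun a => p a && q a) l := by
  apply Nat.eq_of_testBit_eq
  intro i
  change (maskOf p l &&& maskOf q l).testBit i = _
  rw [Nat.testBit_and]
  simp only [testBit_maskOf]
  cases l[i]? <;> simp

theorem maskOf_lor (l : List α) :
    Nat.lor (maskOf p l) (maskOf q l) = maskOf (fun a => p a || q a) l := by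
  apply Nat.eq_of_testBit_eq
  intro i
  change (maskOf p l ||| maskOf q l).testBit i = _
  rw [Nat.testBit_or]
  simp only [testBit_maskOf]
  cases l[i]? <;> simp

theorem maskOf_false (l : List α) : maskOf (fun _ => false) l = 0 := by
  induction l with
  | nil => rfl
  | cons a l ih => simp [maskOf, ih]

theorem maskOf_true (l : List α) : maskOf (fun _ => true) l = 1 <<< l.length - 1 := by
  induction l with
  | nil => rfl
  | cons a l ih =>
    simp only [maskOf, ih, Nat.bit_val, Nat.shiftLeft_eq, List.length_cons, pow_succ, one_mul]
    have : 0 < 2 ^ l.length := by positivity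
    simp; omega

theorem maskOf_eq_zero (l : List α) : maskOf p l = 0 ↔ ∀ a ∈ l, p a = false := by
  induction l with
  | nil => simp [maskOf]
  | cons a l ih => cases h : p a <;> simp [maskOf, h, ih, Nat.bit_val]

/-! ### Carry-save addition -/

/-- The number of predicates of a list which hold at `a`. -/
def countAt (ps : List (α → Bool)) (a : α) : ℕ := (ps.map fun p => (p a).toNat).sum

/-- The number whose binary digits, starting with the lowest one, are given at `a`. -/
def valueAt : List (α → Bool) → α → ℕ
  | [], _ => 0
  | b :: bs, a => (b a).toNat + 2 * valueAt bs a

def masks (E : List α) (ps : List (α → Bool)) : List ℕ := ps.map fun p => maskOf p E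

/-- A full adder preserves the sum when carries are counted twice; at most half of the slices,
rounded up, become new carries. -/
theorem carrySave_masks (E : List α) (s : α → Bool) (ps cs : List (α → Bool)) :
    ∃ s' cs', carrySave (maskOf s E) (masks E ps) (masks E cs) = (maskOf s' E, masks E cs') ∧
      (∀ a, (s' a).toNat + 2 * countAt cs' a = (s a).toNat + countAt ps a + 2 * countAt cs a) ∧
      cs'.length = cs.length + (ps.length + 1) / 2 := by
  induction h : ps.length using Nat.strong_induction_on generalizing s ps cs with
  | _ n ih =>
    match ps, h with
    | [], h => exact ⟨s, cs, rfl, by simp [countAt], by simp at h; simp [← h]⟩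
    | [b], h =>
      refine ⟨fun a => s a ^^ b a, (fun a => s a && b a) :: cs, ?_, ?_, ?_⟩
      · simp only [masks, carrySave, List.map_cons, List.map_nil, maskOf_xor, maskOf_land]
      · intro a
        simp only [countAt, List.map_cons, List.sum_cons, List.map_nil, List.sum_nil]
        cases s a <;> cases b a <;> (simp; try omega)
      · simp at h; simp [← h]
    | b :: b' :: ps, h =>
      simp only [List.length_cons] at h
      obtain ⟨s', cs', h1, h2, h3⟩ := ih ps.length (by omega) (fun a => (s a ^^ b a) ^^ b' a) ps
        ((fun a => (s a && b a) || ((s a ^^ b a) && b' a)) :: cs) rfl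
      refine ⟨s', cs', ?_, ?_, ?_⟩
      · rw [← h1]
        simp only [masks, carrySave, List.map_cons, maskOf_xor, maskOf_land, maskOf_lor]
      · intro a
        rw [h2]
        simp only [countAt, List.map_cons, List.sum_cons]
        cases s a <;> cases b a <;> cases b' a <;> simp <;> omega
      · rw [h3, List.length_cons]; omega

/-- A round turns fewer than `2 ^ (f + 1)` slices into one digit and fewer than `2 ^ f` carries, so
`f` rounds exhaust the list. -/
theorem counter_masks (E : List α) (f : ℕ) (ps : List (α → Bool)) (h : ps.length < 2 ^ f) :
    ∃ bs, counter f (masks E ps) = masks E bs ∧ ∀ a, valueAt bs a = countAt ps a := by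
  induction f generalizing ps with
  | zero =>
    have : ps = [] := List.length_eq_zero_iff.1 (by simpa using h)
    subst this
    exact ⟨[], rfl, by simp [valueAt, countAt]⟩
  | succ f ih =>
    cases ps with
    | nil => exact ⟨[], rfl, by simp [valueAt, countAt]⟩
    | cons p ps =>
      obtain ⟨s', cs', h1, h2, h3⟩ := carrySave_masks E p ps []
      simp only [List.length_cons, List.length_nil, pow_succ] at h h3
      obtain ⟨bs, h4, h5⟩ := ih cs' (by omega)
      refine ⟨s' :: bs, ?_, ?_⟩
      · have e : carrySave (maskOf p E) (masks E ps) [] = (maskOf s' E, masks E cs') := h1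
        simp only [masks, List.map_cons, counter]
        simp only [masks] at e h4
        rw [e, h4]
      · intro a
        have := h2 a
        simp only [valueAt, h5]
        simp only [countAt, List.map_cons, List.sum_cons, List.map_nil, List.sum_nil] at this ⊢
        omega

/-- The accumulator `q` decides whether equality is admitted: the test is `≤ c` where it holds and
`< c` where it does not. In this form the induction passes from `c` to `c / 2`. -/
theorem leMask_masks (E : List α) (bs : List (α → Bool)) (c : ℕ) (q : α → Bool) :
    leMask (maskOf (fun _ => true) E) (masks E bs) c (maskOf q E) =
      maskOf (fun a => decide (valueAt bs a < c + (q a).toNat)) E := by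
  induction bs generalizing c q with
  | nil =>
    rcases Nat.eq_zero_or_pos c with rfl | hc
    · simp only [masks, List.map_nil, leMask, valueAt]
      refine maskOf_congr fun a _ => ?_
      cases q a <;> rfl
    · have e : Nat.beq c 0 = false := by
        cases c with
        | zero => omega
        | succ c => rfl
      simp only [masks, List.map_nil, leMask, valueAt, e]
      refine maskOf_congr fun a _ => ?_
      simp; omega
  | cons b bs ih =>
    simp only [masks, List.map_cons, leMask]
    rcases Nat.mod_two_eq_zero_or_one c with hc | hc
    · rw [hc]
      simp only [show Nat.beq 0 0 = true from rfl, cond_true, maskOf_xor, maskOf_land]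
      refine (ih _ _).trans (maskOf_congr fun a _ => ?_)
      simp only [valueAt]
      refine decide_eq_decide.2 ?_
      cases q a <;> cases b a <;> simp <;> omega
    · rw [hc]
      simp only [show Nat.beq 1 0 = false from rfl, cond_false, maskOf_xor, maskOf_lor]
      refine (ih _ _).trans (maskOf_congr fun a _ => ?_)
      simp only [valueAt]
      refine decide_eq_decide.2 ?_
      cases q a <;> cases b a <;> simp <;> omega

theorem leMask_counter (E : List α) (f : ℕ) (ps : List (α → Bool)) (h : ps.length < 2 ^ f)
    (c : ℕ) :
    leMask (1 <<< E.length - 1) (counter f (masks E ps)) c (1 <<< E.length - 1) =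
      maskOf (fun a => decide (countAt ps a ≤ c)) E := by
  obtain ⟨bs, h1, h2⟩ := counter_masks E f ps h
  rw [h1, ← maskOf_true, leMask_masks]
  refine maskOf_congr fun a _ => ?_
  simp [h2]

end Mask


/-! ### Vectors of bounded weight -/

/-- The vectors with at most `k` ones, all at positions in `l`. -/
def comb {ι : Type*} [DecidableEq ι] : List ι → ℕ → List (ι → ZMod 2)
  | [], _ => [0]
  | _ :: _, 0 => [0]
  | x :: l, k + 1 => comb l (k + 1) ++ (comb l k).map (· + Pi.single x 1)

/-- Whether the coordinate at `i` is one. -/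
def on {ι : Type*} (i : ι) (m : ι → ZMod 2) : Bool := decide (m i = 1)

theorem zmod_two_eq_one_iff (x : ZMod 2) : x = 1 ↔ x ≠ 0 := by revert x; decide

theorem decide_add_eq_one (x y : ZMod 2) :
    decide (x + y = 1) = (decide (x = 1) ^^ decide (y = 1)) := by revert x y; decide

section Comb

variable {ι : Type*} [DecidableEq ι]

theorem comb_zero (l : List ι) : comb l 0 = [0] := by cases l <;> rfl

theorem comb_supported {l : List ι} {k : ℕ} {m : ι → ZMod 2} (hm : m ∈ comb l k) {i : ι}
    (hi : i ∉ l) : m i = 0 := by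
  induction l generalizing k m with
  | nil => simp [comb] at hm; simp [hm]
  | cons x l ih =>
    simp only [List.mem_cons, not_or] at hi
    cases k with
    | zero => simp [comb] at hm; simp [hm]
    | succ k =>
      simp only [comb, List.mem_append, List.mem_map] at hm
      rcases hm with hm | ⟨m, hm, rfl⟩
      · exact ih hm hi.2
      · simp [ih hm hi.2, hi.1]

theorem comb_nodup {l : List ι} (hl : l.Nodup) (k : ℕ) : (comb l k).Nodup := by
  induction l generalizing k with
  | nil => simp [comb]
  | cons x l ih =>
    rw [List.nodup_cons] at hl
    cases k with
    | zero => simp [comb]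
    | succ k =>
      refine List.Nodup.append (ih hl.2 _) ((ih hl.2 _).map fun a b h => by simpa using h) ?_
      intro m h1 h2
      simp only [List.mem_map] at h2
      obtain ⟨m, h2, rfl⟩ := h2
      have h3 := comb_supported h1 hl.1
      simp [comb_supported h2 hl.1] at h3

variable [Fintype ι]

theorem hammingNorm_add_single {m : ι → ZMod 2} {i : ι} (h : m i = 0) :
    hammingNorm (m + Pi.single i 1) = hammingNorm m + 1 := by
  unfold hammingNorm
  have : (Finset.univ.filter fun j => (m + Pi.single i 1 : ι → ZMod 2) j ≠ 0) =
      insert i (Finset.univ.filter fun j => m j ≠ 0) := by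
    ext j
    by_cases hj : j = i
    · subst hj; simp [h]
    · simp [hj]
  rw [this, Finset.card_insert_of_notMem (by simp [h])]

theorem mem_comb {l : List ι} (hl : l.Nodup) {k : ℕ} {m : ι → ZMod 2} :
    m ∈ comb l k ↔ (∀ i ∉ l, m i = 0) ∧ hammingNorm m ≤ k := by
  refine ⟨fun h => ⟨fun i hi => comb_supported h hi, ?_⟩, ?_⟩
  · induction l generalizing k m with
    | nil => simp [comb] at h; simp [h]
    | cons x l ih =>
      rw [List.nodup_cons] at hl
      cases k with
      | zero => simp [comb] at h; simp [h]
      | succ k =>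
        simp only [comb, List.mem_append, List.mem_map] at h
        rcases h with h | ⟨m, h, rfl⟩
        · exact ih hl.2 h
        · rw [hammingNorm_add_single (comb_supported h hl.1)]
          exact Nat.succ_le_succ (ih hl.2 h)
  · rintro ⟨h1, h2⟩
    induction l generalizing k m with
    | nil => simp [comb]; ext i; simp [h1 i]
    | cons x l ih =>
      rw [List.nodup_cons] at hl
      cases k with
      | zero => simpa [comb] using h2
      | succ k =>
        simp only [comb, List.mem_append, List.mem_map]
        by_cases hx : m x = 0
        · refine Or.inl (ih hl.2 (fun i hi => ?_) h2)
          by_cases hix : i = x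
          · rw [hix, hx]
          · exact h1 i (by simp [hi, hix])
        · have hx1 := (zmod_two_eq_one_iff _).2 hx
          have e : m + Pi.single x 1 + Pi.single x 1 = m := by
            funext j; simp [add_assoc, CharTwo.add_self_eq_zero]
          have h0 : (m + Pi.single x 1 : ι → ZMod 2) x = 0 := by
            simp [hx1]; rfl
          have h3 := hammingNorm_add_single h0
          rw [e] at h3
          refine Or.inr ⟨m + Pi.single x 1, ih hl.2 (fun i hi => ?_) (by omega), e⟩
          by_cases hix : i = x
          · rw [hix, h0]
          · simp [hix, h1 i (by simp [hi, hix])]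


end Comb

/-! ### Correctness of the tables -/

section Tables

variable {ι : Type*} [DecidableEq ι]

def levelOf (l : List ι) (k : ℕ) : Level :=
  ⟨(comb l k).length, l.map fun i => maskOf (on i) (comb l k)⟩

def levelsOf (l : List ι) : ℕ → List Level
  | 0 => [levelOf l 0]
  | k + 1 => levelOf l (k + 1) :: levelsOf l k

theorem maskOf_on_eq_zero {l : List ι} {i : ι} (hi : i ∉ l) (k : ℕ) :
    maskOf (on i) (comb l k) = 0 := by
  rw [maskOf_eq_zero]
  intro m hm
  simp [on, comb_supported hm hi]

theorem appendSlices_map {γ : Type*} (s : ℕ) (f g : γ → ℕ) (l : List γ) :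
    appendSlices s (l.map f) (l.map g) = l.map fun i => f i + g i <<< s := by
  induction l with
  | nil => rfl
  | cons a l ih => simp [appendSlices, ih]

theorem maskOf_comb_cons (p : (ι → ZMod 2) → Bool) (x : ι) (l : List ι) (k : ℕ) :
    maskOf p (comb (x :: l) (k + 1)) = maskOf p (comb l (k + 1)) +
      maskOf (fun m => p (m + Pi.single x 1)) (comb l k) <<< (comb l (k + 1)).length := by
  rw [comb, maskOf_append, maskOf_map]
  rfl

theorem levelOf_cons_zero (x : ι) (l : List ι) :
    levelOf (x :: l) 0 = ⟨1, 0 :: (levelOf l 0).slices⟩ := by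
  simp only [levelOf, comb_zero, List.length_singleton, List.map_cons]
  simp [maskOf, on]

theorem levelOf_cons_succ {x : ι} {l : List ι} (hx : x ∉ l) (k : ℕ) :
    levelOf (x :: l) (k + 1) = ⟨(levelOf l (k + 1)).size + (levelOf l k).size,
      ((1 <<< (levelOf l k).size - 1) <<< (levelOf l (k + 1)).size) ::
        appendSlices (levelOf l (k + 1)).size (levelOf l (k + 1)).slices (levelOf l k).slices⟩ := by
  simp only [levelOf, appendSlices_map, List.map_cons, maskOf_comb_cons, maskOf_on_eq_zero hx,
    zero_add, ← maskOf_true]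
  simp only [Level.mk.injEq, List.cons.injEq]
  refine ⟨by simp [comb], ?_, ?_⟩
  · rw [maskOf_congr (q := fun _ => true)]
    intro m hm
    simp [on, comb_supported hm hx]
  · refine List.map_congr_left fun i hi => ?_
    have : i ≠ x := fun h => hx (h ▸ hi)
    have e : (fun m : ι → ZMod 2 => on i (m + Pi.single x 1)) = on i := by
      funext m
      simp [on, this]
    rw [e]

/-- The new position must not occur in `l`: then its slice is zero on the vectors supported in `l`,
and adding it leaves the other slices unchanged. -/
theorem nextLevels_levelsOf {x : ι} {l : List ι} (hx : x ∉ l) (k : ℕ) :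
    nextLevels (levelsOf l k) = levelsOf (x :: l) k := by
  induction k with
  | zero => simp [levelsOf, nextLevels, levelOf_cons_zero]
  | succ k ih =>
    rw [levelsOf, levelsOf, levelOf_cons_succ hx, ← ih]
    cases k <;> simp [levelsOf, nextLevels]

theorem levels_length {l : List ι} (hl : l.Nodup) (k : ℕ) : levels k l.length = levelsOf l k := by
  induction l with
  | nil =>
    simp only [levels, List.length_nil]
    induction k with
    | zero => simp [levelsOf, levelOf, comb]
    | succ k ih => rw [List.replicate_succ, ih, levelsOf]; simp [levelOf, comb]
  | cons x l ih =>
    rw [List.nodup_cons] at hl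
    rw [List.length_cons, levels, ih hl.2, nextLevels_levelsOf hl.1]

theorem ball_length {l : List ι} (hl : l.Nodup) (k : ℕ) :
    ball l.length k = ⟨(levelOf l k).size, (levelOf l k).slices⟩ := by
  rw [ball, levels_length hl]
  cases k <;> rfl

theorem nth_eq_getD (l : List ℕ) (n : ℕ) : nth l n = l.getD n 0 := by
  induction l generalizing n with
  | nil => rfl
  | cons a l ih => cases n with
    | zero => rfl
    | succ n => exact (ih n).trans (by simp)

theorem nth_sizes (l : List ι) {k K : ℕ} (hk : k ≤ K) :
    nth ((levelsOf l K).map Level.size).reverse k = (comb l k).length := by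
  rw [nth_eq_getD]
  have hlen : ∀ K, (levelsOf l K).length = K + 1 := by
    intro K
    induction K with
    | zero => rfl
    | succ K ih => simp [levelsOf, ih]
  induction K with
  | zero =>
    obtain rfl : k = 0 := by omega
    rfl
  | succ K ih =>
    rw [levelsOf, List.map_cons, List.reverse_cons]
    rcases Nat.lt_or_ge k (K + 1) with h | h
    · rw [List.getD_append _ _ _ _ (by simp [hlen, h]), ih (by omega)]
    · obtain rfl : k = K + 1 := by omega
      rw [List.getD_append_right _ _ _ _ (by simp [hlen])]
      simp [hlen, levelOf]

/-- `comb` lists vectors without the first position before those with it, so splitting the mask at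
the size of the first part matches the two branches of the tree. The hypothesis on `φ` is what the
accumulated xor needs; `k ≤ K` keeps the lookups inside the table of sizes. -/
theorem extract_mask (φ : (ι → ZMod 2) → ℕ) (g : ι → ℕ)
    (hφ : ∀ m i, φ (m + Pi.single i 1) = Nat.xor (φ m) (g i)) {K : ℕ} {l : List ι} (hl : l.Nodup)
    {k : ℕ} (hk : k ≤ K) (p : (ι → ZMod 2) → Bool) (m₀ : ι → ZMod 2) (r : List ℕ) :
    extract (l.map g) (sizes K l.length) k (maskOf p (comb l k)) (φ m₀) r =
      ((comb l k).filter p).map (fun m => φ (m₀ + m)) ++ r := by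
  induction l generalizing k p m₀ r with
  | nil =>
    cases h : p 0
    · simp [extract, extractTree, sumTree, comb, maskOf, h]
    · simp [extract, extractTree, sumTree, comb, maskOf, h]
      rfl
  | cons x l ih =>
    rw [List.nodup_cons] at hl
    simp only [List.map_cons, List.length_cons, sizes, levels_length hl.2]
    by_cases h0 : maskOf p (comb (x :: l) k) = 0
    · have : (comb (x :: l) k).filter p = [] := by
        rw [List.filter_eq_nil_iff]
        intro a ha
        simp [(maskOf_eq_zero p _).1 h0 a ha]
      rw [this, h0]
      cases k <;> rfl
    · have hb : Nat.beq (maskOf p (comb (x :: l) k)) 0 = false := by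
        cases h : maskOf p (comb (x :: l) k) with
        | zero => exact absurd h h0
        | succ n => rfl
      cases k with
      | zero =>
        have hp : p 0 = true := by
          by_contra h
          exact h0 ((maskOf_eq_zero p _).2 (by simpa [comb] using h))
        change (Bool.rec (φ m₀ :: r) r (Nat.beq _ 0) : List ℕ) = _
        rw [hb]
        simp [comb, hp]
      | succ k =>
        change (Bool.rec (extract (l.map g) (sizes K l.length) (k + 1)
          (maskOf p (comb (x :: l) (k + 1)) %
            1 <<< nth ((levelsOf l K).map Level.size).reverse (k + 1)) (φ m₀)
          (extract (l.map g) (sizes K l.length) k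
          (maskOf p (comb (x :: l) (k + 1)) >>>
            nth ((levelsOf l K).map Level.size).reverse (k + 1)) (Nat.xor (φ m₀) (g x)) r)) r
              (Nat.beq _ 0) : List ℕ) = _
        rw [hb, nth_sizes l hk, comb, maskOf_append_mod, maskOf_append_shiftRight, maskOf_map,
          ← hφ]
        dsimp only
        rw [ih hl.2 hk, ih hl.2 (by omega), List.filter_append, List.map_append,
          List.append_assoc, List.filter_map, List.map_map]
        congr 2
        refine List.map_congr_left fun m _ => ?_
        simp only [Function.comp_apply, add_assoc, add_comm (Pi.single x (1 : ZMod 2)) m]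

end Tables

/-! ### Families of messages -/

section Scan

abbrev Message := Fin 36 → ZMod 2

/-- A family given in bit-sliced form. -/
structure Family.Enumerates (F : Family) (E : List Message) : Prop where
  size_eq : F.size = E.length
  slices_eq : F.slices = (List.finRange 36).map fun i => maskOf (on i) E

theorem Family.Enumerates.ones_eq {F : Family} {E : List Message} (h : F.Enumerates E) :
    F.ones = 1 <<< E.length - 1 := by
  rw [Family.ones, h.size_eq]
  rfl

theorem ball_enumerates (k : ℕ) : (ball 36 k).Enumerates (comb (List.finRange 36) k) := by
  have h := ball_length (List.nodup_finRange 36) k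
  rw [List.length_finRange] at h
  rw [h]
  exact ⟨rfl, rfl⟩

theorem insertIdx_eraseIdx_self {γ : Type*} (l : List γ) (i : ℕ) (h : i < l.length) :
    (l.eraseIdx i).insertIdx i l[i] = l := by
  induction l generalizing i with
  | nil => simp at h
  | cons a l ih => cases i with
    | zero => simp
    | succ i => simp [ih i (by simpa using h)]

theorem mem_eraseIdx_finRange : ∀ i j : Fin 36, j ∈ (List.finRange 36).eraseIdx i ↔ j ≠ i := by
  decide +kernel

/-- The messages containing `i` with at most `k` further ones. -/
def through (i : Fin 36) (k : ℕ) : List Message :=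
  (comb ((List.finRange 36).eraseIdx i) k).map (Pi.single i 1 + ·)

/-- The 35 slices refer to the positions other than `i` in their order; inserting the constant slice
at index `i` restores all 36. -/
theorem insertSlice_enumerates (i : Fin 36) (k : ℕ) :
    (insertSlice i (ball 35 k)).Enumerates (through i k) := by
  have h := ball_length ((List.nodup_finRange 36).eraseIdx (i : ℕ)) k
  have hi : (i : ℕ) < (List.finRange 36).length := by simp
  rw [List.length_eraseIdx_of_lt hi, List.length_finRange] at h
  rw [insertSlice, h]
  refine ⟨by simp [through, levelOf], ?_⟩
  simp only [levelOf, Family.ones]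
  rw [show ∀ n, Nat.pred (1 <<< n) = 1 <<< n - 1 from fun n => rfl, ← maskOf_true]
  have e : ∀ j : Fin 36, maskOf (on j) (through i k) =
      if j = i then maskOf (fun _ => true) (comb ((List.finRange 36).eraseIdx i) k)
      else maskOf (on j) (comb ((List.finRange 36).eraseIdx i) k) := by
    intro j
    rw [through, maskOf_map]
    split_ifs with hj
    · refine maskOf_congr fun m hm => ?_
      have := comb_supported hm (i := i) (by simp [mem_eraseIdx_finRange])
      simp [on, hj, this]
    · refine maskOf_congr fun m hm => ?_
      simp [on, hj]
  rw [← insertIdx_eraseIdx_self ((List.finRange 36).map fun j => maskOf (on j) (through i k)) i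
    (by simp)]
  simp only [List.getElem_map, List.getElem_finRange, List.eraseIdx_map]
  congr 1
  · refine List.map_congr_left fun j hj => ?_
    rw [e, if_neg ((mem_eraseIdx_finRange i j).1 hj)]
  · rw [e, if_pos]
    rfl

theorem xorSelect_masks (E : List Message) (N : Fin 36 → ZMod 2) (l : List (Fin 36))
    (c : Message → ZMod 2) :
    xorSelect (l.map fun i => decide (N i = 1)) (l.map fun i => maskOf (on i) E)
        (maskOf (fun m => decide (c m = 1)) E) =
      maskOf (fun m => decide (c m + (l.map fun i => m i * N i).sum = 1)) E := by
  induction l generalizing c with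
  | nil => simp [xorSelect]
  | cons i l ih =>
    simp only [List.map_cons, List.sum_cons]
    have e : (Bool.rec (maskOf (fun m => decide (c m = 1)) E)
        (Nat.xor (maskOf (fun m => decide (c m = 1)) E) (maskOf (on i) E))
          (decide (N i = 1)) : ℕ) = maskOf (fun m => decide (c m + m i * N i = 1)) E := by
      rw [maskOf_xor]
      by_cases h : N i = 1
      · simp only [h, decide_true, mul_one]
        refine maskOf_congr fun m _ => ?_
        rw [decide_add_eq_one, on]
      · have h0 : N i = 0 := by
          by_contra h'
          exact h ((zmod_two_eq_one_iff _).2 h')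
        simp [h0]
    change xorSelect (l.map fun i => decide (N i = 1)) (l.map fun i => maskOf (on i) E)
      (Bool.rec _ _ (decide (N i = 1))) = _
    rw [e, ih]
    simp only [add_assoc]

/-- The bits of a vector. -/
def bits {n : ℕ} (u : Fin n → ZMod 2) : List Bool :=
  (List.finRange n).map fun j => decide (u j = 1)

/-- The bits of a matrix, column by column. -/
def colBits {m n : ℕ} (N : Matrix (Fin m) (Fin n) (ZMod 2)) : List (List Bool) :=
  (List.finRange n).map fun j => bits fun i => N i j

theorem otherSlices_map {γ : Type*} (own : List ℕ) (ones : ℕ) (l : List γ) (f : γ → List Bool)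
    (g : γ → Bool) : otherSlices own ones (l.map f) (l.map g) =
      l.map fun j => xorSelect (f j) own (cond (g j) ones 0) := by
  induction l with
  | nil => rfl
  | cons a l ih => simp [otherSlices, ih]

theorem other_eq {F : Family} {E : List Message} (h : F.Enumerates E)
    (N : Matrix (Fin 36) (Fin 36) (ZMod 2)) (u : Message) :
    F.other (colBits N) (bits u) =
      (List.finRange 36).map fun j => maskOf (fun m => on j (m ᵥ* N + u)) E := by
  rw [Family.other, colBits, bits, otherSlices_map, h.slices_eq, h.ones_eq, ← maskOf_true]
  refine List.map_congr_left fun j _ => ?_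
  have e : (cond (decide (u j = 1)) (maskOf (fun _ => true) E) 0) =
      maskOf (fun m => decide ((fun _ => u j : Message → ZMod 2) m = 1)) E := by
    by_cases hu : u j = 1
    · simp [hu]
    · simp [hu, maskOf_false]
  rw [e, bits, xorSelect_masks]
  refine maskOf_congr fun m _ => ?_
  simp [on, Matrix.vecMul, dotProduct, Fin.sum_univ_def, add_comm]

theorem hammingNorm_eq_sum {n : ℕ} (x : Fin n → ZMod 2) :
    ((List.finRange n).map fun j => (on j x).toNat).sum = hammingNorm x := by
  rw [← Fin.sum_univ_def, hammingNorm, Finset.card_filter]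
  refine Finset.sum_congr rfl fun j _ => ?_
  by_cases h : x j = 0
  · simp [on, h]
  · simp [on, (zmod_two_eq_one_iff _).2 h]

theorem le_counter_eq {F : Family} {E : List Message} (h : F.Enumerates E)
    (x : Message → Message) {f : ℕ} (hf : 36 < 2 ^ f) (c : ℕ) :
    F.le (counter f ((List.finRange 36).map fun j => maskOf (fun m => on j (x m)) E)) c =
      maskOf (fun m => decide (hammingNorm (x m) ≤ c)) E := by
  have := leMask_counter E f ((List.finRange 36).map fun j m => on j (x m)) (by simpa using hf) c
  rw [masks, List.map_map] at this
  rw [Family.le, h.ones_eq]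
  refine this.trans (maskOf_congr fun m _ => ?_)
  simp [countAt, List.map_map, Function.comp_def, ← hammingNorm_eq_sum]

/-- Seven rounds of counting suffice for the 72 slices of both halves, as `72 < 2 ^ 7`. -/
theorem le_total_eq {F : Family} {E : List Message} (h : F.Enumerates E)
    (x : Message → Message) (c : ℕ) :
    F.le (total F ((List.finRange 36).map fun j => maskOf (fun m => on j (x m)) E)) c =
      maskOf (fun m => decide (hammingNorm m + hammingNorm (x m) ≤ c)) E := by
  have := leMask_counter E 7 (((List.finRange 36).map fun j => on j) ++
    ((List.finRange 36).map fun j m => on j (x m))) (by simp) c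
  rw [masks, List.map_append, List.map_map, List.map_map] at this
  rw [Family.le, h.ones_eq, total, h.slices_eq]
  refine this.trans (maskOf_congr fun m _ => ?_)
  simp [countAt, List.map_map, Function.comp_def, ← hammingNorm_eq_sum]

end Scan

/-! ### Packed words -/

/-- The number with the digits `f 0, f 1, …` in base `2 ^ 24`, starting with the lowest one. -/
def packNat {n : ℕ} (f : Fin n → ℕ) : ℕ := Nat.ofDigits 16777216 ((List.finRange n).map f)

/-- The digit of a vector at a position. -/
def digitAt {ι : Type*} (c : ι → ZMod 2) (i : ι) : ℕ := (on i c).toNat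

def pack {n : ℕ} (c : Fin n → ZMod 2) : ℕ := packNat (digitAt c)

theorem ofDigits_map_mul {γ : Type*} (a : ℕ) (l : List γ) (f : γ → ℕ) :
    Nat.ofDigits 16777216 (l.map f) * a = Nat.ofDigits 16777216 (l.map fun i => f i * a) := by
  induction l with
  | nil => simp
  | cons i l ih => simp only [List.map_cons, Nat.ofDigits_cons, ← ih]; ring

theorem ofDigits_map_add {γ : Type*} (l : List γ) (f g : γ → ℕ) :
    Nat.ofDigits 16777216 (l.map f) + Nat.ofDigits 16777216 (l.map g) =
      Nat.ofDigits 16777216 (l.map fun i => f i + g i) := by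
  induction l with
  | nil => simp
  | cons i l ih => simp only [List.map_cons, Nat.ofDigits_cons, ← ih]; ring

theorem add_mul_mod_div (a x : ℕ) (ha : a < 16777216) :
    (a + 16777216 * x) % 2 ^ 24 = a ∧ (a + 16777216 * x) / 2 ^ 24 = x := by
  norm_num
  omega

/-- Bitwise operations act separately on the lowest 24 bits and on the rest. -/
theorem land_digits {a b x y : ℕ} (ha : a < 16777216) (hb : b < 16777216) :
    (a + 16777216 * x) &&& (b + 16777216 * y) = (a &&& b) + 16777216 * (x &&& y) := by
  have h := Nat.mod_add_div ((a + 16777216 * x) &&& (b + 16777216 * y)) (2 ^ 24)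
  rw [Nat.and_mod_two_pow, Nat.and_div_two_pow, (add_mul_mod_div a x ha).1,
    (add_mul_mod_div a x ha).2, (add_mul_mod_div b y hb).1, (add_mul_mod_div b y hb).2] at h
  exact h.symm

theorem xor_digits {a b x y : ℕ} (ha : a < 16777216) (hb : b < 16777216) :
    (a + 16777216 * x) ^^^ (b + 16777216 * y) = (a ^^^ b) + 16777216 * (x ^^^ y) := by
  have h := Nat.mod_add_div ((a + 16777216 * x) ^^^ (b + 16777216 * y)) (2 ^ 24)
  rw [Nat.xor_mod_two_pow, Nat.xor_div_two_pow, (add_mul_mod_div a x ha).1,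
    (add_mul_mod_div a x ha).2, (add_mul_mod_div b y hb).1, (add_mul_mod_div b y hb).2] at h
  exact h.symm

theorem land_ofDigits {γ : Type*} (l : List γ) {f g : γ → ℕ} (hf : ∀ i, f i < 16777216)
    (hg : ∀ i, g i < 16777216) :
    Nat.land (Nat.ofDigits 16777216 (l.map f)) (Nat.ofDigits 16777216 (l.map g)) =
      Nat.ofDigits 16777216 (l.map fun i => f i &&& g i) := by
  induction l with
  | nil => simp only [List.map_nil, Nat.ofDigits_nil]; rfl
  | cons i l ih =>
    simp only [List.map_cons, Nat.ofDigits_cons, ← ih]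
    exact land_digits (hf i) (hg i)

theorem xor_ofDigits {γ : Type*} (l : List γ) {f g : γ → ℕ} (hf : ∀ i, f i < 16777216)
    (hg : ∀ i, g i < 16777216) :
    Nat.xor (Nat.ofDigits 16777216 (l.map f)) (Nat.ofDigits 16777216 (l.map g)) =
      Nat.ofDigits 16777216 (l.map fun i => f i ^^^ g i) := by
  induction l with
  | nil => simp only [List.map_nil, Nat.ofDigits_nil]; rfl
  | cons i l ih =>
    simp only [List.map_cons, Nat.ofDigits_cons, ← ih]
    exact xor_digits (hf i) (hg i)

theorem digitAt_lt {ι : Type*} (c : ι → ZMod 2) (i : ι) : digitAt c i < 16777216 :=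
  (Bool.toNat_lt _).trans (by norm_num)

section

variable {n : ℕ}

theorem pack_add (a b : Fin n → ZMod 2) : pack (a + b) = Nat.xor (pack a) (pack b) := by
  rw [pack, pack, pack, packNat, packNat, packNat, xor_ofDigits _ (digitAt_lt a) (digitAt_lt b)]
  congr 2
  funext i
  simp only [digitAt, on, Pi.add_apply, decide_add_eq_one]
  cases decide (a i = 1) <;> cases decide (b i = 1) <;> rfl

theorem pack_zero : pack (0 : Fin n → ZMod 2) = 0 := by
  have : ∀ l : List (Fin n), Nat.ofDigits 16777216 (l.map (digitAt (0 : Fin n → ZMod 2))) = 0 := by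
    intro l
    induction l with
    | nil => rfl
    | cons i l ih => rw [List.map_cons, Nat.ofDigits_cons, ih]; simp [digitAt, on]
  exact this _

theorem packBits_bits (c : Fin n → ZMod 2) : packBits (bits c) = pack c := by
  have : ∀ l : List (Fin n), packBits (l.map fun j => decide (c j = 1)) =
      Nat.ofDigits 16777216 (l.map (digitAt c)) := by
    intro l
    induction l with
    | nil => rfl
    | cons i l ih =>
      rw [List.map_cons, List.map_cons, Nat.ofDigits_cons, ← ih]
      change Nat.add (Bool.rec 0 1 (decide (c i = 1))) _ = (decide (c i = 1)).toNat + _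
      cases decide (c i = 1) <;> rfl
  exact this _

theorem packNat_mod (f : Fin n → ℕ) : packNat f % 16777215 = (∑ i, f i) % 16777215 := by
  have := Nat.ofDigits_modEq' 16777216 1 16777215 (by decide) ((List.finRange n).map f)
  rw [Nat.ofDigits_one, ← Fin.sum_univ_def] at this
  exact this

/-- Masking a digit by `2 ^ 24 - 1` keeps it and masking by 0 deletes it, so exactly the digits on
the support of `w` are summed. -/
theorem dot_pack_mul {f : Fin n → ℕ} (hf : ∀ i, f i < 16777216) (w : Fin n → ZMod 2) :
    dot (packNat f) (Nat.mul (pack w) 16777215) =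
      (∑ i with w i = 1, f i) % 16777215 := by
  have e : Nat.mul (pack w) 16777215 =
    Nat.ofDigits 16777216 ((List.finRange n).map fun i => digitAt w i * 16777215) :=
    ofDigits_map_mul _ _ _
  rw [e, dot, packNat, land_ofDigits _ hf]
  · refine (packNat_mod _).trans ?_
    rw [Finset.sum_filter]
    congr 1
    refine Finset.sum_congr rfl fun i _ => ?_
    by_cases h : w i = 1
    · simp only [digitAt, on, h, decide_true, Bool.toNat_true, if_true, one_mul]
      exact (Nat.and_two_pow_sub_one_eq_mod (f i) 24).trans (Nat.mod_eq_of_lt (hf i))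
    · simp [digitAt, on, h]
  · intro i
    have := Bool.toNat_le (on i w)
    simp only [digitAt]
    omega

theorem dot_pack (a b : Fin n → ZMod 2) (hn : n < 16777215) :
    dot (pack a) (pack b) = (Finset.univ.filter fun i => a i = 1 ∧ b i = 1).card := by
  rw [dot, pack, pack, packNat, packNat, land_ofDigits _ (digitAt_lt a) (digitAt_lt b)]
  refine (packNat_mod _).trans ?_
  have e : (∑ i, (digitAt a i &&& digitAt b i)) =
      (Finset.univ.filter fun i => a i = 1 ∧ b i = 1).card := by
    rw [Finset.card_filter]
    refine Finset.sum_congr rfl fun i _ => ?_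
    by_cases ha : a i = 1 <;> by_cases hb : b i = 1 <;> simp [digitAt, on, ha, hb]
  rw [e, Nat.mod_eq_of_lt]
  exact ((Finset.card_filter_le _ _).trans (by simp)).trans_lt hn

theorem dot_pack_self (a : Fin n → ZMod 2) (hn : n < 16777215) :
    dot (pack a) (pack a) = hammingNorm a := by
  rw [dot_pack a a hn, hammingNorm]
  congr 1
  ext i
  simp [zmod_two_eq_one_iff]

theorem cast_dot_pack (a b : Fin n → ZMod 2) (hn : n < 16777215) :
    ((dot (pack a) (pack b) : ℕ) : ZMod 2) = a ⬝ᵥ b := by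
  rw [dot_pack a b hn, Finset.card_filter, dotProduct]
  push_cast
  refine Finset.sum_congr rfl fun i _ => ?_
  generalize a i = x
  generalize b i = y
  revert x y
  decide

theorem digit_packNat {f : Fin n → ℕ} (hf : ∀ i, f i < 16777216) (i : Fin n) :
    digit (packNat f) i = f i := by
  have key : ∀ (l : List (Fin n)) (k : ℕ) (hk : k < l.length),
      digit (Nat.ofDigits 16777216 (l.map f)) k = f l[k] := by
    intro l
    induction l with
    | nil => intro k hk; simp at hk
    | cons j l ih =>
      intro k hk
      rw [List.map_cons, Nat.ofDigits_cons]
      change ((_ : ℕ) >>> (24 * k)) % 16777216 = _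
      cases k with
      | zero =>
        have := hf j
        simp only [Nat.mul_zero, Nat.shiftRight_zero, List.getElem_cons_zero]
        omega
      | succ k =>
        rw [Nat.shiftRight_eq_div_pow, show 24 * (k + 1) = 24 + 24 * k by ring, pow_add,
          ← Nat.div_div_eq_div_mul, (add_mul_mod_div _ _ (hf j)).2,
          ← Nat.shiftRight_eq_div_pow]
        exact ih k (by simpa using hk)
  have h := key (List.finRange n) i (by simp)
  rw [List.getElem_finRange] at h
  exact h

theorem pack_append {m : ℕ} (a : Fin m → ZMod 2) (b : Fin n → ZMod 2) :
    pack (Fin.append a b) = pack a + 16777216 ^ m * pack b := by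
  have e : (List.finRange (m + n)).map (digitAt (Fin.append a b)) =
      (List.finRange m).map (digitAt a) ++ (List.finRange n).map (digitAt b) := by
    rw [← List.ofFn_eq_map, ← List.ofFn_eq_map, ← List.ofFn_eq_map, ← List.ofFn_fin_append]
    congr 1
    funext i
    refine Fin.addCases (fun i => ?_) (fun i => ?_) i <;> simp [digitAt, on]
  rw [pack, packNat, e, Nat.ofDigits_append]
  simp [pack, packNat]

/-! ### Hashing of families of words -/

/-- One round of hashing. -/
def hashStep (L : List (Fin n → ZMod 2)) (f : Fin n → ℕ) (k : Fin n) : ℕ :=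
  (L.map fun w => digitAt w k * hash ((∑ i with w i = 1, f i) % 16777215)).sum

theorem hash_lt (s : ℕ) : hash s < 65521 := Nat.mod_lt _ (by norm_num)

/-- At most 256 summands of at most 65520 stay below `2 ^ 24`. -/
theorem hashStep_lt {L : List (Fin n → ZMod 2)} (hL : L.length ≤ 256) (f : Fin n → ℕ)
    (k : Fin n) : hashStep L f k < 16777216 := by
  have : hashStep L f k ≤ L.length * 65520 := by
    unfold hashStep
    refine (List.sum_le_card_nsmul _ 65520 ?_).trans (by simp)
    simp only [List.mem_map]
    rintro _ ⟨w, _, rfl⟩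
    have h1 := Bool.toNat_le (on k w)
    have h2 := hash_lt ((∑ i with w i = 1, f i) % 16777215)
    simp only [digitAt]
    nlinarith
  have h3 : L.length * 65520 ≤ 256 * 65520 := Nat.mul_le_mul_right _ hL
  omega

theorem refine_pack (L : List (Fin n → ZMod 2)) {f : Fin n → ℕ} (hf : ∀ i, f i < 16777216) :
    refine (L.map pack) (packNat f) = packNat (hashStep L f) := by
  induction L with
  | nil =>
    have : ∀ l : List (Fin n), Nat.ofDigits 16777216 (l.map (hashStep [] f)) = 0 := by
      intro l
      induction l with
      | nil => rfl
      | cons i l ih => rw [List.map_cons, Nat.ofDigits_cons, ih]; simp [hashStep]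
    exact (this _).symm
  | cons w L ih =>
    change pack w * hash (dot (packNat f) (Nat.mul (pack w) 16777215)) +
      refine (L.map pack) (packNat f) = _
    rw [ih, dot_pack_mul hf, pack, packNat, ofDigits_map_mul, packNat, ofDigits_map_add]
    rfl

/-- Three rounds of hashing. -/
def hashFun (L : List (Fin n → ZMod 2)) : Fin n → ℕ :=
  hashStep L (hashStep L (hashStep L fun _ => 1))

theorem onesVec_eq : onesVec n = packNat fun _ : Fin n => 1 := by
  have h : ∀ l : List (Fin n), packBits (List.replicate l.length true) =
      Nat.ofDigits 16777216 (l.map fun _ => 1) := by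
    intro l
    induction l with
    | nil => rfl
    | cons i l ih =>
      rw [List.length_cons, List.replicate_succ, List.map_cons, Nat.ofDigits_cons, ← ih]
      rfl
  have := h (List.finRange n)
  rwa [List.length_finRange] at this

theorem digit_invariant {L : List (Fin 72 → ZMod 2)} (hL : L.length ≤ 256) (i : Fin 72) :
    digit (invariant (L.map pack)) i = hashFun L i := by
  rw [invariant, onesVec_eq, refine_pack L (fun _ => by norm_num),
    refine_pack L (hashStep_lt hL _), refine_pack L (hashStep_lt hL _),
    digit_packNat (hashStep_lt hL _)]
  rfl

theorem memb_eq (a : ℕ) (l : List ℕ) : memb a l = decide (a ∈ l) := by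
  induction l with
  | nil => rfl
  | cons b l ih =>
    change (Bool.rec (memb a l) true (Nat.beq a b) : Bool) = _
    cases h : Nat.beq a b with
    | false =>
      have : a ≠ b := Nat.ne_of_beq_eq_false h
      simp [ih, this]
    | true =>
      have : a = b := Nat.eq_of_beq_eq_true h
      simp [this]

theorem distinct_eq_true {l : List ℕ} : distinct l = true ↔ l.Nodup := by
  induction l with
  | nil => simp [distinct]
  | cons a l ih =>
    change (Bool.rec (distinct l) false (memb a l) : Bool) = true ↔ _
    rw [memb_eq, List.nodup_cons, ← ih]
    by_cases h : a ∈ l <;> simp [h]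

end


/-! ### Codes with systematic generator matrices -/

section Systematic

variable {n : ℕ}

def leftPart (c : Fin (n + n) → ZMod 2) : Fin n → ZMod 2 := fun i => c (Fin.castAdd n i)

def rightPart (c : Fin (n + n) → ZMod 2) : Fin n → ZMod 2 := fun i => c (Fin.natAdd n i)

theorem append_parts (c : Fin (n + n) → ZMod 2) : Fin.append (leftPart c) (rightPart c) = c := by
  funext i
  refine Fin.addCases (fun i => ?_) (fun i => ?_) i <;>
    simp [-Fin.natAdd_eq_addNat, leftPart, rightPart]

@[simp] theorem leftPart_append (a b : Fin n → ZMod 2) : leftPart (Fin.append a b) = a := by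
  funext i
  simp [leftPart]

@[simp] theorem rightPart_append (a b : Fin n → ZMod 2) : rightPart (Fin.append a b) = b := by
  funext i
  simp [rightPart, -Fin.natAdd_eq_addNat]

theorem dotProduct_eq_parts (a b : Fin (n + n) → ZMod 2) :
    a ⬝ᵥ b = leftPart a ⬝ᵥ leftPart b + rightPart a ⬝ᵥ rightPart b := by
  simp [dotProduct, Fin.sum_univ_add, leftPart, rightPart]

theorem hammingNorm_eq_parts (c : Fin (n + n) → ZMod 2) :
    hammingNorm c = hammingNorm (leftPart c) + hammingNorm (rightPart c) := by
  simp only [hammingNorm, Finset.card_filter, Fin.sum_univ_add]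
  rfl

variable (T : Matrix (Fin n) (Fin n) (ZMod 2))

theorem vecMul_generator (m : Fin n → ZMod 2) :
    m ᵥ* Matrix.reindex (Equiv.refl (Fin n)) finSumFinEquiv (Matrix.fromCols 1 T) =
      Fin.append m (m ᵥ* T) := by
  funext j
  refine Fin.addCases (fun j => ?_) (fun j => ?_) j <;>
    simp [-Fin.natAdd_eq_addNat, Matrix.vecMul, dotProduct, Matrix.one_apply]

theorem codeOf_eq_range : codeOf T = LinearMap.range (Matrix.vecMulLinear
    (Matrix.reindex (Equiv.refl (Fin n)) finSumFinEquiv (Matrix.fromCols 1 T))) := by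
  rw [range_vecMulLinear]
  rfl

theorem mem_codeOf {c : Fin (n + n) → ZMod 2} :
    c ∈ codeOf T ↔ rightPart c = leftPart c ᵥ* T := by
  rw [codeOf_eq_range, LinearMap.mem_range]
  constructor
  · rintro ⟨m, rfl⟩
    rw [Matrix.vecMulLinear_apply, vecMul_generator]
    simp
  · intro h
    refine ⟨leftPart c, ?_⟩
    rw [Matrix.vecMulLinear_apply, vecMul_generator, ← h, append_parts]

theorem finrank_codeOf : Module.finrank (ZMod 2) (codeOf T) = n := by
  rw [codeOf_eq_range, LinearMap.finrank_range_of_inj, Module.finrank_fin_fun]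
  intro a b h
  rw [Matrix.vecMulLinear_apply, Matrix.vecMulLinear_apply, vecMul_generator,
    vecMul_generator] at h
  simpa using congrArg leftPart h

variable {T}

theorem vecMul_dotProduct_vecMul (hT : T * Tᵀ = 1) (a b : Fin n → ZMod 2) :
    (a ᵥ* T) ⬝ᵥ (b ᵥ* T) = a ⬝ᵥ b := by
  rw [← Matrix.dotProduct_mulVec, ← Matrix.vecMul_transpose, Matrix.vecMul_vecMul, hT,
    Matrix.vecMul_one]

theorem transpose_mul_self_eq_one (hT : T * Tᵀ = 1) : Tᵀ * T = 1 := mul_eq_one_comm.1 hT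

/-- For orthogonal `T` the two halves of the product of two codewords cancel. Conversely,
orthogonality to all `(m, m T)` forces `x_left = x_right Tᵀ`, and multiplying by `T` gives
membership. -/
theorem isSelfDual_codeOf (hT : T * Tᵀ = 1) : IsSelfDual (codeOf T) := by
  have hT' := transpose_mul_self_eq_one hT
  ext x
  constructor
  · intro hx
    have h : ∀ m : Fin n → ZMod 2, (leftPart x + rightPart x ᵥ* Tᵀ) ⬝ᵥ m = 0 := by
      intro m
      have := hx (Fin.append m (m ᵥ* T)) ((mem_codeOf T).2 (by simp))
      rw [dotProduct_eq_parts, leftPart_append, rightPart_append] at this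
      rw [add_dotProduct, ← Matrix.dotProduct_mulVec, Matrix.mulVec_transpose, this]
    have h1 := dotProduct_eq_zero _ h
    have h2 : leftPart x = rightPart x ᵥ* Tᵀ := by
      funext i
      have := congrFun h1 i
      exact CharTwo.add_eq_zero.1 this
    rw [mem_codeOf, h2, Matrix.vecMul_vecMul, hT', Matrix.vecMul_one]
  · intro hx y hy
    rw [mem_codeOf] at hx hy
    rw [dotProduct_eq_parts, hx, hy, vecMul_dotProduct_vecMul hT]
    exact CharTwo.add_self_eq_zero _

end Systematic

/-! ### Both halves of the coordinates as information sets -/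

abbrev Word := Fin (36 + 36) → ZMod 2

/-- `π` is an information set of `C`; the complementary part `π'` is determined by `N`. -/
structure Systematic (C : Set Word) (π π' : Word → Message)
    (N : Matrix (Fin 36) (Fin 36) (ZMod 2)) (enc : Message →+ Word) : Prop where
  mem_iff : ∀ c, c ∈ C ↔ π' c = π c ᵥ* N
  own_enc : ∀ m, π (enc m) = m
  other_enc : ∀ m, π' (enc m) = m ᵥ* N
  ext : ∀ a b, π a = π b → π' a = π' b → a = b
  norm_eq : ∀ c, hammingNorm c = hammingNorm (π c) + hammingNorm (π' c)
  own_add : ∀ a b, π (a + b) = π a + π b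
  other_add : ∀ a b, π' (a + b) = π' a + π' b

def encodeLeft (M : Matrix (Fin 36) (Fin 36) (ZMod 2)) : Message →+ Word where
  toFun m := Fin.append m (m ᵥ* M)
  map_zero' := by
    funext i
    refine Fin.addCases (fun i => ?_) (fun i => ?_) i <;>
    simp [-Fin.natAdd_eq_addNat]
  map_add' a b := by
    funext i
    refine Fin.addCases (fun i => ?_) (fun i => ?_) i <;>
    simp [-Fin.natAdd_eq_addNat, Matrix.add_vecMul]

def encodeRight (M : Matrix (Fin 36) (Fin 36) (ZMod 2)) : Message →+ Word where
  toFun m := Fin.append (m ᵥ* Mᵀ) m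
  map_zero' := by
    funext i
    refine Fin.addCases (fun i => ?_) (fun i => ?_) i <;>
    simp [-Fin.natAdd_eq_addNat]
  map_add' a b := by
    funext i
    refine Fin.addCases (fun i => ?_) (fun i => ?_) i <;>
    simp [-Fin.natAdd_eq_addNat, Matrix.add_vecMul]

theorem ext_parts {n : ℕ} {a b : Fin (n + n) → ZMod 2} (h : leftPart a = leftPart b)
    (h' : rightPart a = rightPart b) : a = b := by
  rw [← append_parts a, ← append_parts b, h, h']

theorem systematic_left (M : Matrix (Fin 36) (Fin 36) (ZMod 2)) :
    Systematic (codeOf M) leftPart rightPart M (encodeLeft M) where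
  mem_iff _ := mem_codeOf M
  own_enc _ := leftPart_append _ _
  other_enc _ := rightPart_append _ _
  ext _ _ := ext_parts
  norm_eq := hammingNorm_eq_parts
  own_add _ _ := rfl
  other_add _ _ := rfl

/-- As `Mᵀ` is inverse to `M`, the right half determines the left one by `Mᵀ`. -/
theorem systematic_right {M : Matrix (Fin 36) (Fin 36) (ZMod 2)} (hM : M * Mᵀ = 1) :
    Systematic (codeOf M) rightPart leftPart Mᵀ (encodeRight M) where
  mem_iff c := by
    have hM' := transpose_mul_self_eq_one hM
    refine (mem_codeOf M).trans ⟨fun h => ?_, fun h => ?_⟩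
    · rw [h, Matrix.vecMul_vecMul, hM, Matrix.vecMul_one]
    · rw [h, Matrix.vecMul_vecMul, hM', Matrix.vecMul_one]
  own_enc _ := rightPart_append _ _
  other_enc _ := leftPart_append _ _
  ext _ _ h h' := ext_parts h' h
  norm_eq c := by rw [hammingNorm_eq_parts, add_comm]
  own_add _ _ := rfl
  other_add _ _ := rfl

/-! ### Complete lists of the codewords of weight at most 12 through a coordinate -/

section Lists

variable {C : Set Word} {π π' : Word → Message} {N N' : Matrix (Fin 36) (Fin 36) (ZMod 2)}
  {enc enc' : Message →+ Word}

theorem Systematic.norm_enc (h : Systematic C π π' N enc) (m : Message) :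
    hammingNorm (enc m) = hammingNorm m + hammingNorm (m ᵥ* N) := by
  rw [h.norm_eq, h.own_enc, h.other_enc]

theorem Systematic.enc_mem (h : Systematic C π π' N enc) (m : Message) : enc m ∈ C := by
  rw [h.mem_iff, h.own_enc, h.other_enc]

theorem Systematic.enc_own (h : Systematic C π π' N enc) {c : Word} (hc : c ∈ C) :
    enc (π c) = c := by
  refine h.ext _ _ (h.own_enc _) ?_
  rw [h.other_enc, ← (h.mem_iff c).1 hc]

theorem Systematic.injective (h : Systematic C π π' N enc) : Function.Injective enc :=
  fun a b hab => by rw [← h.own_enc a, hab, h.own_enc]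

theorem mem_through {i : Fin 36} {k : ℕ} {m : Message} :
    m ∈ through i k ↔ m i = 1 ∧ hammingNorm m ≤ k + 1 := by
  have hn := (List.nodup_finRange 36).eraseIdx (i : ℕ)
  rw [through, List.mem_map]
  constructor
  · rintro ⟨m, hm, rfl⟩
    rw [mem_comb hn] at hm
    have h0 := hm.1 i (by simp [mem_eraseIdx_finRange])
    refine ⟨by simp [h0], ?_⟩
    rw [add_comm, hammingNorm_add_single h0]
    omega
  · rintro ⟨h1, h2⟩
    have h0 : (Pi.single i 1 + m : Message) i = 0 := by
      rw [Pi.add_apply, h1, Pi.single_eq_same]; rfl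
    have e : Pi.single i 1 + (Pi.single i 1 + m) = m := by
      rw [← add_assoc]
      funext j
      simp [CharTwo.add_self_eq_zero]
    have h3 := hammingNorm_add_single h0
    rw [add_comm, e] at h3
    refine ⟨Pi.single i 1 + m, (mem_comb hn).2 ⟨fun j hj => ?_, by omega⟩, e⟩
    obtain rfl : j = i := by simpa [mem_eraseIdx_finRange] using hj
    exact h0

theorem through_nodup (i : Fin 36) (k : ℕ) : (through i k).Nodup :=
  (comb_nodup ((List.nodup_finRange 36).eraseIdx (i : ℕ)) k).map (add_right_injective _)

/-- The words of weight at most 12 containing `i`, where `i` is in the own half of the first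
encoding. -/
def wordList (N N' : Matrix (Fin 36) (Fin 36) (ZMod 2)) (enc enc' : Message →+ Word)
    (i : Fin 36) : List Word :=
  ((through i 5).filter fun m => decide (hammingNorm m + hammingNorm (m ᵥ* N) ≤ 12)).map enc ++
  ((comb (List.finRange 36) 5).filter fun m => on i (m ᵥ* N') &&
    (decide (hammingNorm m + hammingNorm (m ᵥ* N') ≤ 12) &&
      (true ^^ decide (hammingNorm (m ᵥ* N') ≤ 6)))).map enc'

/-- With at most 6 ones in the own half the word comes from the first list; otherwise at most `12 -
7 = 5` ones remain for the other half. -/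
theorem mem_wordList (h : Systematic C π π' N enc) (h' : Systematic C π' π N' enc') {i : Fin 36}
    {c : Word} : c ∈ wordList N N' enc enc' i ↔ c ∈ C ∧ π c i = 1 ∧ hammingNorm c ≤ 12 := by
  simp only [wordList, List.mem_append, List.mem_map, List.mem_filter, mem_through,
    mem_comb (List.nodup_finRange 36), Bool.and_eq_true, decide_eq_true_eq, Bool.true_xor,
    Bool.not_eq_true', decide_eq_false_iff_not, on]
  constructor
  · rintro (⟨m, ⟨⟨h1, h2⟩, h3⟩, rfl⟩ | ⟨m, ⟨h1, h2, h3, h4⟩, rfl⟩)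
    · exact ⟨h.enc_mem m, by rw [h.own_enc, h1], by rw [h.norm_enc]; exact h3⟩
    · exact ⟨h'.enc_mem m, by rw [h'.other_enc, h2], by rw [h'.norm_enc]; exact h3⟩
  · rintro ⟨h1, h2, h3⟩
    by_cases h6 : hammingNorm (π c) ≤ 6
    · refine Or.inl ⟨π c, ⟨⟨h2, h6⟩, ?_⟩, h.enc_own h1⟩
      rw [← h.norm_enc, h.enc_own h1]
      exact h3
    · have h4 := (h'.mem_iff c).1 h1
      rw [h'.norm_eq, h4] at h3
      rw [h4] at h6 h2
      exact Or.inr ⟨π' c, ⟨⟨by simp, by omega⟩, h2, h3, h6⟩, h'.enc_own h1⟩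

/-- The two lists are disjoint because the second requires more than 6 ones in the own half.
Duplicates would spoil both the counts and the hashes. -/
theorem wordList_nodup (h : Systematic C π π' N enc) (h' : Systematic C π' π N' enc')
    (i : Fin 36) : (wordList N N' enc enc' i).Nodup := by
  refine List.Nodup.append (((through_nodup i 5).filter _).map h.injective)
    (((comb_nodup (List.nodup_finRange 36) 5).filter _).map h'.injective) ?_
  intro c h1 h2
  simp only [List.mem_map, List.mem_filter, mem_through, Bool.and_eq_true, Bool.true_xor,
    Bool.not_eq_true', decide_eq_false_iff_not] at h1 h2
  obtain ⟨m, ⟨⟨-, h3⟩, -⟩, rfl⟩ := h1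
  obtain ⟨m', ⟨-, -, -, h4⟩, h5⟩ := h2
  apply h4
  rw [← h'.other_enc, h5, h.own_enc]
  exact h3

/-- A half of the program represents a systematic encoding. -/
structure Half.Represents (H : Half) (N : Matrix (Fin 36) (Fin 36) (ZMod 2))
    (enc : Message →+ Word) : Prop where
  cols_eq : H.cols = colBits N
  gens_eq : H.gens = (List.finRange 36).map fun i => pack (enc (Pi.single i 1))

theorem zeros_eq : zeros = bits (0 : Message) := by decide

theorem nth_map_finRange {n : ℕ} (f : Fin n → ℕ) (i : Fin n) :
    nth ((List.finRange n).map f) i = f i := by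
  rw [nth_eq_getD, List.getD_eq_getElem _ _ (by simp)]
  simp

variable {H H' : Half}

theorem other_zeros (hH : H.Represents N enc) {F : Family} {E : List Message}
    (hF : F.Enumerates E) : F.other H.cols zeros =
      (List.finRange 36).map fun j => maskOf (fun m => on j (m ᵥ* N)) E := by
  rw [hH.cols_eq, zeros_eq, other_eq hF]
  simp

theorem extract_gens (hH : H.Represents N enc) {K k : ℕ} (hk : k ≤ K) (p : Message → Bool)
    (r : List ℕ) :
    extract H.gens (sizes K 36) k (maskOf p (comb (List.finRange 36) k)) 0 r =
      ((comb (List.finRange 36) k).filter p).map (fun m => pack (enc m)) ++ r := by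
  have := extract_mask (fun m => pack (enc m)) (fun i => pack (enc (Pi.single i 1)))
    (fun m i => by rw [map_add, pack_add]) (List.nodup_finRange 36) hk p 0 r
  rw [List.length_finRange, map_zero, pack_zero] at this
  rw [hH.gens_eq, this]
  simp

theorem words_eq (hH : H.Represents N enc) (hH' : H'.Represents N' enc') (i : Fin 36) :
    words H H' i = (wordList N N' enc enc' i).map pack := by
  have hF := insertSlice_enumerates i 5
  have hB := ball_enumerates 5
  have h1 : otherWords H' i (ball 36 5) ((ball 36 5).other H'.cols zeros) =
      (((comb (List.finRange 36) 5).filter fun m => on i (m ᵥ* N') &&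
        (decide (hammingNorm m + hammingNorm (m ᵥ* N') ≤ 12) &&
        (true ^^ decide (hammingNorm (m ᵥ* N') ≤ 6)))).map enc').map pack := by
    rw [otherWords, other_zeros hH' hB, nth_map_finRange, le_total_eq hB (fun m => m ᵥ* N'),
      le_counter_eq hB (fun m => m ᵥ* N') (by norm_num), hB.ones_eq, ← maskOf_true, maskOf_xor,
      maskOf_land, maskOf_land, extract_gens hH' le_rfl, List.append_nil, List.map_map]
    rfl
  rw [words, h1, ownWords, other_zeros hH hF, le_total_eq hF (fun m => m ᵥ* N), through,
    maskOf_map, hH.gens_eq, nth_map_finRange, wordList, List.map_append]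
  have := extract_mask (fun m => pack (enc m)) (fun i => pack (enc (Pi.single i 1)))
    (fun m i => by rw [map_add, pack_add]) ((List.nodup_finRange 36).eraseIdx (i : ℕ)) (K := 5)
    (k := 5) le_rfl
  rw [List.length_eraseIdx_of_lt (by simp), List.length_finRange] at this
  rw [List.eraseIdx_map, this, List.append_cancel_right_eq, through, List.filter_map,
    List.map_map, List.map_map]
  rfl

end Lists


/-! ### Weights in self-dual codes and the shadow -/

section Weights

variable {n : ℕ}

/-- The number of common ones. -/
def overlap (a b : Fin n → ZMod 2) : ℕ := (Finset.univ.filter fun i => a i = 1 ∧ b i = 1).card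

theorem cast_overlap (a b : Fin n → ZMod 2) : (overlap a b : ZMod 2) = a ⬝ᵥ b := by
  rw [overlap, Finset.card_filter, dotProduct]
  push_cast
  refine Finset.sum_congr rfl fun i _ => ?_
  generalize a i = x
  generalize b i = y
  revert x y
  decide

theorem overlap_self (a : Fin n → ZMod 2) : overlap a a = hammingNorm a := by
  rw [overlap, hammingNorm]
  congr 1
  ext i
  simp [zmod_two_eq_one_iff]

theorem hammingNorm_add (a b : Fin n → ZMod 2) :
    hammingNorm (a + b) + 2 * overlap a b = hammingNorm a + hammingNorm b := by
  simp only [hammingNorm, overlap, Finset.card_filter, Finset.mul_sum, ← Finset.sum_add_distrib,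
    Pi.add_apply]
  have h : ∀ x y : ZMod 2, ((if x + y ≠ 0 then 1 else 0) + 2 * if x = 1 ∧ y = 1 then 1 else 0) =
      (if x ≠ 0 then 1 else 0) + if y ≠ 0 then 1 else 0 := by decide
  exact Finset.sum_congr rfl fun i _ => h (a i) (b i)

theorem even_overlap {a b : Fin n → ZMod 2} (h : a ⬝ᵥ b = 0) : 2 ∣ overlap a b := by
  rw [← CharP.cast_eq_zero_iff (ZMod 2) 2, cast_overlap, h]

variable {C : Submodule (ZMod 2) (Fin n → ZMod 2)}

theorem IsSelfDual.mem_iff (hC : IsSelfDual C) {x : Fin n → ZMod 2} :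
    x ∈ C ↔ ∀ y ∈ C, x ⬝ᵥ y = 0 := by
  conv_lhs => rw [← hC]
  rfl

theorem IsSelfDual.even (hC : IsSelfDual C) {x : Fin n → ZMod 2} (hx : x ∈ C) :
    2 ∣ hammingNorm x := by
  rw [← overlap_self]
  exact even_overlap (hC.mem_iff.1 hx x hx)

/-- Half of the weight, modulo two. -/
def halfWeight (x : Fin n → ZMod 2) : ZMod 2 := ((hammingNorm x / 2 : ℕ) : ZMod 2)

/-- In `wt (x + y) = wt x + wt y - 2 |x ∩ y|` the overlap is even. -/
theorem IsSelfDual.halfWeight_add (hC : IsSelfDual C) {x y : Fin n → ZMod 2} (hx : x ∈ C)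
    (hy : y ∈ C) : halfWeight (x + y) = halfWeight x + halfWeight y := by
  obtain ⟨k, hk⟩ := even_overlap (hC.mem_iff.1 hx y hy)
  obtain ⟨a, ha⟩ := hC.even hx
  obtain ⟨b, hb⟩ := hC.even hy
  have h := hammingNorm_add x y
  have e : hammingNorm x / 2 + hammingNorm y / 2 = hammingNorm (x + y) / 2 + 2 * k := by omega
  rw [halfWeight, halfWeight, halfWeight, ← Nat.cast_add, e, Nat.cast_add, Nat.cast_mul]
  rw [show ((2 : ℕ) : ZMod 2) = 0 from rfl]
  simp

/-- The vectors whose products with the codewords are the half weights of these. -/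
def shadow (C : Submodule (ZMod 2) (Fin n → ZMod 2)) : Set (Fin n → ZMod 2) :=
  {s | ∀ c ∈ C, s ⬝ᵥ c = halfWeight c}

/-- The shadow is a coset of the self-dual code: two of its vectors have the same product with every
codeword. -/
theorem mem_shadow_iff (hC : IsSelfDual C) {t s : Fin n → ZMod 2} (ht : t ∈ shadow C) :
    s ∈ shadow C ↔ s + t ∈ C := by
  rw [hC.mem_iff]
  refine forall₂_congr fun c hc => ?_
  rw [add_dotProduct, ht c hc]
  exact (CharTwo.add_eq_zero).symm

/-- With `s = t + c`, the weight changes by `wt c - 2 |t ∩ c|`. Since `|t ∩ c|` and `wt c / 2` have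
the same parity, this is divisible by 4. -/
theorem shadow_norm_mod (hC : IsSelfDual C) {t s : Fin n → ZMod 2} (ht : t ∈ shadow C)
    (hs : s ∈ shadow C) : hammingNorm s % 4 = hammingNorm t % 4 := by
  have hc := (mem_shadow_iff hC ht).1 hs
  have h1 := hammingNorm_add t (s + t)
  have e : t + (s + t) = s := by
    funext i
    have := CharTwo.add_self_eq_zero (t i)
    simp only [Pi.add_apply]
    linear_combination this
  rw [e] at h1
  have h2 := ht _ hc
  rw [← cast_overlap, halfWeight, ZMod.natCast_eq_natCast_iff'] at h2
  have h3 := hC.even hc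
  omega

/-- Both sides of the defining condition are additive on a self-dual code, so generators suffice. -/
theorem mem_shadow_of_generators {m : ℕ} (hC : IsSelfDual C) (g : Fin m → Fin n → ZMod 2)
    (hg : C = Submodule.span (ZMod 2) (Set.range g)) {t : Fin n → ZMod 2}
    (h : ∀ i, t ⬝ᵥ g i = halfWeight (g i)) : t ∈ shadow C := by
  intro c hc
  have hc' := hc
  rw [hg] at hc'
  induction hc' using Submodule.span_induction with
  | mem x hx =>
    obtain ⟨i, rfl⟩ := hx
    exact h i
  | zero => simp [halfWeight]
  | add x y hx hy ihx ihy =>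
    rw [← hg] at hx hy
    rw [dotProduct_add, ihx hx, ihy hy, hC.halfWeight_add hx hy]
  | smul a x hx ih =>
    rw [← hg] at hx
    have ha : ∀ a : ZMod 2, a = 0 ∨ a = 1 := by decide
    rcases ha a with rfl | rfl
    · simp [halfWeight]
    · rw [one_smul]
      exact ih hx

end Weights

/-! ### Shadow vectors supported in one half -/

section ShadowOfCodeOf

variable {n : ℕ} {T : Matrix (Fin n) (Fin n) (ZMod 2)}

/-- The half weights of the rows of `[I | T]`. -/
def rowHalfWeights (T : Matrix (Fin n) (Fin n) (ZMod 2)) : Fin n → ZMod 2 :=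
  fun i => halfWeight (Fin.append (Pi.single i 1) (T i))

theorem codeOf_eq_span (T : Matrix (Fin n) (Fin n) (ZMod 2)) : codeOf T =
    Submodule.span (ZMod 2) (Set.range fun i => Fin.append (Pi.single i 1) (T i)) := by
  rw [codeOf]
  congr 2
  funext i j
  refine Fin.addCases (fun j => ?_) (fun j => ?_) j
  · simp [Matrix.row, Matrix.one_apply, Pi.single_apply, eq_comm]
  · simp [-Fin.natAdd_eq_addNat, Matrix.row]

theorem left_mem_shadow (hT : T * Tᵀ = 1) :
    Fin.append (rowHalfWeights T) 0 ∈ shadow (codeOf T) := by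
  refine mem_shadow_of_generators (isSelfDual_codeOf hT) _ (codeOf_eq_span T) fun i => ?_
  rw [dotProduct_eq_parts]
  simp [rowHalfWeights]

/-- Multiplication by the orthogonal matrix `T` preserves products, so the product of `q T` with the
`i`-th row of `T` is `q i`. -/
theorem right_mem_shadow (hT : T * Tᵀ = 1) :
    Fin.append 0 (rowHalfWeights T ᵥ* T) ∈ shadow (codeOf T) := by
  refine mem_shadow_of_generators (isSelfDual_codeOf hT) _ (codeOf_eq_span T) fun i => ?_
  have h : T i = Pi.single i 1 ᵥ* T := by
    simp
    rfl
  rw [dotProduct_eq_parts, leftPart_append, leftPart_append, rightPart_append, rightPart_append,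
    zero_dotProduct, zero_add, h, vecMul_dotProduct_vecMul hT, ← h]
  simp [rowHalfWeights]

end ShadowOfCodeOf

/-! ### Small weights in a code and in its shadow -/

section Small

variable {C : Set Word} {π π' : Word → Message} {N N' : Matrix (Fin 36) (Fin 36) (ZMod 2)}
  {enc enc' : Message →+ Word} {H H' : Half}

/-- Identifies the lowest bit of a mask, the one allowed to be set in `noLight`, with the zero
message. -/
theorem comb_eq_zero_cons {ι : Type*} [DecidableEq ι] (l : List ι) (k : ℕ) :
    ∃ r, comb l k = 0 :: r := by
  induction l generalizing k with
  | nil => exact ⟨[], rfl⟩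
  | cons x l ih =>
    cases k with
    | zero => exact ⟨[], rfl⟩
    | succ k =>
      obtain ⟨r, hr⟩ := ih (k + 1)
      exact ⟨_, by rw [comb, hr, List.cons_append]⟩

theorem norm_of_noLight (h : Systematic C π π' N enc) (hH : H.Represents N enc)
    (hl : noLight H = true) {c : Word} (hc : c ∈ C) (h0 : c ≠ 0) (h5 : hammingNorm (π c) ≤ 5) :
    11 < hammingNorm c := by
  have hB := ball_enumerates 5
  have h1 := Nat.eq_of_beq_eq_true hl
  rw [other_zeros hH hB, le_total_eq hB (fun m => m ᵥ* N)] at h1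
  obtain ⟨r, hr⟩ := comb_eq_zero_cons (List.finRange 36) 5
  have hm : π c ∈ comb (List.finRange 36) 5 := by
    rw [mem_comb (List.nodup_finRange 36)]
    exact ⟨by simp, h5⟩
  rw [hr] at h1 hm
  have h2 : π c ≠ 0 := by
    intro h2
    apply h0
    rw [← h.enc_own hc, h2, map_zero]
  have h3 := (List.mem_cons.1 hm).resolve_left h2
  rw [maskOf, Nat.bit_val] at h1
  have h4 : maskOf (fun m => decide (hammingNorm m + hammingNorm (m ᵥ* N) ≤ 11)) r = 0 := by
    simp at h1
    exact h1
  have h6 := (maskOf_eq_zero _ _).1 h4 _ h3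
  rw [decide_eq_false_iff_not, ← h.norm_enc, h.enc_own hc] at h6
  omega

/-- If neither half has at most 5 ones, the weight is already at least `6 + 6`. -/
theorem twelve_le_norm (h : Systematic C π π' N enc) (h' : Systematic C π' π N' enc')
    (hH : H.Represents N enc) (hH' : H'.Represents N' enc') (hl : noLight H = true)
    (hl' : noLight H' = true) {c : Word} (hc : c ∈ C) (h0 : c ≠ 0) : 12 ≤ hammingNorm c := by
  by_cases h5 : hammingNorm (π c) ≤ 5
  · exact norm_of_noLight h hH hl hc h0 h5
  · by_cases h6 : hammingNorm (π' c) ≤ 5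
    · exact norm_of_noLight h' hH' hl' hc h0 h6
    · rw [h.norm_eq]
      omega

variable {S : Set Word} {u u' : Message}

theorem other_bits (hH : H.Represents N enc) {F : Family} {E : List Message}
    (hF : F.Enumerates E) (u : Message) : F.other H.cols (bits u) =
      (List.finRange 36).map fun j => maskOf (fun m => on j (m ᵥ* N + u)) E := by
  rw [hH.cols_eq, other_eq hF]

theorem norm_of_shadowHeavy (h : Systematic C π π' N enc)
    (hS : ∀ s, s ∈ S ↔ π' s = π s ᵥ* N + u) (hH : H.Represents N enc)
    (hl : shadowHeavy (ball 36 4) ((ball 36 4).other H.cols (bits u)) = true) {s : Word}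
    (hs : s ∈ S) (h4 : hammingNorm (π s) ≤ 4) : 7 < hammingNorm s := by
  have hB := ball_enumerates 4
  have h1 := Nat.eq_of_beq_eq_true hl
  rw [other_bits hH hB, le_total_eq hB (fun m => m ᵥ* N + u), maskOf_eq_zero] at h1
  have hm : π s ∈ comb (List.finRange 36) 4 := by
    rw [mem_comb (List.nodup_finRange 36)]
    exact ⟨by simp, h4⟩
  have h2 := h1 _ hm
  rw [decide_eq_false_iff_not, ← (hS s).1 hs, ← h.norm_eq] at h2
  omega

theorem eight_le_norm (h : Systematic C π π' N enc) (h' : Systematic C π' π N' enc')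
    (hS : ∀ s, s ∈ S ↔ π' s = π s ᵥ* N + u) (hS' : ∀ s, s ∈ S ↔ π s = π' s ᵥ* N' + u')
    (hH : H.Represents N enc) (hH' : H'.Represents N' enc')
    (hl : shadowHeavy (ball 36 4) ((ball 36 4).other H.cols (bits u)) = true)
    (hl' : shadowHeavy (ball 36 4) ((ball 36 4).other H'.cols (bits u')) = true) {s : Word}
    (hs : s ∈ S) : 8 ≤ hammingNorm s := by
  by_cases h5 : hammingNorm (π s) ≤ 4
  · exact norm_of_shadowHeavy h hS hH hl hs h5
  · by_cases h6 : hammingNorm (π' s) ≤ 4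
    · exact norm_of_shadowHeavy h' hS' hH' hl' hs h6
    · rw [h.norm_eq]
      omega

/-- The shadow is described from either side by an affine map with constant term `u` or `u'`. The
shadow vectors `t` and `t'`, each zero on one half, translate encoded messages into shadow vectors
without changing the message; splitting at weight 4 in the first half makes the two lists disjoint
and complete. -/
theorem card_shadowWords (h : Systematic C π π' N enc) (h' : Systematic C π' π N' enc')
    (hS : ∀ s, s ∈ S ↔ π' s = π s ᵥ* N + u) (hS' : ∀ s, s ∈ S ↔ π s = π' s ᵥ* N' + u')
    (hH : H.Represents N enc) (hH' : H'.Represents N' enc') {t t' : Word} (ht : π t = 0)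
    (htu : π' t = u) (ht' : π' t' = 0) (htu' : π t' = u') :
    {s ∈ S | hammingNorm s ≤ 8}.ncard = (shadowWords H H' (ball 36 4)
      ((ball 36 4).other H.cols (bits u)) ((ball 36 4).other H'.cols (bits u'))).length := by
  have hB := ball_enumerates 4
  set L : List Word :=
    ((comb (List.finRange 36) 4).filter fun m =>
      decide (hammingNorm m + hammingNorm (m ᵥ* N + u) ≤ 8)).map (fun m => enc m + t) ++
    ((comb (List.finRange 36) 4).filter fun m =>
      decide (hammingNorm m + hammingNorm (m ᵥ* N' + u') ≤ 8) &&
      (true ^^ decide (hammingNorm (m ᵥ* N' + u') ≤ 4))).map (fun m => enc' m + t') with hL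
  have hlen : (shadowWords H H' (ball 36 4) ((ball 36 4).other H.cols (bits u))
      ((ball 36 4).other H'.cols (bits u'))).length = L.length := by
    rw [shadowWords, other_bits hH hB, other_bits hH' hB, le_total_eq hB (fun m => m ᵥ* N + u),
      le_total_eq hB (fun m => m ᵥ* N' + u'), le_counter_eq hB (fun m => m ᵥ* N' + u')
      (by norm_num), hB.ones_eq, ← maskOf_true, maskOf_xor, maskOf_land, extract_gens hH' le_rfl,
      extract_gens hH le_rfl]
    simp [hL]
  have own : ∀ m, π (enc m + t) = m := fun m => by rw [h.own_add, h.own_enc, ht, add_zero]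
  have other : ∀ m, π' (enc m + t) = m ᵥ* N + u := fun m => by
    rw [h.other_add, h.other_enc, htu]
  have own' : ∀ m, π' (enc' m + t') = m := fun m => by rw [h'.own_add, h'.own_enc, ht', add_zero]
  have other' : ∀ m, π (enc' m + t') = m ᵥ* N' + u' := fun m => by
    rw [h'.other_add, h'.other_enc, htu']
  have hmem : ∀ s, s ∈ L ↔ s ∈ S ∧ hammingNorm s ≤ 8 := by
    intro s
    simp only [hL, List.mem_append, List.mem_map, List.mem_filter,
      mem_comb (List.nodup_finRange 36), Bool.and_eq_true, decide_eq_true_eq, Bool.true_xor,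
      Bool.not_eq_true', decide_eq_false_iff_not]
    constructor
    · rintro (⟨m, ⟨-, h3⟩, rfl⟩ | ⟨m, ⟨-, h3, h4⟩, rfl⟩)
      · exact ⟨by rw [hS, own, other], by rw [h.norm_eq, own, other]; exact h3⟩
      · exact ⟨by rw [hS', own', other'], by rw [h'.norm_eq, own', other']; exact h3⟩
    · rintro ⟨h1, h3⟩
      have e := (hS s).1 h1
      have e' := (hS' s).1 h1
      by_cases h4 : hammingNorm (π s) ≤ 4
      · refine Or.inl ⟨π s, ⟨⟨by simp, h4⟩, ?_⟩, h.ext _ _ (own _) (by rw [other, ← e])⟩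
        rw [← e, ← h.norm_eq]
        exact h3
      · refine Or.inr ⟨π' s, ⟨⟨by simp, ?_⟩, ?_, ?_⟩, h'.ext _ _ (own' _) (by rw [other', ← e'])⟩
        · rw [h.norm_eq] at h3
          omega
        · rw [← e', ← h'.norm_eq]
          exact h3
        · rw [← e']
          exact h4
  have hnodup : L.Nodup := by
    refine List.Nodup.append (((comb_nodup (List.nodup_finRange 36) 4).filter _).map
      fun a b hab => ?_) (((comb_nodup (List.nodup_finRange 36) 4).filter _).map
      fun a b hab => ?_) ?_
    · rw [← own a, ← own b]
      exact congrArg π hab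
    · rw [← own' a, ← own' b]
      exact congrArg π' hab
    · intro s h1 h2
      simp only [List.mem_map, List.mem_filter, mem_comb (List.nodup_finRange 36),
        Bool.and_eq_true, Bool.true_xor, Bool.not_eq_true', decide_eq_false_iff_not] at h1 h2
      obtain ⟨m, ⟨⟨-, h3⟩, -⟩, rfl⟩ := h1
      obtain ⟨m', ⟨-, -, h4⟩, h5⟩ := h2
      apply h4
      rw [← other', h5, own]
      exact h3
  rw [hlen, ← List.toFinset_card_of_nodup hnodup, ← Set.ncard_coe_finset]
  congr 1
  ext s
  simp [hmem]

end Small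


/-! ### The MacWilliams identity for a self-dual code and its shadow -/

section MacWilliams

def sgn (a : ZMod 2) : ℤ := if a = 0 then 1 else -1

theorem sgn_add : ∀ a b : ZMod 2, sgn (a + b) = sgn a * sgn b := by decide

theorem sgn_sum {ι : Type*} (s : Finset ι) (f : ι → ZMod 2) :
    sgn (∑ i ∈ s, f i) = ∏ i ∈ s, sgn (f i) := by
  classical
  induction s using Finset.induction_on with
  | empty => rfl
  | insert a s ha ih => rw [Finset.sum_insert ha, Finset.prod_insert ha, sgn_add, ih]

variable {n : ℕ}

theorem prod_weight {R : Type*} [CommMonoid R] (c : Fin n → ZMod 2) (a b : R) :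
    (∏ i, if c i = 0 then a else b) = b ^ hammingNorm c * a ^ (n - hammingNorm c) := by
  have h : (Finset.univ.filter fun i => c i = 0).card = n - hammingNorm c := by
    have := Finset.card_filter_add_card_filter_not (s := Finset.univ) (fun i : Fin n => c i = 0)
    rw [Finset.card_univ, Fintype.card_fin] at this
    rw [hammingNorm]
    exact Nat.eq_sub_of_add_eq this
  rw [Finset.prod_ite, Finset.prod_const, Finset.prod_const, h, mul_comm]
  rfl

/-- The sum over `x` factors over the coordinates; the factor is `1 + X` where `c` vanishes and `1 -
X` where it does not. -/
theorem character_expansion (c : Fin n → ZMod 2) :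
    ((1 - X) ^ hammingNorm c * (1 + X) ^ (n - hammingNorm c) : ℤ[X]) =
      ∑ x : Fin n → ZMod 2, Polynomial.C (sgn (x ⬝ᵥ c)) * X ^ hammingNorm x := by
  have h1 : ∀ a : ZMod 2, (∑ b : ZMod 2, Polynomial.C (sgn (b * a)) * (if b = 0 then 1 else X)) =
      if a = 0 then (1 + X : ℤ[X]) else 1 - X := by
    intro a
    have ha : a = 0 ∨ a = 1 := by revert a; decide
    have e : (Finset.univ : Finset (ZMod 2)) = {0, 1} := rfl
    rw [e, Finset.sum_pair (by decide)]
    rcases ha with rfl | rfl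
    · simp [sgn]
    · simp [sgn]
      ring
  rw [← prod_weight c (1 + X : ℤ[X]) (1 - X)]
  simp only [← h1]
  rw [Finset.prod_univ_sum, Fintype.piFinset_univ]
  refine Finset.sum_congr rfl fun x _ => ?_
  rw [Finset.prod_mul_distrib, prod_weight, one_pow, mul_one, dotProduct, sgn_sum, map_prod]

open Classical in
-- If `ψ d = 1` for some `d` in `C`, translation by `d` changes the sign of the sum, which is
-- therefore zero.
theorem character_sum (C : Submodule (ZMod 2) (Fin n → ZMod 2)) (ψ : (Fin n → ZMod 2) → ZMod 2)
    (hψ : ∀ a ∈ C, ∀ b ∈ C, ψ (a + b) = ψ a + ψ b) :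
    ∑ c with c ∈ C, sgn (ψ c) =
      if ∀ c ∈ C, ψ c = 0 then ((Finset.univ.filter fun c => c ∈ C).card : ℤ) else 0 := by
  split_ifs with h
  · rw [Finset.sum_congr rfl fun c hc => ?_, Finset.sum_const, nsmul_eq_mul, mul_one]
    rw [h c (Finset.mem_filter.1 hc).2]
    rfl
  · push Not at h
    obtain ⟨d, hd, hd1⟩ := h
    have e : ∑ c with c ∈ C, sgn (ψ c) = ∑ c with c ∈ C, sgn (ψ (c + d)) := by
      refine Finset.sum_nbij' (fun c => c + d) (fun c => c + d) ?_ ?_ ?_ ?_ ?_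
      · intro c hc
        simp only [Finset.mem_filter, Finset.mem_univ, true_and] at hc ⊢
        exact C.add_mem hc hd
      · intro c hc
        simp only [Finset.mem_filter, Finset.mem_univ, true_and] at hc ⊢
        exact C.add_mem hc hd
      all_goals
        intro c _
        have : c + d + d = c := by
          funext i
          simp [add_assoc, CharTwo.add_self_eq_zero]
        simp [this]
    have e2 : ∑ c with c ∈ C, sgn (ψ (c + d)) = -∑ c with c ∈ C, sgn (ψ c) := by
      rw [← Finset.sum_neg_distrib]
      refine Finset.sum_congr rfl fun c hc => ?_
      rw [hψ c (Finset.mem_filter.1 hc).2 d hd, sgn_add, (zmod_two_eq_one_iff _).2 hd1]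
      simp [sgn]
    rw [e2] at e
    omega

open Classical in
-- After expanding and exchanging sums, the inner character sum selects the vectors whose products
-- with `C` are given by `θ`: the dual code for `θ = 0`, the shadow when `θ` is the half weight.
theorem macwilliams (C : Submodule (ZMod 2) (Fin n → ZMod 2)) (θ : (Fin n → ZMod 2) → ZMod 2)
    (hθ : ∀ a ∈ C, ∀ b ∈ C, θ (a + b) = θ a + θ b) :
    ∑ c with c ∈ C, (Polynomial.C (sgn (θ c)) *
        ((1 - X) ^ hammingNorm c * (1 + X) ^ (n - hammingNorm c)) : ℤ[X]) =
      Polynomial.C ((Finset.univ.filter fun c => c ∈ C).card : ℤ) *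
        ∑ x with ∀ c ∈ C, x ⬝ᵥ c = θ c, X ^ hammingNorm x := by
  simp only [character_expansion, Finset.mul_sum]
  rw [Finset.sum_comm, Finset.sum_filter]
  refine Finset.sum_congr rfl fun x _ => ?_
  have h := character_sum C (fun c => θ c + x ⬝ᵥ c) fun a ha b hb => by
    rw [hθ a ha b hb, dotProduct_add]
    ring
  have h2 : (∀ c ∈ C, θ c + x ⬝ᵥ c = 0) ↔ ∀ c ∈ C, x ⬝ᵥ c = θ c := by
    refine forall₂_congr fun c _ => ?_
    rw [CharTwo.add_eq_zero, eq_comm]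
  simp only [← mul_assoc, ← Polynomial.C_mul, ← sgn_add, ← Finset.sum_mul]
  rw [← map_sum, h]
  simp only [h2]
  split_ifs <;> simp

end MacWilliams

/-! ### Weight distributions -/

section Distribution

variable {n : ℕ}

/-- The number of members of weight `j`. -/
noncomputable def weightCount (S : Set (Fin n → ZMod 2)) (j : ℕ) : ℕ :=
  {x ∈ S | hammingNorm x = j}.ncard

/-- The coefficients of the Krawtchouk polynomials. -/
noncomputable def krawtchouk (n i j : ℕ) : ℤ := ((1 - X) ^ i * (1 + X) ^ (n - i) : ℤ[X]).coeff j

open Classical in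
theorem weightCount_eq (S : Set (Fin n → ZMod 2)) (j : ℕ) :
    weightCount S j = (Finset.univ.filter fun x => x ∈ S ∧ hammingNorm x = j).card := by
  rw [weightCount, ← Set.ncard_coe_finset]
  congr 1
  ext x
  simp

open Classical in
theorem coeff_sum_pow (S : Set (Fin n → ZMod 2)) (j : ℕ) :
    (∑ x with x ∈ S, X ^ hammingNorm x : ℤ[X]).coeff j = weightCount S j := by
  rw [weightCount_eq, Polynomial.finsetSum_coeff, Finset.card_filter, Finset.sum_filter]
  push_cast
  refine Finset.sum_congr rfl fun x _ => ?_
  rw [Polynomial.coeff_X_pow]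
  by_cases h : x ∈ S <;> simp [h, eq_comm]

open Classical in
theorem sum_eq_sum_weightCount (S : Set (Fin n → ZMod 2)) (f : ℕ → ℤ) :
    ∑ x with x ∈ S, f (hammingNorm x) = ∑ i ∈ Finset.range (n + 1), weightCount S i * f i := by
  have h : ∀ x ∈ Finset.univ.filter (fun x => x ∈ S),
      hammingNorm x ∈ Finset.range (n + 1) := by
    intro x _
    rw [Finset.mem_range, Nat.lt_succ_iff]
    exact hammingNorm_le_card_fintype.trans (by simp)
  rw [← Finset.sum_fiberwise_of_maps_to h]
  refine Finset.sum_congr rfl fun i _ => ?_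
  rw [weightCount_eq, Finset.filter_filter, Finset.sum_congr rfl fun x hx => ?_,
    Finset.sum_const, nsmul_eq_mul]
  rw [(Finset.mem_filter.1 hx).2.2]

/-- Meaningful at even `i` only; a self-dual code has no words of odd weight. -/
def halfSign (i : ℕ) : ℤ := if i / 2 % 2 = 0 then 1 else -1

theorem sgn_halfWeight (x : Fin n → ZMod 2) : sgn (halfWeight x) = halfSign (hammingNorm x) := by
  rw [halfWeight, sgn, halfSign]
  congr 1
  rw [CharP.cast_eq_zero_iff (ZMod 2) 2, Nat.dvd_iff_mod_eq_zero]

variable {C : Submodule (ZMod 2) (Fin n → ZMod 2)}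

open Classical in
theorem sum_krawtchouk (hC : IsSelfDual C) (j : ℕ) :
    ∑ i ∈ Finset.range (n + 1), (weightCount (C : Set (Fin n → ZMod 2)) i : ℤ) * krawtchouk n i j =
      (Nat.card C : ℤ) * weightCount (C : Set (Fin n → ZMod 2)) j := by
  have h := congrArg (fun p => p.coeff j) (macwilliams C (fun _ => 0) (by simp))
  have hC' : ∀ x, (∀ c ∈ C, x ⬝ᵥ c = 0) ↔ x ∈ (C : Set (Fin n → ZMod 2)) :=
    fun x => hC.mem_iff.symm
  simp only [hC', Polynomial.coeff_C_mul, coeff_sum_pow] at h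
  rw [Polynomial.finsetSum_coeff] at h
  rw [← sum_eq_sum_weightCount, Nat.card_eq_fintype_card, Fintype.card_subtype, ← h]
  refine Finset.sum_congr rfl fun c _ => ?_
  simp [krawtchouk, sgn]

open Classical in
theorem sum_halfSign_krawtchouk (hC : IsSelfDual C) (j : ℕ) :
    ∑ i ∈ Finset.range (n + 1),
        (weightCount (C : Set (Fin n → ZMod 2)) i : ℤ) * (halfSign i * krawtchouk n i j) =
      (Nat.card C : ℤ) * weightCount (shadow C) j := by
  have h := congrArg (fun p => p.coeff j)
    (macwilliams C halfWeight fun a ha b hb => hC.halfWeight_add ha hb)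
  have hC' : ∀ x, (∀ c ∈ C, x ⬝ᵥ c = halfWeight c) ↔ x ∈ shadow C := fun x => Iff.rfl
  simp only [hC', Polynomial.coeff_C_mul, coeff_sum_pow] at h
  rw [Polynomial.finsetSum_coeff] at h
  rw [← sum_eq_sum_weightCount, Nat.card_eq_fintype_card, Fintype.card_subtype, ← h]
  refine Finset.sum_congr rfl fun c _ => ?_
  rw [Polynomial.coeff_C_mul, sgn_halfWeight]
  rfl

theorem weightCount_odd (hC : IsSelfDual C) {j : ℕ} (hj : ¬2 ∣ j) :
    weightCount (C : Set (Fin n → ZMod 2)) j = 0 := by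
  rw [weightCount, Set.ncard_eq_zero]
  ext x
  simp only [Set.mem_ofPred_eq, Set.mem_empty_iff_false, iff_false, not_and]
  rintro hx rfl
  exact hj (hC.even hx)

theorem weightCount_zero (C : Submodule (ZMod 2) (Fin n → ZMod 2)) :
    weightCount (C : Set (Fin n → ZMod 2)) 0 = 1 := by
  rw [weightCount, Set.ncard_eq_one]
  refine ⟨0, ?_⟩
  ext x
  simp only [Set.mem_ofPred_eq, hammingNorm_eq_zero, Set.mem_singleton_iff, and_iff_right_iff_imp]
  rintro rfl
  exact C.zero_mem

/-- The product of the all-one vector with `y` is the weight of `y` modulo 2. -/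
theorem IsSelfDual.one_mem (hC : IsSelfDual C) : (1 : Fin n → ZMod 2) ∈ C := by
  rw [hC.mem_iff]
  intro y hy
  rw [← cast_overlap, CharP.cast_eq_zero_iff (ZMod 2) 2]
  have : overlap 1 y = overlap y y := by
    rw [overlap, overlap]
    congr 1
    ext i
    simp
  rw [this, overlap_self]
  exact hC.even hy

theorem hammingNorm_one_add (x : Fin n → ZMod 2) : hammingNorm (1 + x) + hammingNorm x = n := by
  have h := hammingNorm_add 1 x
  have : overlap 1 x = overlap x x := by
    rw [overlap, overlap]
    congr 1
    ext i
    simp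
  rw [this, overlap_self] at h
  have h1 : hammingNorm (1 : Fin n → ZMod 2) = n := by simp [hammingNorm]
  omega

theorem weightCount_compl (hC : IsSelfDual C) {i j : ℕ} (h : i + j = n) :
    weightCount (C : Set (Fin n → ZMod 2)) i = weightCount (C : Set (Fin n → ZMod 2)) j := by
  have e : ∀ x : Fin n → ZMod 2, 1 + (1 + x) = x := by
    intro x
    funext i
    simp [← add_assoc, CharTwo.add_self_eq_zero]
  refine Set.ncard_congr (fun x _ => 1 + x) ?_ ?_ ?_
  · rintro x ⟨hx, h1⟩
    have := hammingNorm_one_add x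
    exact ⟨C.add_mem hC.one_mem hx, by omega⟩
  · intro a b _ _ hab
    exact add_left_cancel hab
  · rintro x ⟨hx, h1⟩
    have := hammingNorm_one_add x
    exact ⟨1 + x, ⟨C.add_mem hC.one_mem hx, by omega⟩, e x⟩

end Distribution


/-! ### The weight enumerator of a self-dual code of length 72 -/

section Krawtchouk

/-- Multiplication by `1 + ε X` of a polynomial given by its lowest coefficients. -/
def mulLinear (ε : ℤ) : ℤ → List ℤ → List ℤ
  | _, [] => []
  | a, b :: l => (b + ε * a) :: mulLinear ε b l

/-- The lowest coefficients of `(1 - X) ^ i * (1 + X) ^ k`. -/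
def krawtchoukList (i k : ℕ) : List ℤ :=
  (mulLinear (-1) 0)^[i] ((mulLinear 1 0)^[k] [1, 0, 0, 0, 0, 0, 0, 0, 0, 0, 0])

theorem mulLinear_eq (ε : ℤ) (a : ℤ) (N : ℕ) (f : ℕ → ℤ) :
    mulLinear ε a ((List.range N).map f) =
      (List.range N).map fun j => f j + ε * (if j = 0 then a else f (j - 1)) := by
  induction N generalizing a f with
  | zero => rfl
  | succ N ih =>
    rw [List.range_succ_eq_map, List.map_cons, List.map_map, mulLinear, ih, List.map_cons,
      List.map_map]
    congr 1
    refine List.map_congr_left fun j _ => ?_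
    cases j <;> simp

theorem mulLinear_coeff (ε : ℤ) (N : ℕ) (p : ℤ[X]) :
    mulLinear ε 0 ((List.range N).map p.coeff) =
      (List.range N).map ((1 + Polynomial.C ε * X) * p).coeff := by
  rw [mulLinear_eq]
  refine List.map_congr_left fun j _ => ?_
  rw [add_mul, one_mul, mul_assoc, Polynomial.coeff_add, Polynomial.coeff_C_mul]
  cases j with
  | zero => simp
  | succ j => simp [Polynomial.coeff_X_mul]

theorem krawtchoukList_eq (i k : ℕ) : krawtchoukList i k =
    (List.range 11).map ((1 - X) ^ i * (1 + X) ^ k : ℤ[X]).coeff := by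
  have h0 : [1, 0, 0, 0, 0, 0, 0, 0, 0, 0, 0] = (List.range 11).map (1 : ℤ[X]).coeff := by
    simp [List.range_succ, Polynomial.coeff_one]
  have h1 : (mulLinear 1 0)^[k] [1, 0, 0, 0, 0, 0, 0, 0, 0, 0, 0] =
      (List.range 11).map ((1 + X) ^ k : ℤ[X]).coeff := by
    induction k with
    | zero => simpa using h0
    | succ k ih =>
      rw [Function.iterate_succ_apply', ih, mulLinear_coeff, pow_succ']
      simp
  rw [krawtchoukList, h1]
  induction i with
  | zero => simp
  | succ i ih =>
    rw [Function.iterate_succ_apply', ih, mulLinear_coeff, pow_succ', mul_assoc]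
    congr 2
    simp only [map_neg, map_one]
    ring

/-- A combination of Krawtchouk polynomials of degrees up to 10, evaluated at `i`; truncation to
eleven coefficients loses nothing. -/
def weighted (w : List ℤ) (i : ℕ) : ℤ := (List.zipWith (· * ·) w (krawtchoukList i (72 - i))).sum

theorem weighted_eq (f : ℕ → ℤ) (i : ℕ) : weighted ((List.range 11).map f) i =
    ∑ j ∈ Finset.range 11, f j * krawtchouk 72 i j := by
  rw [weighted, krawtchoukList_eq, List.zipWith_map, List.zipWith_self]
  simp only [krawtchouk, Finset.sum_range_succ, List.range_succ]
  simp
  ring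

end Krawtchouk

/-- The Krawtchouk coefficients of the polynomial with leading coefficient `2 ^ 10 / 10!` and simple
zeros at `18, 22, …, 54`. Even degrees alone give symmetry under `i ↦ 72 - i`. Among the weights `≡
2` modulo 4 from 12 to 60, only 14 and 58 survive. -/
def weights₂ : List ℤ := [540, 0, 211, 0, 64, 0, 21, 0, 4, 0, 1]

/-- The analogue for weights divisible by 4: zeros at `20, 24, …, 52`, the one at 36 being double by
symmetry. Only 12, 16, 56 and 60 survive between 12 and 60. -/
def weights₀ : List ℤ := [3924, 0, 1187, 0, 320, 0, 69, 0, 12, 0, 1]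

/-- The branch repeating the left side is void: it covers the `i` for which the number of codewords
is known anyway. -/
theorem weighted_weights₂ : ∀ i ∈ Finset.range 73, (1 - halfSign i) * weighted weights₂ i =
    if i = 14 ∨ i = 58 then 2147483648 else if i < 12 ∨ 60 < i ∨ i % 2 = 1 then
      (1 - halfSign i) * weighted weights₂ i else 0 := by
  decide +kernel

theorem weighted_weights₀ : ∀ i ∈ Finset.range 73, (1 + halfSign i) * weighted weights₀ i =
    if i = 0 ∨ i = 72 then 1381905727488 else if i = 12 ∨ i = 60 then 12884901888
    else if i = 16 ∨ i = 56 then 1073741824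
    else if i < 12 ∨ 60 < i ∨ i % 2 = 1 then
      (1 + halfSign i) * weighted weights₀ i else 0 := by
  decide +kernel

/-! ### The numbers of codewords of weights 14 and 16 -/

section Enumerator

variable {C : Submodule (ZMod 2) (Fin 72 → ZMod 2)}

theorem sum_weighted (hC : IsSelfDual C) (f : ℕ → ℤ) :
    ∑ i ∈ Finset.range 73, (weightCount (C : Set (Fin 72 → ZMod 2)) i : ℤ) *
      weighted ((List.range 11).map f) i = (Nat.card C : ℤ) *
        ∑ j ∈ Finset.range 11, f j * weightCount (C : Set (Fin 72 → ZMod 2)) j := by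
  simp only [weighted_eq, Finset.mul_sum]
  rw [Finset.sum_comm]
  refine Finset.sum_congr rfl fun j _ => ?_
  rw [mul_left_comm, ← sum_krawtchouk hC j, Finset.mul_sum]
  exact Finset.sum_congr rfl fun i _ => by ring

theorem sum_halfSign_weighted (hC : IsSelfDual C) (f : ℕ → ℤ) :
    ∑ i ∈ Finset.range 73, (weightCount (C : Set (Fin 72 → ZMod 2)) i : ℤ) *
      (halfSign i * weighted ((List.range 11).map f) i) = (Nat.card C : ℤ) *
        ∑ j ∈ Finset.range 11, f j * weightCount (shadow C) j := by
  simp only [weighted_eq, Finset.mul_sum]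
  rw [Finset.sum_comm]
  refine Finset.sum_congr rfl fun j _ => ?_
  rw [mul_left_comm, ← sum_halfSign_krawtchouk hC j, Finset.mul_sum]
  exact Finset.sum_congr rfl fun i _ => by ring

/-- Weights above 60 correspond to weights below 12 by complementation. -/
theorem weightCount_extreme (hC : IsSelfDual C)
    (h0 : ∀ j, 0 < j → j < 12 → weightCount (C : Set (Fin 72 → ZMod 2)) j = 0) {i : ℕ}
    (hi : i < 73) (h : i < 12 ∨ 60 < i ∨ i % 2 = 1) (hi0 : i ≠ 0) (hi72 : i ≠ 72) :
    weightCount (C : Set (Fin 72 → ZMod 2)) i = 0 := by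
  rcases h with h | h | h
  · exact h0 i (by omega) h
  · rw [weightCount_compl hC (show i + (72 - i) = 72 by omega)]
    exact h0 _ (by omega) (by omega)
  · exact weightCount_odd hC (by omega)

variable {γ : ℕ}

/-- The difference of the plain and the twisted identity retains only weights `≡ 2` modulo 4, and
`weights₂` leaves `A₁₄ = A₅₈`. The right side needs only `A_j` and `B_j` for `j ≤ 10`. -/
theorem weightCount_fourteen (hC : IsSelfDual C) (hcard : Nat.card C = 2 ^ 36)
    (h0 : ∀ j, 0 < j → j < 12 → weightCount (C : Set (Fin 72 → ZMod 2)) j = 0)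
    (hB : ∀ j, j < 11 → j ≠ 8 → weightCount (shadow C) j = 0)
    (hB8 : weightCount (shadow C) 8 = γ) :
    (weightCount (C : Set (Fin 72 → ZMod 2)) 14 : ℤ) = 8640 - 64 * γ := by
  have h1 := sum_weighted hC fun j => weights₂.getD j 0
  have h2 := sum_halfSign_weighted hC fun j => weights₂.getD j 0
  rw [show (List.range 11).map (fun j => weights₂.getD j 0) = weights₂ from rfl] at h1 h2
  have h3 : ∑ i ∈ Finset.range 73, (weightCount (C : Set (Fin 72 → ZMod 2)) i : ℤ) *
      ((1 - halfSign i) * weighted weights₂ i) =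
      ∑ i ∈ ({14, 58} : Finset ℕ), (weightCount (C : Set (Fin 72 → ZMod 2)) i : ℤ) *
        2147483648 := by
    symm
    refine Finset.sum_subset_zero_on_sdiff (by decide) ?_ ?_
    · intro i hi
      rw [Finset.mem_sdiff, Finset.mem_range] at hi
      obtain ⟨hi, hi2⟩ := hi
      simp only [Finset.mem_insert, Finset.mem_singleton] at hi2
      by_cases h : i < 12 ∨ 60 < i ∨ i % 2 = 1
      -- At 0 and 72 the numbers of codewords do not vanish, but the factor `1 - halfSign i` does.
      · by_cases hi0 : i = 0
        · subst hi0; simp [halfSign]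
        by_cases hi72 : i = 72
        · subst hi72; simp [halfSign]
        rw [weightCount_extreme hC h0 hi h hi0 hi72]
        simp
      · rw [weighted_weights₂ i (Finset.mem_range.2 hi), if_neg hi2, if_neg h, mul_zero]
    · intro i hi
      rw [weighted_weights₂ i (Finset.mem_range.2 (by
        simp only [Finset.mem_insert, Finset.mem_singleton] at hi
        omega)), if_pos (by simpa using hi)]
  rw [Finset.sum_pair (by decide), weightCount_compl hC (show 58 + 14 = 72 by rfl)] at h3
  -- Here 540 is the weight attached to `A₀ = 1` and 4 the one attached to `B₈ = γ`.
  have h4 : ∑ i ∈ Finset.range 73, (weightCount (C : Set (Fin 72 → ZMod 2)) i : ℤ) *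
      ((1 - halfSign i) * weighted weights₂ i) = (2 : ℤ) ^ 36 * (540 - 4 * γ) := by
    rw [← sub_eq_zero]
    simp only [sub_mul, one_mul, mul_sub, Finset.sum_sub_distrib]
    rw [h1, h2, hcard]
    simp only [Finset.sum_range_succ, Finset.sum_range_zero, weightCount_zero, hB8]
    simp [h0, hB, weights₂]
  rw [h3] at h4
  linarith

/-- Now the sum of the two identities retains the weights divisible by 4, and `weights₀` leaves a
relation between `A₀`, `A₁₂`, `A₁₆` and the equal numbers at the complementary weights. -/
theorem weightCount_sixteen (hC : IsSelfDual C) (hcard : Nat.card C = 2 ^ 36)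
    (h0 : ∀ j, 0 < j → j < 12 → weightCount (C : Set (Fin 72 → ZMod 2)) j = 0)
    (hB : ∀ j, j < 11 → j ≠ 8 → weightCount (shadow C) j = 0)
    (hB8 : weightCount (shadow C) 8 = γ) :
    (weightCount (C : Set (Fin 72 → ZMod 2)) 16 : ℤ) =
      124281 - 12 * weightCount (C : Set (Fin 72 → ZMod 2)) 12 + 384 * γ := by
  have h1 := sum_weighted hC fun j => weights₀.getD j 0
  have h2 := sum_halfSign_weighted hC fun j => weights₀.getD j 0
  rw [show (List.range 11).map (fun j => weights₀.getD j 0) = weights₀ from rfl] at h1 h2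
  have h3 : ∑ i ∈ Finset.range 73, (weightCount (C : Set (Fin 72 → ZMod 2)) i : ℤ) *
      ((1 + halfSign i) * weighted weights₀ i) =
      ∑ i ∈ ({0, 12, 16, 56, 60, 72} : Finset ℕ),
        (weightCount (C : Set (Fin 72 → ZMod 2)) i : ℤ) *
          ((1 + halfSign i) * weighted weights₀ i) := by
    symm
    refine Finset.sum_subset (by decide) ?_
    intro i hi hi2
    have hi' := Finset.mem_range.1 hi
    simp only [Finset.mem_insert, Finset.mem_singleton, not_or] at hi2
    by_cases h : i < 12 ∨ 60 < i ∨ i % 2 = 1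
    · rw [weightCount_extreme hC h0 hi' h hi2.1 hi2.2.2.2.2.2]
      simp
    · rw [weighted_weights₀ i hi, if_neg (by omega), if_neg (by omega), if_neg (by omega),
        if_neg h, mul_zero]
  have e := weighted_weights₀
  simp only [Finset.mem_range] at e
  rw [Finset.sum_insert (by decide), Finset.sum_insert (by decide), Finset.sum_insert (by decide),
    Finset.sum_insert (by decide), Finset.sum_pair (by decide), e 0 (by decide),
    e 12 (by decide), e 16 (by decide), e 56 (by decide), e 60 (by decide), e 72 (by decide),
    weightCount_compl hC (show 56 + 16 = 72 by rfl),
    weightCount_compl hC (show 60 + 12 = 72 by rfl),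
    weightCount_compl hC (show 72 + 0 = 72 by rfl), weightCount_zero] at h3
  have h4 : ∑ i ∈ Finset.range 73, (weightCount (C : Set (Fin 72 → ZMod 2)) i : ℤ) *
      ((1 + halfSign i) * weighted weights₀ i) = (2 : ℤ) ^ 36 * (3924 + 12 * γ) := by
    rw [← sub_eq_zero]
    simp only [add_mul, one_mul, mul_add, Finset.sum_add_distrib]
    rw [h1, h2, hcard]
    simp only [Finset.sum_range_succ, Finset.sum_range_zero, weightCount_zero, hB8]
    simp [h0, hB, weights₀]
  rw [h3] at h4
  norm_num at h4
  linarith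

open Classical in
theorem coeff_weightEnumerator (C : Submodule (ZMod 2) (Fin 72 → ZMod 2)) (j : ℕ) :
    (weightEnumerator C).coeff j = weightCount (C : Set (Fin 72 → ZMod 2)) j :=
  (congrArg (fun p : ℤ[X] => p.coeff j) (by rw [weightEnumerator]; congr)).trans
    (coeff_sum_pow (C : Set (Fin 72 → ZMod 2)) j)

theorem hasWeightEnumeratorW721 (hC : IsSelfDual C) (hcard : Nat.card C = 2 ^ 36) {β : ℕ}
    (h0 : ∀ j, 0 < j → j < 12 → weightCount (C : Set (Fin 72 → ZMod 2)) j = 0)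
    (h12 : weightCount (C : Set (Fin 72 → ZMod 2)) 12 = 2 * β)
    (hB : ∀ j, j < 11 → j ≠ 8 → weightCount (shadow C) j = 0)
    (hB8 : weightCount (shadow C) 8 = γ) : HasWeightEnumeratorW721 C γ β := by
  have h14 := weightCount_fourteen hC hcard h0 hB hB8
  have h16 := weightCount_sixteen hC hcard h0 hB hB8
  have h : (X ^ 18 : ℤ[X]) ∣ weightEnumerator C - (1 + Polynomial.C (2 * (β : ℤ)) * X ^ 12 +
      Polynomial.C (8640 - 64 * (γ : ℤ)) * X ^ 14 +
      Polynomial.C (124281 - 24 * (β : ℤ) + 384 * (γ : ℤ)) * X ^ 16) := by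
    rw [Polynomial.X_pow_dvd_iff]
    intro d hd
    simp only [Polynomial.coeff_sub, Polynomial.coeff_add, Polynomial.coeff_C_mul,
      Polynomial.coeff_X_pow, Polynomial.coeff_one, coeff_weightEnumerator]
    rcases Nat.eq_zero_or_pos d with rfl | hd0
    · simp [weightCount_zero]
    rcases Nat.lt_or_ge d 12 with h | h
    · rw [h0 d hd0 h]
      simp [show d ≠ 0 by omega, show d ≠ 12 by omega, show d ≠ 14 by omega,
        show d ≠ 16 by omega]
    by_cases hodd : 2 ∣ d
    · obtain rfl | rfl | rfl : d = 12 ∨ d = 14 ∨ d = 16 := by omega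
      · simp [h12]
      · simp [h14]
      · simp [h16, h12]
        ring
    · rw [weightCount_odd hC hodd]
      simp [show d ≠ 0 by omega, show d ≠ 12 by omega, show d ≠ 14 by omega,
        show d ≠ 16 by omega]
  obtain ⟨Q, hQ⟩ := h
  exact ⟨Q, by rw [← hQ]; ring⟩

end Enumerator


/-! ### The block patterns and the group matrices -/

section Patterns

variable {M : Type*}

/-- The pattern only places its entries, so it commutes with applying `A`; evaluating it on the
identity of `ℕ` reveals the index of every block. -/
theorem patternI_eq (A : ℕ → M) (I J : Fin 18) :
    patternI A I J = A (1 + blockIndex .G1 I J) := by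
  have h : ∀ I J : Fin 18, Nat.beq (patternI id I J) (1 + blockIndex .G1 I J) = true := by
    decide +kernel
  rw [← Nat.eq_of_beq_eq_true (h I J)]
  simp only [patternI, assemble, Matrix.reindex_apply, Matrix.submatrix_apply, Matrix.comp_apply]
  generalize (finProdFinEquiv.symm I : Fin 2 × Fin 9) = p
  generalize (finProdFinEquiv.symm J : Fin 2 × Fin 9) = q
  obtain ⟨p, i⟩ := p
  obtain ⟨q, j⟩ := q
  fin_cases p <;> fin_cases q <;> rfl

theorem patternIII_eq (A : ℕ → M) (I J : Fin 18) :
    patternIII A I J = A (1 + blockIndex .G3 I J) := by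
  have h : ∀ I J : Fin 18, Nat.beq (patternIII id I J) (1 + blockIndex .G3 I J) = true := by
    decide +kernel
  rw [← Nat.eq_of_beq_eq_true (h I J)]
  have e : ∀ (x y z : ℕ) (i j : Fin 3), CIRC ![A x, A y, A z] i j = A (CIRC ![x, y, z] i j) := by
    intro x y z i j
    simp only [CIRC, Matrix.of_apply]
    generalize j - i = k
    fin_cases k <;> rfl
  simp only [patternIII, assemble, Matrix.reindex_apply, Matrix.submatrix_apply,
    Matrix.comp_apply]
  generalize (finProdFinEquiv.symm I : Fin 6 × Fin 3) = p
  generalize (finProdFinEquiv.symm J : Fin 6 × Fin 3) = q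
  obtain ⟨p, i⟩ := p
  obtain ⟨q, j⟩ := q
  fin_cases p <;> fin_cases q <;> exact e _ _ _ i j

theorem patternIV_eq (A : ℕ → M) (I J : Fin 18) :
    patternIV A I J = A (1 + blockIndex .G4 I J) := by
  have h : ∀ I J : Fin 18, Nat.beq (patternIV id I J) (1 + blockIndex .G4 I J) = true := by
    decide +kernel
  rw [← Nat.eq_of_beq_eq_true (h I J)]
  simp only [patternIV, assemble, Matrix.reindex_apply, Matrix.submatrix_apply, Matrix.comp_apply]
  generalize (finProdFinEquiv.symm I : Fin 3 × Fin 6) = p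
  generalize (finProdFinEquiv.symm J : Fin 3 × Fin 6) = q
  obtain ⟨p, i⟩ := p
  obtain ⟨q, j⟩ := q
  fin_cases p <;> fin_cases q <;> rfl

/-- Block transposition excludes the argument by the pattern of indices, so the four quarters are
compared separately. -/
theorem patternII_eq {R : Type*} (A : ℕ → Matrix (Fin 2) (Fin 2) R) (I J : Fin 18) :
    patternII A I J = if blockFlip .G2 I then (A (1 + blockIndex .G2 I J))ᵀ
      else A (1 + blockIndex .G2 I J) := by
  have h : ∀ (p q : Fin 2) (i j : Fin 9), 1 + blockIndex .G2 (finProdFinEquiv (p, i) : Fin 18)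
      (finProdFinEquiv (q, j) : Fin 18) = (if p = q then 1 else 10) +
        if p = 0 then ((j - i : Fin 9) : ℕ) else ((i - j : Fin 9) : ℕ) := by decide +kernel
  have h' : ∀ (p : Fin 2) (i : Fin 9), blockFlip .G2 (finProdFinEquiv (p, i) : Fin 18) =
      decide (p = 1) := by decide +kernel
  obtain ⟨⟨p, i⟩, rfl⟩ := (finProdFinEquiv : Fin 2 × Fin 9 ≃ Fin 18).surjective I
  obtain ⟨⟨q, j⟩, rfl⟩ := (finProdFinEquiv : Fin 2 × Fin 9 ≃ Fin 18).surjective J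
  simp only [h, h', patternII, assemble, Matrix.reindex_apply, Matrix.submatrix_apply,
    Matrix.comp_apply]
  erw [Equiv.symm_apply_apply, Equiv.symm_apply_apply]
  fin_cases p <;> fin_cases q <;> rfl

/-- The condition `g_i g_t = g_j` says that the block at `(i, j)` is the coefficient of `g_t`, which
only the summand `t` contributes. -/
theorem sigma_groupElement {R G : Type*} [CommRing R] [Group G] {k n : ℕ} (g : Fin n ≃ G)
    (A : ℕ → Matrix (Fin k) (Fin k) R) (i j t : Fin n) (h : g i * g t = g j) :
    sigma g (groupElement g A) i j = A (1 + t) := by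
  have e : (g i)⁻¹ * g j = g t := by rw [← h, inv_mul_cancel_left]
  rw [sigma, Matrix.of_apply, e, groupElement]
  rw [MonoidAlgebra.coeff_sum, Finsupp.finsetSum_apply, Finset.sum_eq_single t]
  · rw [MonoidAlgebra.coeff_single, Finsupp.single_eq_same, add_comm]
  · intro s _ hs
    exact Finsupp.single_eq_of_ne (g.injective.ne hs.symm)
  · simp

theorem blockIndex_lt : ∀ I J : Fin 18, (blockIndex .G1 I J < 18 ∧ blockIndex .G2 I J < 18) ∧
    blockIndex .G3 I J < 18 ∧ blockIndex .G4 I J < 18 := by decide +kernel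

theorem tau_listingI (A : ℕ → Matrix (Fin 2) (Fin 2) (ZMod 2)) :
    tau listingI (groupElement listingI A) = assemble (patternI A) := by
  refine congrArg assemble (Matrix.ext fun I J => ?_)
  rw [patternI_eq, sigma_groupElement listingI A I J ⟨_, (blockIndex_lt I J).1.1⟩]
  revert I J
  decide +kernel

theorem tau_listingII (A : ℕ → Matrix (Fin 2) (Fin 2) (ZMod 2))
    (hA : ∀ t ∈ Finset.Icc 1 18, (A t)ᵀ = A t) :
    tau listingII (groupElement listingII A) = assemble (patternII A) := by
  refine congrArg assemble (Matrix.ext fun I J => ?_)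
  have h : 1 + blockIndex .G2 I J ∈ Finset.Icc 1 18 := by
    have := (blockIndex_lt I J).1.2
    rw [Finset.mem_Icc]
    omega
  rw [patternII_eq, hA _ h, ite_self,
    sigma_groupElement listingII A I J ⟨_, (blockIndex_lt I J).1.2⟩]
  clear h
  revert I J
  decide +kernel

theorem tau_listingIII (A : ℕ → Matrix (Fin 2) (Fin 2) (ZMod 2)) :
    tau listingIII (groupElement listingIII A) = assemble (patternIII A) := by
  refine congrArg assemble (Matrix.ext fun I J => ?_)
  rw [patternIII_eq, sigma_groupElement listingIII A I J ⟨_, (blockIndex_lt I J).2.1⟩]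
  revert I J
  decide +kernel

theorem tau_listingIV (A : ℕ → Matrix (Fin 2) (Fin 2) (ZMod 2)) :
    tau listingIV (groupElement listingIV A) = assemble (patternIV A) := by
  refine congrArg assemble (Matrix.ext fun I J => ?_)
  rw [patternIV_eq, sigma_groupElement listingIV A I J ⟨_, (blockIndex_lt I J).2.2⟩]
  revert I J
  decide +kernel

end Patterns


/-! ### The entries of the matrices of the table -/

section Entries

theorem pattern_eq {R : Type*} (κ : Kind) (A : ℕ → Matrix (Fin 2) (Fin 2) R) (I J : Fin 18) :
    κ.pattern A I J = if blockFlip κ I then (A (1 + blockIndex κ I J))ᵀ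
      else A (1 + blockIndex κ I J) := by
  cases κ
  case G1 | G1p | G1pp | G1ppp | G1pppp => exact patternI_eq A I J
  case G2 | G2p | G2pp => exact patternII_eq A I J
  case G3 => exact patternIII_eq A I J
  case G4 | G4p => exact patternIV_eq A I J

theorem isPersym_succ (κ : Kind) (t : ℕ) : κ.isPersym (1 + t) = persymFlag κ t := by
  cases κ
  case G1 | G2 | G3 | G4 | G1pppp | G2pp => rfl
  case G1p =>
    change decide (10 ≤ 1 + t) = Nat.ble 9 t
    rw [Bool.eq_iff_iff, decide_eq_true_eq, Nat.ble_eq]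
    omega
  case G1pp =>
    change decide ((1 + t) % 2 = 0) = Nat.beq (t % 2) 1
    rw [Bool.eq_iff_iff, decide_eq_true_eq, Nat.beq_eq]
    omega
  case G1ppp | G2p | G4p =>
    change decide (1 + t ≤ 9) = Nat.ble t 8
    rw [Bool.eq_iff_iff, decide_eq_true_eq, Nat.ble_eq]
    omega

theorem bit_eq_one (w k : ℕ) :
    decide (bit w k = 1) = Nat.beq (Nat.mod (Nat.shiftRight w k) 2) 1 := by
  have h : w.testBit k = Nat.beq (Nat.mod (Nat.shiftRight w k) 2) 1 := by
    rw [Nat.testBit_eq_decide_div_mod_eq, ← Nat.shiftRight_eq_div_pow, Bool.eq_iff_iff,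
      decide_eq_true_eq, Nat.beq_eq]
    rfl
  rw [← h, bit]
  cases w.testBit k <;> rfl

theorem block_eq (κ : Kind) (t w : ℕ) (a b : Fin 2) : decide (κ.block (1 + t) w a b = 1) =
    Nat.beq (Nat.mod (Nat.shiftRight w (bitIndex (persymFlag κ t) a b)) 2) 1 := by
  rw [← bit_eq_one, Kind.block, isPersym_succ]
  cases persymFlag κ t <;> fin_cases a <;> fin_cases b <;> rfl

theorem entry_eq (r : TableRow) (i j : Fin 36) :
    entry r.kind r.params i j = decide (r.rightHalf i j = 1) := by
  change _ = decide (r.kind.pattern r.block (finProdFinEquiv.symm i : Fin 18 × Fin 2).1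
    (finProdFinEquiv.symm j : Fin 18 × Fin 2).1 (finProdFinEquiv.symm i : Fin 18 × Fin 2).2
    (finProdFinEquiv.symm j : Fin 18 × Fin 2).2 = 1)
  have h1 : ∀ i : Fin 36, ((finProdFinEquiv.symm i : Fin 18 × Fin 2).1 : ℕ) = Nat.div i 2 :=
    fun i => rfl
  have h2 : ∀ i : Fin 36, ((finProdFinEquiv.symm i : Fin 18 × Fin 2).2 : ℕ) = Nat.mod i 2 :=
    fun i => rfl
  have h3 : ∀ t, r.block (1 + t) = r.kind.block (1 + t) (r.params.getD t 0) := fun t => by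
    rw [TableRow.block, Nat.add_sub_cancel_left]
  rw [entry, pattern_eq, ← h1, ← h1, ← h2, ← h2, bitAt, nth_eq_getD, h3]
  cases blockFlip r.kind (finProdFinEquiv.symm i : Fin 18 × Fin 2).1
  · exact (block_eq _ _ _ _ _).symm
  · exact (block_eq _ _ _ _ _).symm

end Entries

/-! ### The tables of the program -/

section Tables

theorem tab_eq {α : Type} (f : ℕ → α) (n : ℕ) :
    tab f n = (List.finRange n).map fun i : Fin n => f i := by
  have h : ∀ n (l : List α), (Nat.rec (motive := fun _ => List α → List α) (fun l => l)
      (fun k ih l => ih (f k :: l)) n l : List α) = (List.range n).map f ++ l := by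
    intro n
    induction n with
    | zero => intro l; rfl
    | succ n ih =>
      intro l
      exact (ih (f n :: l)).trans (by simp [List.range_succ])
  rw [tab, h, List.append_nil, ← List.map_coe_finRange_eq_range, List.map_map]
  rfl

theorem pack_single (i : Fin 36) :
    pack (Pi.single i 1 : Message) = Nat.shiftLeft 1 (Nat.mul 24 i) := by
  revert i
  decide +kernel

variable {κ : Kind} {params : List ℕ} {M : Matrix (Fin 36) (Fin 36) (ZMod 2)}

theorem rowBits_eq (hM : ∀ i j : Fin 36, entry κ params i j = decide (M i j = 1)) (i : Fin 36) :
    rowBits κ params i = bits (M i) := by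
  rw [rowBits, tab_eq]
  exact List.map_congr_left fun j _ => hM i j

theorem columnBits_eq (hM : ∀ i j : Fin 36, entry κ params i j = decide (M i j = 1))
    (j : Fin 36) : columnBits κ params j = bits fun i => M i j := by
  rw [columnBits, tab_eq]
  exact List.map_congr_left fun i _ => hM i j

theorem encodeLeft_single (i : Fin 36) :
    encodeLeft M (Pi.single i 1) = Fin.append (Pi.single i 1) (M i) := by
  change Fin.append _ _ = _
  rw [Matrix.single_one_vecMul]
  rfl

theorem leftHalf_represents (hM : ∀ i j : Fin 36, entry κ params i j = decide (M i j = 1)) :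
    (leftHalf κ params).Represents M (encodeLeft M) where
  cols_eq := by
    change tab (columnBits κ params) 36 = _
    rw [tab_eq]
    exact List.map_congr_left fun j _ => columnBits_eq hM j
  gens_eq := by
    change tab (fun i => Nat.add (Nat.shiftLeft 1 (Nat.mul 24 i))
      (Nat.mul (Nat.shiftLeft 1 864) (packBits (rowBits κ params i)))) 36 = _
    rw [tab_eq]
    refine List.map_congr_left fun i _ => ?_
    rw [encodeLeft_single, pack_append, pack_single, rowBits_eq hM, packBits_bits,
      show (16777216 : ℕ) ^ 36 = Nat.shiftLeft 1 864 by decide +kernel]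
    rfl

theorem rightHalf_represents (hM : ∀ i j : Fin 36, entry κ params i j = decide (M i j = 1)) :
    (rightHalf κ params).Represents Mᵀ (encodeRight M) where
  cols_eq := by
    change tab (rowBits κ params) 36 = _
    rw [tab_eq]
    exact List.map_congr_left fun i _ => rowBits_eq hM i
  gens_eq := by
    change tab (fun j => Nat.add (packBits (columnBits κ params j))
      (Nat.mul (Nat.shiftLeft 1 864) (Nat.shiftLeft 1 (Nat.mul 24 j)))) 36 = _
    rw [tab_eq]
    refine List.map_congr_left fun j _ => ?_
    have e : encodeRight M (Pi.single j 1) = Fin.append (fun i => M i j) (Pi.single j 1) := by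
      change Fin.append _ _ = _
      rw [Matrix.single_one_vecMul]
      rfl
    rw [e, pack_append, pack_single, columnBits_eq hM, packBits_bits,
      show (16777216 : ℕ) ^ 36 = Nat.shiftLeft 1 864 by decide +kernel]
    rfl

theorem allEven_eq_true {a : ℕ} {l : List ℕ} (h : allEven a l = true) {b : ℕ} (hb : b ∈ l) :
    dot a b % 2 = 0 := by
  induction l with
  | nil => simp at hb
  | cons c l ih =>
    change (Bool.rec (allEven a l) false (Nat.beq (Nat.mod (dot a c) 2) 1) : Bool) = true at h
    cases hc : Nat.beq (Nat.mod (dot a c) 2) 1 with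
    | true => simp [hc] at h
    | false =>
      rw [hc] at h
      rcases List.mem_cons.1 hb with rfl | hb
      · have : dot a b % 2 ≠ 1 := Nat.ne_of_beq_eq_false hc
        omega
      · exact ih h hb

theorem dot_comm (a b : ℕ) : dot a b = dot b a :=
  congrArg (fun x => Nat.mod x 16777215) (Nat.and_comm a b)

theorem selfOrthogonal_eq_true {l : List ℕ} (h : selfOrthogonal l = true) {a b : ℕ} (ha : a ∈ l)
    (hb : b ∈ l) : dot a b % 2 = 0 := by
  induction l with
  | nil => simp at hb
  | cons c l ih =>
    change (Bool.rec false (selfOrthogonal l) (allEven c (c :: l)) : Bool) = true at h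
    cases hc : allEven c (c :: l) with
    | false => simp [hc] at h
    | true =>
      rw [hc] at h
      rcases List.mem_cons.1 ha with rfl | ha'
      · exact allEven_eq_true hc hb
      · rcases List.mem_cons.1 hb with rfl | hb'
        · rw [dot_comm]
          exact allEven_eq_true hc ha
        · exact ih h ha' hb'

variable {H : Half}

/-- An even overlap of two rows of `[I | M]` means that the product of the rows of `M` equals that
of the unit vectors. -/
theorem mul_transpose_eq_one (hH : H.Represents M (encodeLeft M))
    (h : selfOrthogonal H.gens = true) : M * Mᵀ = 1 := by
  ext i j
  have hmem : ∀ i : Fin 36, pack (Fin.append (Pi.single i 1 : Message) (M i)) ∈ H.gens := by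
    intro i
    rw [hH.gens_eq, ← encodeLeft_single]
    exact List.mem_map_of_mem (List.mem_finRange i)
  have h1 := selfOrthogonal_eq_true h (hmem i) (hmem j)
  have h2 := cast_dot_pack (Fin.append (Pi.single i 1 : Message) (M i))
    (Fin.append (Pi.single j 1 : Message) (M j)) (by norm_num)
  rw [(CharP.cast_eq_zero_iff (ZMod 2) 2 _).2 (Nat.dvd_of_mod_eq_zero h1), dotProduct_eq_parts,
    leftPart_append, leftPart_append, rightPart_append, rightPart_append] at h2
  have h3 := (CharTwo.add_eq_zero.1 h2.symm).symm
  rw [Matrix.mul_apply]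
  refine h3.trans ?_
  rw [single_one_dotProduct, Pi.single_apply, Matrix.one_apply]

theorem natCast_eq_one (k : ℕ) : (k : ZMod 2) = 1 ↔ k % 2 = 1 := by
  rw [← Nat.cast_one, ZMod.natCast_eq_natCast_iff']

/-- All weights are even by self-duality, so half the weight is odd exactly for weight 2 modulo 4.
-/
theorem oddHalves_eq (hH : H.Represents M (encodeLeft M)) (hM : M * Mᵀ = 1) :
    oddHalves H.gens = bits (rowHalfWeights M) := by
  rw [oddHalves, hH.gens_eq, List.map_map]
  refine List.map_congr_left fun i _ => ?_
  have h2 : 2 ∣ hammingNorm (encodeLeft M (Pi.single i 1)) :=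
    (isSelfDual_codeOf hM).even ((systematic_left M).enc_mem _)
  have e : dot (pack (encodeLeft M (Pi.single i 1))) (pack (encodeLeft M (Pi.single i 1))) =
    hammingNorm (encodeLeft M (Pi.single i 1)) := dot_pack_self _ (by norm_num)
  change Nat.beq (dot (pack (encodeLeft M (Pi.single i 1)))
    (pack (encodeLeft M (Pi.single i 1))) % 4) 2 = decide (halfWeight _ = 1)
  rw [e, ← encodeLeft_single, halfWeight, Bool.eq_iff_iff, Nat.beq_eq, decide_eq_true_eq,
    natCast_eq_one]
  omega

theorem xorSelect_pack (enc : Message →+ Word) (q : Message) (l : List (Fin 36)) (c : Word) :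
    xorSelect (l.map fun j => decide (q j = 1)) (l.map fun i => pack (enc (Pi.single i 1)))
      (pack c) = pack (c + enc (l.map fun i => Pi.single i (q i)).sum) := by
  induction l generalizing c with
  | nil => simp [xorSelect]
  | cons i l ih =>
    have h : (Bool.rec (pack c) (Nat.xor (pack c) (pack (enc (Pi.single i 1))))
        (decide (q i = 1)) : ℕ) = pack (c + enc (Pi.single i (q i))) := by
      by_cases hq : q i = 1
      · rw [hq, pack_add]
        rfl
      · have h0 : q i = 0 := by rwa [zmod_two_eq_one_iff, not_not] at hq
        rw [h0, Pi.single_zero, map_zero, add_zero]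
        rfl
    change xorSelect (l.map fun j => decide (q j = 1))
      (l.map fun i => pack (enc (Pi.single i 1))) (Bool.rec (pack c)
        (Nat.xor (pack c) (pack (enc (Pi.single i 1)))) (decide (q i = 1))) = _
    rw [h, ih, List.map_cons, List.sum_cons, map_add, add_assoc]

theorem rightBits_eq (hH : H.Represents M (encodeLeft M)) (q : Message) :
    rightBits (xorSelect (bits q) H.gens 0) = bits (q ᵥ* M) := by
  have h := xorSelect_pack (encodeLeft M) q (List.finRange 36) 0
  have e : ((List.finRange 36).map fun i => Pi.single i (q i)).sum = q := by
    rw [← Fin.sum_univ_def, Finset.univ_sum_single]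
  rw [e, zero_add, pack_zero] at h
  rw [bits, hH.gens_eq, h, rightBits, tab_eq]
  refine List.map_congr_left fun i _ => ?_
  have h2 : digit (pack (encodeLeft M q)) (Fin.natAdd 36 i : Fin (36 + 36)) =
      digitAt (encodeLeft M q) (Fin.natAdd 36 i) := digit_packNat (digitAt_lt _) _
  have h3 : digitAt (encodeLeft M q) (Fin.natAdd 36 i) = (decide ((q ᵥ* M) i = 1)).toNat :=
    congrArg (fun x : ZMod 2 => (decide (x = 1)).toNat)
      (congrFun (rightPart_append q (q ᵥ* M)) i)
  rw [Fin.val_natAdd, h3] at h2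
  generalize pack (encodeLeft M q) = x at h2 ⊢
  change Nat.beq (digit x (36 + i)) 1 = _
  rw [h2]
  cases decide ((q ᵥ* M) i = 1) <;> rfl

end Tables


/-! ### Symmetries of the matrices of the table -/

/-- Exchanging the two indices inside every block fixes circulant blocks and transposes persymmetric
ones. -/
def flipUnit (i : ℕ) : ℕ := Nat.add (Nat.mul 2 (Nat.div i 2)) (Nat.sub 1 (Nat.mod i 2))

/-- The map `18 p + 2 b + a ↦ 18 p + 2 ((s b + c) % 9) + a`, where `s` and `c` depend on `p`. -/
def moveNine (s c : ℕ → ℕ) (i : ℕ) : ℕ :=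
  Nat.add (Nat.mul 18 (Nat.div i 18)) (Nat.add (Nat.mod i 2) (Nat.mul 2
    (Nat.mod (Nat.add (c (Nat.div i 18)) (Nat.mul (s (Nat.div i 18)) (Nat.div (Nat.mod i 18) 2)))
      9)))

/-- The same for `n` blocks in each of the parts. -/
def nextBlock (n : ℕ) (i : ℕ) : ℕ :=
  Nat.add (Nat.mul (2 * n) (Nat.div i (2 * n))) (Nat.mod (Nat.add i 2) (2 * n))

def addMod (c : ℕ) (i : ℕ) : ℕ := Nat.mod (Nat.add i c) 36

/-- The position of an entry in the list of parameters: three times the number of the block plus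
the number of the binary digit. -/
def place (κ : Kind) (i j : ℕ) : ℕ :=
  Nat.add (Nat.mul 3 (blockIndex κ (Nat.div i 2) (Nat.div j 2)))
    (Bool.rec (bitIndex (persymFlag κ (blockIndex κ (Nat.div i 2) (Nat.div j 2)))
        (Nat.mod i 2) (Nat.mod j 2))
      (bitIndex (persymFlag κ (blockIndex κ (Nat.div i 2) (Nat.div j 2)))
        (Nat.mod j 2) (Nat.mod i 2)) (blockFlip κ (Nat.div i 2)))

/-- Permutations `π` of the indices preserving the matrices of a kind; with the flag `true` they
transpose the matrix. -/
def kindGenerators (κ : Kind) : List (Bool × (ℕ → ℕ)) :=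
  match κ with
  | .G1 => [(false, moveNine (fun _ => 1) fun p => Nat.add 1 (Nat.mul 7 p)), (false, addMod 18),
      (false, flipUnit)]
  | .G1p | .G1pp | .G1ppp | .G1pppp =>
    [(false, moveNine (fun _ => 1) fun p => Nat.add 1 (Nat.mul 7 p)), (false, addMod 18)]
  | .G2 => [(false, nextBlock 9),
      (false, fun i => moveNine (fun _ => 8) (fun _ => 0) (flipUnit (addMod 18 i))),
      (false, flipUnit)]
  | .G2p | .G2pp => [(false, nextBlock 9),
      (false, fun i => moveNine (fun _ => 8) (fun _ => 0) (flipUnit (addMod 18 i)))]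
  | .G3 => [(false, nextBlock 3), (false, fun i => bif Nat.blt i 30 then Nat.add i 6
      else nextBlock 3 (Nat.sub i 30)), (false, flipUnit), (true, Nat.sub 35)]
  | .G4 => [(false, nextBlock 6), (false, addMod 12), (false, flipUnit), (true, Nat.sub 35)]
  | .G4p => [(false, nextBlock 6), (false, addMod 12), (true, Nat.sub 35)]

/-- Further symmetries of two codes of the table. -/
def specialGenerators (κ : Kind) (α : ℕ) : List (Bool × (ℕ → ℕ)) :=
  match κ with
  | .G1 => bif Nat.beq α 72 then [(true, moveNine (fun _ => 8) (Nat.mul 8))] else []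
  | .G2pp => bif Nat.beq α 36 then [(false, fun i => Nat.add (Nat.mul 18 (Nat.div i 18))
        (Nat.mod (Nat.add i (Nat.add 1 (Nat.mul 6 (Nat.mod i 2)))) 18))] else []
  | _ => []

def forallBelow (n : ℕ) (p : ℕ → Bool) : Bool :=
  Nat.rec (motive := fun _ => Bool) true (fun k ih => Bool.rec false ih (p k)) n

/-- The list of images being distinct and below 36 makes the map a permutation; the flag requires
transposition of the matrix instead of invariance. -/
def isSymmetry (e : ℕ → ℕ → ℕ) (g : Bool × (ℕ → ℕ)) : Bool :=
  distinct (tab g.2 36) && (forallBelow 36 (fun i => Nat.blt (g.2 i) 36) &&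
    forallBelow 36 fun i => forallBelow 36 fun j =>
      Nat.beq (e (g.2 i) (g.2 j)) (bif g.1 then e j i else e i j))

def checkSpecial (r : TableRow) : Bool :=
  (specialGenerators r.kind r.autOrder).all
    (isSymmetry fun i j => bif entry r.kind r.params i j then 1 else 0)

def generators (κ : Kind) (α : ℕ) : List (Bool × (ℕ → ℕ)) :=
  kindGenerators κ ++ specialGenerators κ α

/-- A symmetry acts on both halves of the coordinates alike; one that transposes the matrix also
exchanges the halves. -/
def action (g : Bool × (ℕ → ℕ)) (k : ℕ) : ℕ :=
  bif Bool.xor g.1 (Nat.ble 36 k) then Nat.add 36 (g.2 (Nat.mod k 36)) else g.2 (Nat.mod k 36)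

/-- Representatives of the orbits of the coordinates. -/
def orbitRep (κ : Kind) (α k : ℕ) : ℕ :=
  bif Nat.beq α 72 then 0 else bif Nat.beq α 36 then
    match κ with
    | .G4p => Nat.mul 36 (Nat.mod (Nat.add k (Nat.div k 36)) 2)
    | _ => Nat.mul 36 (Nat.div k 36)
  else Nat.add (Nat.mul 36 (Nat.div k 36)) (
    match κ with
    | .G2p | .G2pp => Nat.mod (Nat.add k (Nat.div k 18)) 2
    | _ => Nat.mod k 2)

def orbitReps (α : ℕ) : List ℕ :=
  bif Nat.beq α 72 then [0] else bif Nat.beq α 36 then [0, 36] else [0, 36, 1, 37]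

/-- An order in which every coordinate which is not a representative is reached from a smaller one
by one of the generators. -/
def orbitKey (κ : Kind) (α k : ℕ) : ℕ :=
  bif Nat.beq (orbitRep κ α k) 36 then Nat.mod (Nat.add k 36) 72 else k

/-- Each coordinate is a representative or the image, under some generator, of a coordinate of the
same class with smaller key. This proves by induction that every class lies in one orbit, without
generating the group. -/
def checkOrbits (κ : Kind) (α : ℕ) : Bool :=
  forallBelow 72 fun k => (orbitReps α).any (Nat.beq (orbitRep κ α k)) &&
    (Nat.beq (orbitRep κ α k) k || !forallBelow 72 fun l =>
      !(Nat.blt (orbitKey κ α l) (orbitKey κ α k) &&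
        (Nat.beq (orbitRep κ α l) (orbitRep κ α k) &&
          (generators κ α).any fun g => Nat.beq (action g l) k)))

/-- The orders of the automorphism groups for the codes of a kind. -/
def groupOrders (κ : Kind) : List ℕ :=
  match κ with
  | .G1 => [36, 72]
  | .G1p | .G1pp | .G1ppp | .G1pppp | .G2p => [18]
  | .G2 | .G4p => [36]
  | .G2pp => [36, 18]
  | .G3 | .G4 => [72]

set_option maxRecDepth 10000 in
theorem checkOrbits_groupOrders (κ : Kind) :
    ∀ α ∈ groupOrders κ, checkOrbits κ α = true := by
  cases κ <;> decide +kernel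

theorem card_orbitRep (κ : Kind) : ∀ α ∈ groupOrders κ, ∀ i ∈ orbitReps α,
    (Finset.univ.filter fun k : Fin 72 => orbitRep κ α k = i).card = α := by
  cases κ <;> decide +kernel

/-- An entry depends on its position only through `place`, so symmetries of this function are
symmetries of every matrix of the kind, whatever the parameters. -/
theorem isSymmetry_kindGenerators (κ : Kind) :
    (kindGenerators κ).all (isSymmetry (place κ)) = true := by
  cases κ <;> decide +kernel

theorem forallBelow_eq_true {n : ℕ} {p : ℕ → Bool} :
    forallBelow n p = true ↔ ∀ k < n, p k = true := by
  induction n with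
  | zero => simp [forallBelow]
  | succ n ih =>
    change (Bool.rec false (forallBelow n p) (p n) : Bool) = true ↔ _
    rw [Nat.forall_lt_succ_right, ← ih]
    cases p n <;> simp

theorem exists_perm_of_isSymmetry {e : ℕ → ℕ → ℕ} {g : Bool × (ℕ → ℕ)}
    (h : isSymmetry e g = true) : ∃ π : Equiv.Perm (Fin 36), (∀ i, (π i : ℕ) = g.2 i) ∧
      ∀ i j, e (π i) (π j) = bif g.1 then e j i else e i j := by
  rw [isSymmetry, Bool.and_eq_true, Bool.and_eq_true, distinct_eq_true, tab_eq,
    forallBelow_eq_true, forallBelow_eq_true] at h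
  obtain ⟨h1, h2, h3⟩ := h
  have hlt : ∀ i : Fin 36, g.2 i < 36 := fun i => Nat.blt_eq.mp (h2 i i.2)
  have hinj : Function.Injective fun i : Fin 36 => (⟨g.2 i, hlt i⟩ : Fin 36) := by
    intro i j hij
    exact List.inj_on_of_nodup_map h1 (List.mem_finRange i) (List.mem_finRange j)
      (congrArg Fin.val hij)
  refine ⟨Equiv.ofBijective _ (Finite.injective_iff_bijective.1 hinj), fun _ => rfl,
    fun i j => ?_⟩
  exact Nat.eq_of_beq_eq_true (forallBelow_eq_true.1 (h3 i i.2) j j.2)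

theorem bitIndex_lt (p : Bool) (a b : ℕ) : bitIndex p a b < 3 := by
  unfold bitIndex
  cases p <;> cases Nat.beq a b <;> cases Nat.ble a b <;> decide

theorem entry_eq_place (κ : Kind) (params : List ℕ) (i j : ℕ) : entry κ params i j =
    Nat.beq (Nat.mod (Nat.shiftRight (nth params (place κ i j / 3)) (place κ i j % 3)) 2) 1 := by
  have h : ∀ t b : ℕ, b < 3 → Nat.add (Nat.mul 3 t) b / 3 = t ∧ Nat.add (Nat.mul 3 t) b % 3 = b := by
    intro t b hb
    change (3 * t + b) / 3 = t ∧ (3 * t + b) % 3 = b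
    omega
  rw [entry, bitAt, place]
  cases blockFlip κ (Nat.div i 2)
  · rw [(h _ _ (bitIndex_lt _ _ _)).1, (h _ _ (bitIndex_lt _ _ _)).2]
  · rw [(h _ _ (bitIndex_lt _ _ _)).1, (h _ _ (bitIndex_lt _ _ _)).2]

/-! ### Automorphisms and orbits of coordinates -/

section Automorphisms

variable {n : ℕ} {M : Matrix (Fin n) (Fin n) (ZMod 2)}

/-- A permutation acting on both halves of the coordinates, followed by an exchange of these if
the flag is `true`. -/
def liftPerm (s : Bool) (π : Equiv.Perm (Fin n)) : Equiv.Perm (Fin (n + n)) :=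
  finSumFinEquiv.permCongr ((Equiv.sumCongr π π).trans
    (bif s then Equiv.sumComm _ _ else Equiv.refl _))

theorem liftPerm_castAdd (s : Bool) (π : Equiv.Perm (Fin n)) (i : Fin n) :
    liftPerm s π (Fin.castAdd n i) = bif s then Fin.natAdd n (π i) else Fin.castAdd n (π i) := by
  cases s <;> simp [liftPerm, Equiv.permCongr_apply, -Fin.natAdd_eq_addNat]

theorem liftPerm_natAdd (s : Bool) (π : Equiv.Perm (Fin n)) (i : Fin n) :
    liftPerm s π (Fin.natAdd n i) = bif s then Fin.castAdd n (π i) else Fin.natAdd n (π i) := by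
  cases s <;> simp [liftPerm, Equiv.permCongr_apply, -Fin.natAdd_eq_addNat]

theorem comp_vecMul {N : Matrix (Fin n) (Fin n) (ZMod 2)} {π : Equiv.Perm (Fin n)}
    (h : ∀ i j, N (π i) (π j) = M i j) (x : Fin n → ZMod 2) :
    (x ∘ π) ᵥ* M = (x ᵥ* N) ∘ π := by
  funext j
  simp only [Matrix.vecMul, dotProduct, Function.comp_apply, ← h]
  exact Equiv.sum_comp π fun i => x i * N i (π j)

theorem comp_left_inj {π : Equiv.Perm (Fin n)} {x y : Fin n → ZMod 2} :
    x ∘ π = y ∘ π ↔ x = y := π.surjective.injective_comp_right.eq_iff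

theorem liftPerm_false_mem {π : Equiv.Perm (Fin n)} (h : ∀ i j, M (π i) (π j) = M i j) :
    liftPerm false π ∈ automorphismGroup (codeOf M) := by
  intro c
  have h1 : leftPart (c ∘ liftPerm false π) = leftPart c ∘ π := by
    funext i
    simp [leftPart, liftPerm_castAdd]
  have h2 : rightPart (c ∘ liftPerm false π) = rightPart c ∘ π := by
    funext i
    simp [rightPart, liftPerm_natAdd, -Fin.natAdd_eq_addNat]
  rw [mem_codeOf, mem_codeOf, h1, h2, comp_vecMul h, comp_left_inj]

theorem mem_codeOf_iff_left (hM : M * Mᵀ = 1) {c : Fin (n + n) → ZMod 2} :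
    c ∈ codeOf M ↔ leftPart c = rightPart c ᵥ* Mᵀ := by
  have hM' := transpose_mul_self_eq_one hM
  refine (mem_codeOf M).trans ⟨fun h => ?_, fun h => ?_⟩
  · rw [h, Matrix.vecMul_vecMul, hM, Matrix.vecMul_one]
  · rw [h, Matrix.vecMul_vecMul, hM', Matrix.vecMul_one]

/-- Exchanging the halves replaces `M` by `Mᵀ` in the description of the code, by orthogonality; the
permutation then carries `Mᵀ` back to `M`. -/
theorem liftPerm_true_mem (hM : M * Mᵀ = 1) {π : Equiv.Perm (Fin n)}
    (h : ∀ i j, M (π i) (π j) = M j i) : liftPerm true π ∈ automorphismGroup (codeOf M) := by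
  intro c
  have h1 : leftPart (c ∘ liftPerm true π) = rightPart c ∘ π := by
    funext i
    simp [leftPart, rightPart, liftPerm_castAdd, -Fin.natAdd_eq_addNat]
  have h2 : rightPart (c ∘ liftPerm true π) = leftPart c ∘ π := by
    funext i
    simp [leftPart, rightPart, liftPerm_natAdd, -Fin.natAdd_eq_addNat]
  rw [mem_codeOf, mem_codeOf_iff_left hM, h1, h2,
    comp_vecMul (N := Mᵀ) (fun i j => by rw [Matrix.transpose_apply, h]), comp_left_inj]

end Automorphisms

/-! ### Orbits of coordinates under the known automorphisms -/

section Orbits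

variable {κ : Kind} {params : List ℕ} {M : Matrix (Fin 36) (Fin 36) (ZMod 2)}

theorem action_eq {g : Bool × (ℕ → ℕ)} {π : Equiv.Perm (Fin 36)} (h : ∀ i, (π i : ℕ) = g.2 i)
    (k : Fin (36 + 36)) : action g k = liftPerm g.1 π k := by
  obtain ⟨s, f⟩ := g
  refine Fin.addCases (fun i => ?_) (fun i => ?_) k
  · have h1 : Nat.ble 36 (Fin.castAdd 36 i : Fin (36 + 36)) = false := by
      rw [Bool.eq_false_iff, Ne, Nat.ble_eq, Fin.val_castAdd]
      omega
    have h2 : Nat.mod (Fin.castAdd 36 i : Fin (36 + 36)) 36 = i := Nat.mod_eq_of_lt i.2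
    rw [action, h1, h2, ← h, liftPerm_castAdd]
    cases s <;> rfl
  · have h1 : Nat.ble 36 (Fin.natAdd 36 i : Fin (36 + 36)) = true := by
      rw [Nat.ble_eq, Fin.val_natAdd]
      omega
    have h2 : Nat.mod (Fin.natAdd 36 i : Fin (36 + 36)) 36 = i := by
      rw [Fin.val_natAdd]
      exact (Nat.add_mod_left _ _).trans (Nat.mod_eq_of_lt i.2)
    rw [action, h1, h2, ← h, liftPerm_natAdd]
    cases s <;> rfl

theorem exists_automorphism (hM : ∀ i j : Fin 36, entry κ params i j = decide (M i j = 1))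
    (hM' : M * Mᵀ = 1) {g : Bool × (ℕ → ℕ)}
    (hg : ∃ π : Equiv.Perm (Fin 36), (∀ i, (π i : ℕ) = g.2 i) ∧ ∀ i j : Fin 36,
      entry κ params (π i) (π j) = bif g.1 then entry κ params j i else entry κ params i j) :
    ∃ σ ∈ automorphismGroup (codeOf M), ∀ k, (σ k : ℕ) = action g k := by
  obtain ⟨π, h1, h2⟩ := hg
  refine ⟨liftPerm g.1 π, ?_, fun k => (action_eq h1 k).symm⟩
  have inj : ∀ a b : ZMod 2, decide (a = 1) = decide (b = 1) → a = b := by decide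
  obtain ⟨s, f⟩ := g
  cases s
  · refine liftPerm_false_mem fun i j => inj _ _ ?_
    rw [← hM, ← hM]
    exact h2 i j
  · refine liftPerm_true_mem hM' fun i j => inj _ _ ?_
    rw [← hM, ← hM]
    exact h2 i j

theorem exists_automorphism_of_generator
    (hM : ∀ i j : Fin 36, entry κ params i j = decide (M i j = 1)) (hM' : M * Mᵀ = 1) {α : ℕ}
    (hs : (specialGenerators κ α).all
      (isSymmetry fun i j => bif entry κ params i j then 1 else 0) = true)
    {g : Bool × (ℕ → ℕ)} (hg : g ∈ generators κ α) :
    ∃ σ ∈ automorphismGroup (codeOf M), ∀ k, (σ k : ℕ) = action g k := by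
  refine exists_automorphism hM hM' ?_
  rcases List.mem_append.1 hg with hg | hg
  · obtain ⟨π, h1, h2⟩ := exists_perm_of_isSymmetry
      (List.all_eq_true.1 (isSymmetry_kindGenerators κ) g hg)
    refine ⟨π, h1, fun i j => ?_⟩
    rw [entry_eq_place, h2]
    cases g.1
    · rw [cond_false, cond_false, entry_eq_place]
    · rw [cond_true, cond_true, entry_eq_place]
  · obtain ⟨π, h1, h2⟩ := exists_perm_of_isSymmetry (List.all_eq_true.1 hs g hg)
    refine ⟨π, h1, fun i j => ?_⟩
    have h3 := h2 i j
    generalize entry κ params (π i) (π j) = x at h3 ⊢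
    generalize entry κ params i j = y at h3 ⊢
    generalize entry κ params j i = z at h3 ⊢
    revert h3
    cases g.1 <;> cases x <;> cases y <;> cases z <;> decide

theorem orbitRep_mem {α : ℕ} (ho : checkOrbits κ α = true) {k : ℕ} (hk : k < 72) :
    orbitRep κ α k ∈ orbitReps α := by
  have h := forallBelow_eq_true.1 ho k hk
  rw [Bool.and_eq_true, List.any_eq_true] at h
  obtain ⟨⟨i, hi, hi2⟩, -⟩ := h
  rwa [Nat.eq_of_beq_eq_true hi2]

theorem orbitReps_lt (α : ℕ) : ∀ i ∈ orbitReps α, i < 72 := by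
  unfold orbitReps
  cases Nat.beq α 72 <;> cases Nat.beq α 36 <;> decide

theorem exists_automorphism_orbitRep {C : Submodule (ZMod 2) Word} {α : ℕ}
    (ho : checkOrbits κ α = true)
    (hC : ∀ g ∈ generators κ α, ∃ σ ∈ automorphismGroup C, ∀ k, (σ k : ℕ) = action g k)
    (k : Fin (36 + 36)) (i : Fin (36 + 36)) (hi : orbitRep κ α k = i) :
    ∃ σ ∈ automorphismGroup C, σ i = k := by
  induction hm : orbitKey κ α k using Nat.strong_induction_on generalizing k with
  | _ m ih =>
    have h := forallBelow_eq_true.1 ho k k.2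
    rw [Bool.and_eq_true, Bool.or_eq_true] at h
    rcases h.2 with h2 | h2
    · exact ⟨1, one_mem _, Fin.ext (hi.symm.trans (Nat.eq_of_beq_eq_true h2))⟩
    · rw [Bool.not_eq_true', Bool.eq_false_iff, Ne, forallBelow_eq_true] at h2
      push Not at h2
      obtain ⟨l, hl, h3⟩ := h2
      simp only [ne_eq, Bool.not_eq_true', Bool.not_eq_false, Bool.and_eq_true,
        List.any_eq_true, Nat.blt_eq, Nat.beq_eq] at h3
      obtain ⟨h4, h5, g, hg, h6⟩ := h3
      obtain ⟨σ, hσ, hσ2⟩ := ih _ (hm ▸ h4) ⟨l, hl⟩ (h5.trans hi) rfl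
      obtain ⟨ρ, hρ, hρ2⟩ := hC g hg
      refine ⟨ρ * σ, mul_mem hρ hσ, Fin.ext ?_⟩
      rw [Equiv.Perm.mul_apply, hσ2, hρ2]
      exact h6

end Orbits


/-! ### Words of small weight through a coordinate -/

section Through

variable {n : ℕ} (C : Submodule (ZMod 2) (Fin n → ZMod 2))

open Classical in
/-- The codewords of weight at most 12 with a one at a given coordinate. -/
noncomputable def lightThrough (i : Fin n) : Finset (Fin n → ZMod 2) :=
  Finset.univ.filter fun c => c ∈ C ∧ c i = 1 ∧ hammingNorm c ≤ 12

/-- The hash values attached by a coordinate to all the coordinates. -/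
noncomputable def hashThrough (i : Fin n) : Fin n → ℕ := hashFun (lightThrough C i).toList

variable {C}

theorem mem_lightThrough {i : Fin n} {c : Fin n → ZMod 2} :
    c ∈ lightThrough C i ↔ c ∈ C ∧ c i = 1 ∧ hammingNorm c ≤ 12 := by
  simp [lightThrough]

theorem perm_lightThrough {i : Fin n} {L : List (Fin n → ZMod 2)} (hL : L.Nodup)
    (h : ∀ c, c ∈ L ↔ c ∈ C ∧ c i = 1 ∧ hammingNorm c ≤ 12) :
    List.Perm L (lightThrough C i).toList := by
  rw [List.perm_ext_iff_of_nodup hL (Finset.nodup_toList _)]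
  intro c
  rw [h, Finset.mem_toList, mem_lightThrough]

theorem hashStep_perm {L L' : List (Fin n → ZMod 2)} (h : L.Perm L') (f : Fin n → ℕ) :
    hashStep L f = hashStep L' f := by
  funext k
  exact (h.map _).sum_eq

theorem hashFun_perm {L L' : List (Fin n → ZMod 2)} (h : L.Perm L') : hashFun L = hashFun L' := by
  simp only [hashFun, hashStep_perm h]

/-- Every ingredient of a round is a sum over words or over a support, so relabelling the
coordinates relabels the result. -/
theorem hashStep_comp (L : List (Fin n → ZMod 2)) (σ : Equiv.Perm (Fin n)) (f : Fin n → ℕ) :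
    hashStep (L.map fun c => c ∘ σ) (f ∘ σ) = hashStep L f ∘ σ := by
  funext k
  simp only [hashStep, List.map_map, Function.comp_apply]
  congr 1
  refine List.map_congr_left fun c _ => ?_
  have h : (∑ i with c (σ i) = 1, f (σ i)) = ∑ i with c i = 1, f i := by
    rw [Finset.sum_filter, Finset.sum_filter]
    exact Equiv.sum_comp σ fun i => if c i = 1 then f i else 0
  simp only [Function.comp_apply, h]
  rfl

theorem hashFun_comp (L : List (Fin n → ZMod 2)) (σ : Equiv.Perm (Fin n)) :
    hashFun (L.map fun c => c ∘ σ) = hashFun L ∘ σ := by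
  have h : (fun _ => 1 : Fin n → ℕ) = (fun _ => 1) ∘ σ := rfl
  rw [hashFun, h, hashStep_comp, hashStep_comp, hashStep_comp]
  rfl

theorem hammingNorm_comp (c : Fin n → ZMod 2) (σ : Equiv.Perm (Fin n)) :
    hammingNorm (c ∘ σ) = hammingNorm c := by
  rw [hammingNorm, hammingNorm]
  exact Finset.card_bij (fun i _ => σ i) (by simp) (fun _ _ _ _ h => σ.injective h)
    fun j hj => ⟨σ.symm j, by simpa using hj, by simp⟩

/-- Composition with an automorphism preserves membership and weight, and it moves the prescribed
one from `σ i` to `i`. -/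
theorem perm_lightThrough_comp {σ : Equiv.Perm (Fin n)} (hσ : σ ∈ automorphismGroup C)
    (i : Fin n) : List.Perm ((lightThrough C (σ i)).toList.map fun c => c ∘ σ)
      (lightThrough C i).toList := by
  refine perm_lightThrough ((Finset.nodup_toList _).map σ.surjective.injective_comp_right) ?_
  intro c
  rw [List.mem_map]
  constructor
  · rintro ⟨d, hd, rfl⟩
    rw [Finset.mem_toList, mem_lightThrough] at hd
    exact ⟨(hσ d).2 hd.1, hd.2.1, (hammingNorm_comp d σ).trans_le hd.2.2⟩
  · rintro ⟨h1, h2, h3⟩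
    have e : (c ∘ ⇑σ.symm) ∘ ⇑σ = c := by
      funext j
      simp
    refine ⟨c ∘ σ.symm, ?_, e⟩
    rw [Finset.mem_toList, mem_lightThrough, hammingNorm_comp]
    exact ⟨(hσ _).1 (by rw [e]; exact h1), by simpa using h2, h3⟩

theorem card_lightThrough {σ : Equiv.Perm (Fin n)} (hσ : σ ∈ automorphismGroup C) (i : Fin n) :
    (lightThrough C (σ i)).card = (lightThrough C i).card := by
  have h := (perm_lightThrough_comp hσ i).length_eq
  rwa [List.length_map, Finset.length_toList, Finset.length_toList] at h

theorem hashThrough_apply {σ : Equiv.Perm (Fin n)} (hσ : σ ∈ automorphismGroup C)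
    (i k : Fin n) : hashThrough C (σ i) (σ k) = hashThrough C i k := by
  rw [hashThrough, hashThrough, ← hashFun_perm (perm_lightThrough_comp hσ i), hashFun_comp]
  rfl

/-- An automorphism fixing `i₀` preserves the hash values attached to `i₀`; as they are distinct, it
is the identity. Hence evaluation at `i₀` is injective, and the order is the size of the orbit of
`i₀`. That orbit contains the class of `i₀` by `hrep` and nothing else, because the hash value of a
coordinate at itself is constant on orbits. -/
theorem card_automorphismGroup {i₀ : Fin n} {rep : Fin n → Fin n}
    (hrep : ∀ k, ∃ σ ∈ automorphismGroup C, σ (rep k) = k)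
    (hinj : Function.Injective (hashThrough C i₀))
    (hne : ∀ k, rep k ≠ i₀ → hashThrough C (rep k) (rep k) ≠ hashThrough C i₀ i₀) :
    Nat.card (automorphismGroup C) = (Finset.univ.filter fun k => rep k = i₀).card := by
  have hf : Function.Injective fun σ : automorphismGroup C => (σ : Equiv.Perm (Fin n)) i₀ := by
    rintro ⟨σ, hσ⟩ ⟨τ, hτ⟩ h
    have h0 : τ i₀ = σ i₀ := h.symm
    have hστ := mul_mem (inv_mem hτ) hσ
    have hfix : (τ⁻¹ * σ) i₀ = i₀ := by
      rw [Equiv.Perm.mul_apply, ← h0]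
      exact τ.symm_apply_apply i₀
    have h1 : ∀ k, (τ⁻¹ * σ) k = k := by
      intro k
      apply hinj
      have := hashThrough_apply hστ i₀ k
      rwa [hfix] at this
    refine Subtype.ext (Equiv.ext fun k => ?_)
    exact (τ.apply_symm_apply (σ k)).symm.trans (congrArg τ (h1 k))
  rw [← Nat.card_range_of_injective hf, Nat.card_coe_set_eq, ← Set.ncard_coe_finset]
  congr 1
  ext k
  simp only [Set.mem_range, Subtype.exists, exists_prop, Finset.coe_filter, Finset.mem_univ,
    true_and, Set.mem_ofPred_eq]
  obtain ⟨ρ, hρ, hρk⟩ := hrep k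
  constructor
  · rintro ⟨σ, hσ, h⟩
    by_contra hk
    refine hne k hk ?_
    have h1 := hashThrough_apply hρ (rep k) (rep k)
    have h2 := hashThrough_apply hσ i₀ i₀
    rw [hρk] at h1
    rw [h] at h2
    exact h1.symm.trans h2
  · intro h
    exact ⟨ρ, hρ, by rw [← h, hρk]⟩

/-- Double counting of pairs of a word of weight 12 and a coordinate in its support; no nonzero word
is lighter. -/
theorem twelve_mul_weightCount (h12 : ∀ c ∈ C, c ≠ 0 → 12 ≤ hammingNorm c) :
    12 * weightCount (C : Set (Fin n → ZMod 2)) 12 = ∑ i, (lightThrough C i).card := by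
  classical
  have h1 : weightCount (C : Set (Fin n → ZMod 2)) 12 =
      (Finset.univ.filter fun c => c ∈ C ∧ hammingNorm c = 12).card := by
    rw [weightCount, ← Set.ncard_coe_finset]
    congr 1
    ext c
    simp
  have h2 : ∀ i, lightThrough C i =
      (Finset.univ.filter fun c => c ∈ C ∧ hammingNorm c = 12).filter fun c => c i = 1 := by
    intro i
    ext c
    rw [mem_lightThrough, Finset.mem_filter, Finset.mem_filter]
    constructor
    · rintro ⟨h, h3, h4⟩
      have h5 : c ≠ 0 := by
        rintro rfl
        exact zero_ne_one h3
      exact ⟨⟨Finset.mem_univ _, h, le_antisymm h4 (h12 c h h5)⟩, h3⟩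
    · rintro ⟨⟨-, h, h4⟩, h3⟩
      exact ⟨h, h3, h4.le⟩
  simp only [h1, h2, Finset.card_filter _ (Finset.univ.filter _)]
  rw [Finset.sum_comm, mul_comm, ← smul_eq_mul, ← Finset.sum_const]
  refine Finset.sum_congr rfl fun c hc => ?_
  rw [← (Finset.mem_filter.1 hc).2.2, hammingNorm, Finset.card_filter]
  simp only [zmod_two_eq_one_iff]

end Through


/-! ### Evaluation of the program -/

section Words

variable {C : Submodule (ZMod 2) (Fin 72 → ZMod 2)}

/-- A list of the packed words of weight at most 12 through a coordinate. -/
def ListsThrough (C : Submodule (ZMod 2) (Fin 72 → ZMod 2)) (i : Fin 72) (W : List ℕ) : Prop :=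
  ∃ L : List (Fin 72 → ZMod 2), W = L.map pack ∧ L.Perm (lightThrough C i).toList

theorem ListsThrough.length_eq {i : Fin 72} {W : List ℕ} (h : ListsThrough C i W) :
    W.length = (lightThrough C i).card := by
  obtain ⟨L, rfl, hL⟩ := h
  rw [List.length_map, hL.length_eq, Finset.length_toList]

theorem ListsThrough.digit_eq {i : Fin 72} {W : List ℕ} (h : ListsThrough C i W)
    (hW : W.length ≤ 256) (k : Fin 72) : digit (invariant W) k = hashThrough C i k := by
  obtain ⟨L, rfl, hL⟩ := h
  rw [List.length_map] at hW
  rw [digit_invariant hW, hashFun_perm hL]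
  rfl

theorem injective_hashThrough {W : List ℕ} (hW : ListsThrough C 0 W)
    (h : checkFirst W = true) : Function.Injective (hashThrough C 0) := by
  rw [checkFirst, Bool.and_eq_true, distinct_eq_true, Nat.ble_eq, digitList] at h
  intro i j hij
  rw [← hW.digit_eq h.1, ← hW.digit_eq h.1] at hij
  exact Fin.ext (List.inj_on_of_nodup_map h.2 (List.mem_range.2 i.2) (List.mem_range.2 j.2) hij)

theorem hashThrough_ne {W W' : List ℕ} {i : Fin 72} (hW : ListsThrough C 0 W)
    (hW' : ListsThrough C i W') (h : checkFirst W = true)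
    (h' : checkLater (digit (invariant W) 0) i W' = true) :
    hashThrough C i i ≠ hashThrough C 0 0 := by
  rw [checkFirst, Bool.and_eq_true, Nat.ble_eq] at h
  rw [checkLater, Bool.and_eq_true, Nat.ble_eq, Bool.not_eq_true'] at h'
  rw [← hW'.digit_eq h'.1, ← hW.digit_eq h.1]
  exact Nat.ne_of_beq_eq_false h'.2

variable {κ : Kind} {α β : ℕ}

/-- All classes of coordinates have the same number `α` of members. -/
theorem sum_orbitRep (hα : α ∈ groupOrders κ) (ho : checkOrbits κ α = true) (f : ℕ → ℕ) :
    ∑ k : Fin 72, f (orbitRep κ α k) = α * ((orbitReps α).map f).sum := by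
  have hn : (orbitReps α).Nodup := by
    unfold orbitReps
    cases Nat.beq α 72 <;> cases Nat.beq α 36 <;> decide
  rw [← Finset.sum_fiberwise_of_maps_to (t := (orbitReps α).toFinset)
    (g := fun k : Fin 72 => orbitRep κ α k)
    (fun k _ => List.mem_toFinset.2 (orbitRep_mem ho k.2)), ← List.sum_toFinset _ hn,
    Finset.mul_sum]
  refine Finset.sum_congr rfl fun i hi => ?_
  refine (Finset.sum_congr rfl fun k hk => congrArg f (Finset.mem_filter.1 hk).2).trans ?_
  rw [Finset.sum_const, card_orbitRep κ α hα i (List.mem_toFinset.1 hi), smul_eq_mul]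

theorem groupOrders_cases (hα : α ∈ groupOrders κ) : α = 18 ∨ α = 36 ∨ α = 72 := by
  cases κ <;> simp [groupOrders] at hα <;> omega

theorem checkWords_eq_true {W W₁ W' W'₁ : List ℕ} (hα : α ∈ groupOrders κ)
    (ho : checkOrbits κ α = true)
    (hC : ∀ g ∈ generators κ α, ∃ σ ∈ automorphismGroup C, ∀ k, (σ k : ℕ) = action g k)
    (hW : ListsThrough C 0 W) (hW₁ : ListsThrough C 1 W₁) (hW' : ListsThrough C 36 W')
    (hW'₁ : ListsThrough C 37 W'₁) (h : checkWords α β W W₁ W' W'₁ = true) :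
    Nat.card (automorphismGroup C) = α ∧ ∑ i, (lightThrough C i).card = 24 * β := by
  have hlt : ∀ k : Fin 72, orbitRep κ α k < 72 := fun k => orbitReps_lt α _ (orbitRep_mem ho k.2)
  have hrep : ∀ k : Fin 72, ∃ σ ∈ automorphismGroup C, σ ⟨orbitRep κ α k, hlt k⟩ = k :=
    fun k => exists_automorphism_orbitRep ho hC k _ rfl
  have hcard := card_orbitRep κ α hα 0 (by
    unfold orbitReps
    cases Nat.beq α 72 <;> cases Nat.beq α 36 <;> decide)
  set f : ℕ → ℕ := fun i => if h : i < 72 then (lightThrough C ⟨i, h⟩).card else 0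
  have hfv : ∀ i : Fin 72, f i = (lightThrough C i).card := fun i => dif_pos i.2
  have hsum : ∑ i, (lightThrough C i).card = α * ((orbitReps α).map f).sum := by
    rw [← sum_orbitRep hα ho]
    refine Finset.sum_congr rfl fun k _ => ?_
    obtain ⟨σ, hσ, hσ2⟩ := hrep k
    have h1 := card_lightThrough hσ ⟨orbitRep κ α k, hlt k⟩
    rw [hσ2] at h1
    exact h1.trans (hfv ⟨_, hlt k⟩).symm
  have h0 : f 0 = W.length := (hfv 0).trans hW.length_eq.symm
  have h1 : f 1 = W₁.length := (hfv 1).trans hW₁.length_eq.symm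
  have h36 : f 36 = W'.length := (hfv 36).trans hW'.length_eq.symm
  have h37 : f 37 = W'₁.length := (hfv 37).trans hW'₁.length_eq.symm
  rw [checkWords, Bool.and_eq_true] at h
  have hAut : (∀ i ∈ orbitReps α, ∀ hi : i < 72, i ≠ 0 →
      hashThrough C ⟨i, hi⟩ ⟨i, hi⟩ ≠ hashThrough C 0 0) →
      Nat.card (automorphismGroup C) = α := by
    intro hne
    rw [card_automorphismGroup hrep (injective_hashThrough hW h.1)]
    · refine (congrArg Finset.card ?_).trans hcard
      ext k
      simp [Fin.ext_iff]
    · intro k hk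
      exact hne _ (orbitRep_mem ho k.2) (hlt k) fun h => hk (Fin.ext h)
  obtain ⟨hF, h⟩ := h
  rcases groupOrders_cases hα with rfl | rfl | rfl
  · simp only [show Nat.beq 18 72 = false from rfl, show Nat.beq 18 36 = false from rfl,
      cond_false, Bool.and_eq_true, Nat.beq_eq] at h
    obtain ⟨h2, h3, h4, h5⟩ := h
    refine ⟨hAut ?_, ?_⟩
    · intro i hi hi2 hi0
      have : i = 0 ∨ i = 36 ∨ i = 1 ∨ i = 37 := by
        simpa [show orbitReps 18 = [0, 36, 1, 37] from rfl] using hi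
      rcases this with rfl | rfl | rfl | rfl
      · exact absurd rfl hi0
      · exact hashThrough_ne hW hW' hF h2
      · exact hashThrough_ne hW hW₁ hF h3
      · exact hashThrough_ne hW hW'₁ hF h4
    · rw [hsum, ← h5]
      simp only [orbitReps, show Nat.beq 18 72 = false from rfl,
        show Nat.beq 18 36 = false from rfl, cond_false, List.map_cons, List.map_nil,
        List.sum_cons, List.sum_nil, h0, h1, h36, h37]
      ring
  · simp only [show Nat.beq 36 72 = false from rfl, show Nat.beq 36 36 = true from rfl,
      cond_false, cond_true, Bool.and_eq_true, Nat.beq_eq] at h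
    obtain ⟨h2, h5⟩ := h
    refine ⟨hAut ?_, ?_⟩
    · intro i hi hi2 hi0
      have : i = 0 ∨ i = 36 := by simpa [show orbitReps 36 = [0, 36] from rfl] using hi
      rcases this with rfl | rfl
      · exact absurd rfl hi0
      · exact hashThrough_ne hW hW' hF h2
    · rw [hsum, ← h5]
      simp only [orbitReps, show Nat.beq 36 72 = false from rfl,
        show Nat.beq 36 36 = true from rfl, cond_false, cond_true, List.map_cons, List.map_nil,
        List.sum_cons, List.sum_nil, h0, h36]
      ring
  · simp only [show Nat.beq 72 72 = true from rfl, cond_true, Nat.beq_eq] at h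
    refine ⟨hAut ?_, ?_⟩
    · intro i hi hi2 hi0
      have : i = 0 := by simpa [orbitReps] using hi
      exact absurd this hi0
    · rw [hsum, ← h]
      simp only [orbitReps, show Nat.beq 72 72 = true from rfl, cond_true, List.map_cons,
        List.map_nil, List.sum_cons, List.sum_nil, h0]
      ring

end Words

/-! ### The lists and the shadow for a single code -/

section Rows

variable {M : Matrix (Fin 36) (Fin 36) (ZMod 2)} {H H' : Half}

theorem listsThrough_left (hM : M * Mᵀ = 1) (hH : H.Represents M (encodeLeft M))
    (hH' : H'.Represents Mᵀ (encodeRight M)) (i : Fin 36) :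
    ListsThrough (codeOf M) (Fin.castAdd 36 i) (words H H' i) :=
  ⟨_, words_eq hH hH' i,
    perm_lightThrough (wordList_nodup (systematic_left M) (systematic_right hM) i)
      fun _ => mem_wordList (systematic_left M) (systematic_right hM)⟩

theorem listsThrough_right (hM : M * Mᵀ = 1) (hH : H.Represents M (encodeLeft M))
    (hH' : H'.Represents Mᵀ (encodeRight M)) (i : Fin 36) :
    ListsThrough (codeOf M) (Fin.natAdd 36 i) (words H' H i) :=
  ⟨_, words_eq hH' hH i,
    perm_lightThrough (wordList_nodup (systematic_right hM) (systematic_left M) i)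
      fun _ => mem_wordList (systematic_right hM) (systematic_left M)⟩

/-- Shadow weights are at least 8 and divisible by 4, so below 11 only weight 8 occurs, and the
vectors of weight at most 8 are those of weight 8. -/
theorem weightCount_shadow (hM : M * Mᵀ = 1) (hH : H.Represents M (encodeLeft M))
    (hH' : H'.Represents Mᵀ (encodeRight M)) {γ : ℕ}
    (h : checkShadow H H' (ball 36 4) (bits (rowHalfWeights M)) (bits (rowHalfWeights M ᵥ* M)) γ =
      true) :
    (∀ j < 11, j ≠ 8 → weightCount (shadow (codeOf M)) j = 0) ∧
      weightCount (shadow (codeOf M)) 8 = γ := by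
  have hC := isSelfDual_codeOf hM
  have hl := left_mem_shadow hM
  have hr := right_mem_shadow hM
  simp only [checkShadow, Bool.and_eq_true, Nat.beq_eq] at h
  obtain ⟨h1, h2, h3, h4⟩ := h
  have hS : ∀ s, s ∈ shadow (codeOf M) ↔
      rightPart s = leftPart s ᵥ* M + rowHalfWeights M ᵥ* M := by
    intro s
    rw [mem_shadow_iff hC hr, mem_codeOf]
    have e1 : rightPart (s + Fin.append 0 (rowHalfWeights M ᵥ* M)) =
        rightPart s + rowHalfWeights M ᵥ* M := by
      conv_rhs => rw [← rightPart_append 0 (rowHalfWeights M ᵥ* M)]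
      rfl
    have e2 : leftPart (s + Fin.append 0 (rowHalfWeights M ᵥ* M)) = leftPart s := by
      conv_rhs => rw [← add_zero (leftPart s), ← leftPart_append 0 (rowHalfWeights M ᵥ* M)]
      rfl
    rw [e1, e2]
    exact CharTwo.add_eq_iff_eq_add
  have hS' : ∀ s, s ∈ shadow (codeOf M) ↔
      leftPart s = rightPart s ᵥ* Mᵀ + rowHalfWeights M := by
    intro s
    rw [mem_shadow_iff hC hl, mem_codeOf_iff_left hM]
    have e1 : rightPart (s + Fin.append (rowHalfWeights M) 0) = rightPart s := by
      conv_rhs => rw [← add_zero (rightPart s), ← rightPart_append (rowHalfWeights M) 0]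
      rfl
    have e2 : leftPart (s + Fin.append (rowHalfWeights M) 0) =
        leftPart s + rowHalfWeights M := by
      conv_rhs => rw [← leftPart_append (rowHalfWeights M) 0]
      rfl
    rw [e1, e2]
    exact CharTwo.add_eq_iff_eq_add
  have h8 : ∀ s ∈ shadow (codeOf M), 8 ≤ hammingNorm s := fun s hs =>
    eight_le_norm (systematic_left M) (systematic_right hM) hS hS' hH hH' h2 h3 hs
  have hmod : ∀ s ∈ shadow (codeOf M), hammingNorm s % 4 = 0 := by
    intro s hs
    rw [shadow_norm_mod hC hr hs, hammingNorm_eq_parts, leftPart_append, rightPart_append,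
      hammingNorm_zero, zero_add]
    rw [packBits_bits, dot_pack_self _ (by norm_num)] at h1
    exact h1
  have hcount := card_shadowWords (systematic_left M) (systematic_right hM) hS hS' hH hH'
    (leftPart_append 0 (rowHalfWeights M ᵥ* M)) (rightPart_append _ _)
    (rightPart_append (rowHalfWeights M) 0) (leftPart_append _ _)
  rw [h4] at hcount
  constructor
  · intro j hj hj8
    rw [weightCount, Set.ncard_eq_zero]
    refine Set.eq_empty_of_forall_notMem ?_
    rintro s ⟨hs, hsj⟩
    have := h8 s hs
    have := hmod s hs
    omega
  · rw [weightCount, ← hcount]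
    congr 1
    ext s
    refine and_congr_right fun hs => ?_
    have := h8 s hs
    omega

end Rows


/-! ### The codes of the table -/

/-- The properties claimed for a row of the table. -/
def RowClaim (r : TableRow) : Prop :=
  IsSelfDual r.code ∧ IsTypeI r.code ∧ Module.finrank (ZMod 2) r.code = 36 ∧
    HasMinDistance r.code 12 ∧ HasWeightEnumeratorW721 r.code r.γ r.β ∧
    Nat.card (automorphismGroup r.code) = r.autOrder

/-- The conditions on a row which are checked by evaluation. -/
noncomputable def checkRow (r : TableRow) : Bool :=
  check r && (checkSpecial r && ((groupOrders r.kind).any (Nat.beq r.autOrder) &&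
    (Nat.blt r.γ 135 && Nat.blt 0 r.β)))

theorem rowClaim_of_checkRow {r : TableRow} (h : checkRow r = true) : RowClaim r := by
  have hM := entry_eq r
  have hH := leftHalf_represents hM
  have hH' := rightHalf_represents hM
  simp only [checkRow, check, checkHalves, Bool.and_eq_true, List.any_eq_true] at h
  obtain ⟨⟨h1, h2, h3, h4, h5⟩, hs, ⟨α, hα, hα'⟩, hγ, hβ⟩ := h
  rw [← Nat.eq_of_beq_eq_true hα'] at hα
  have ho := checkOrbits_groupOrders r.kind _ hα
  have hMM := mul_transpose_eq_one hH h1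
  rw [oddHalves_eq hH hMM, rightBits_eq hH] at h4
  have hC : IsSelfDual r.code := isSelfDual_codeOf hMM
  have hrank : Module.finrank (ZMod 2) r.code = 36 := finrank_codeOf r.rightHalf
  have hcard : Nat.card r.code = 2 ^ 36 := by
    rw [Module.natCard_eq_pow_finrank (K := ZMod 2), hrank, Nat.card_zmod]
  have h12 : ∀ c ∈ r.code, c ≠ 0 → 12 ≤ hammingNorm c := fun c hc h0 =>
    twelve_le_norm (systematic_left r.rightHalf) (systematic_right hMM) hH hH' h2 h3 hc h0
  obtain ⟨hB, hB8⟩ := weightCount_shadow hMM hH hH' h4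
  obtain ⟨hAut, hsum⟩ := checkWords_eq_true (C := r.code) hα ho
    (fun g hg => exists_automorphism_of_generator hM hMM hs hg)
    (listsThrough_left hMM hH hH' 0) (listsThrough_left hMM hH hH' 1)
    (listsThrough_right hMM hH hH' 0) (listsThrough_right hMM hH hH' 1) h5
  -- From `12 * A₁₂ = 24 * β`.
  have hA12 : weightCount (r.code : Set (Fin 72 → ZMod 2)) 12 = 2 * r.β := by
    have := twelve_mul_weightCount h12
    omega
  have hA0 : ∀ j, 0 < j → j < 12 → weightCount (r.code : Set (Fin 72 → ZMod 2)) j = 0 := by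
    intro j hj hj12
    rw [weightCount, Set.ncard_eq_zero]
    refine Set.eq_empty_of_forall_notMem ?_
    rintro c ⟨hc, hcj⟩
    have := h12 c hc (by rintro rfl; rw [hammingNorm_zero] at hcj; omega)
    omega
  have hA14 := weightCount_fourteen hC hcard hA0 hB hB8
  refine ⟨hC, ⟨hC, ?_⟩, hrank, ?_, hasWeightEnumeratorW721 hC hcard hA0 hA12 hB hB8, hAut⟩
  -- As `8640 = 64 * 135`, the bound `γ < 135` yields a word of weight 14, which makes the code Type
  -- I.
  · have hpos : weightCount (r.code : Set (Fin 72 → ZMod 2)) 14 ≠ 0 := by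
      intro h0
      have := Nat.blt_eq.mp hγ
      omega
    obtain ⟨c, hc, hc14⟩ := Set.nonempty_of_ncard_ne_zero hpos
    exact ⟨c, hc, by rw [hc14]; decide⟩
  · have hpos : weightCount (r.code : Set (Fin 72 → ZMod 2)) 12 ≠ 0 := by
      have := Nat.blt_eq.mp hβ
      omega
    obtain ⟨c, hc, hc12⟩ := Set.nonempty_of_ncard_ne_zero hpos
    refine ⟨⟨c, hc, 0, zero_mem _, ?_, ?_⟩, ?_⟩
    · rintro rfl
      rw [hammingNorm_zero] at hc12
      omega
    · rw [hammingDist_zero_right, hc12]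
    · rintro _ ⟨x, hx, y, hy, hxy, rfl⟩
      rw [hammingDist_eq_hammingNorm]
      rw [neg_add_eq_sub]
      exact h12 _ (sub_mem hy hx) (sub_ne_zero.2 hxy.symm)


theorem all_of_slices {α : Type*} (p : α → Bool) (l : List α) (n m : ℕ) (hl : l.length ≤ n * m)
    (h : ∀ q < m, ((l.drop (n * q)).take n).all p = true) : l.all p = true := by
  rw [List.all_eq_true]
  intro a ha
  obtain ⟨i, hi, rfl⟩ := List.mem_iff_getElem.1 ha
  have hn : 0 < n := Nat.pos_of_ne_zero fun h0 => by simp [h0] at hl; simp [hl] at hi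
  have hq : i / n < m := Nat.div_lt_of_lt_mul (hi.trans_le hl)
  refine List.all_eq_true.1 (h _ hq) _ ?_
  have e : n * (i / n) + i % n = i := Nat.div_add_mod i n
  rw [List.mem_take_iff_getElem]
  refine ⟨i % n, lt_min (Nat.mod_lt _ hn) (by rw [List.length_drop]; omega), ?_⟩
  simp [e]

/-! Evaluation of the program on the rows of the table, in slices of eight rows. -/

set_option maxRecDepth 100000 in
theorem checkRow_slice_0 : ((codeTable.drop (8 * 0)).take 8).all checkRow = true := by
  decide +kernel

set_option maxRecDepth 100000 in
theorem checkRow_slice_1 : ((codeTable.drop (8 * 1)).take 8).all checkRow = true := by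
  decide +kernel

set_option maxRecDepth 100000 in
theorem checkRow_slice_2 : ((codeTable.drop (8 * 2)).take 8).all checkRow = true := by
  decide +kernel

set_option maxRecDepth 100000 in
theorem checkRow_slice_3 : ((codeTable.drop (8 * 3)).take 8).all checkRow = true := by
  decide +kernel

set_option maxRecDepth 100000 in
theorem checkRow_slice_4 : ((codeTable.drop (8 * 4)).take 8).all checkRow = true := by
  decide +kernel

set_option maxRecDepth 100000 in
theorem checkRow_slice_5 : ((codeTable.drop (8 * 5)).take 8).all checkRow = true := by
  decide +kernel

set_option maxRecDepth 100000 in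
theorem checkRow_slice_6 : ((codeTable.drop (8 * 6)).take 8).all checkRow = true := by
  decide +kernel

set_option maxRecDepth 100000 in
theorem checkRow_slice_7 : ((codeTable.drop (8 * 7)).take 8).all checkRow = true := by
  decide +kernel

set_option maxRecDepth 100000 in
theorem checkRow_slice_8 : ((codeTable.drop (8 * 8)).take 8).all checkRow = true := by
  decide +kernel

set_option maxRecDepth 100000 in
theorem checkRow_slice_9 : ((codeTable.drop (8 * 9)).take 8).all checkRow = true := by
  decide +kernel

set_option maxRecDepth 100000 in
theorem checkRow_slice_10 : ((codeTable.drop (8 * 10)).take 8).all checkRow = true := by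
  decide +kernel

set_option maxRecDepth 100000 in
theorem checkRow_slice_11 : ((codeTable.drop (8 * 11)).take 8).all checkRow = true := by
  decide +kernel

set_option maxRecDepth 100000 in
theorem checkRow_slice_12 : ((codeTable.drop (8 * 12)).take 8).all checkRow = true := by
  decide +kernel

set_option maxRecDepth 100000 in
theorem checkRow_slice_13 : ((codeTable.drop (8 * 13)).take 8).all checkRow = true := by
  decide +kernel

set_option maxRecDepth 100000 in
theorem checkRow_slice_14 : ((codeTable.drop (8 * 14)).take 8).all checkRow = true := by
  decide +kernel

set_option maxRecDepth 100000 in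
theorem checkRow_slice_15 : ((codeTable.drop (8 * 15)).take 8).all checkRow = true := by
  decide +kernel

set_option maxRecDepth 100000 in
theorem checkRow_slice_16 : ((codeTable.drop (8 * 16)).take 8).all checkRow = true := by
  decide +kernel

theorem length_codeTable : codeTable.length = 134 := by decide +kernel

theorem checkRow_codeTable : codeTable.all checkRow = true := by
  refine all_of_slices _ _ 8 17 (by rw [length_codeTable]; norm_num) fun q hq => ?_
  interval_cases q
  · exact checkRow_slice_0
  · exact checkRow_slice_1
  · exact checkRow_slice_2
  · exact checkRow_slice_3
  · exact checkRow_slice_4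
  · exact checkRow_slice_5
  · exact checkRow_slice_6
  · exact checkRow_slice_7
  · exact checkRow_slice_8
  · exact checkRow_slice_9
  · exact checkRow_slice_10
  · exact checkRow_slice_11
  · exact checkRow_slice_12
  · exact checkRow_slice_13
  · exact checkRow_slice_14
  · exact checkRow_slice_15
  · exact checkRow_slice_16

end SelfDual72

open SelfDual72 in
theorem mainTheorem1 :
    (∀ A : ℕ → Matrix (Fin 2) (Fin 2) (ZMod 2),
      tau listingI (groupElement listingI A) = assemble (patternI A)) ∧
    (∀ A : ℕ → Matrix (Fin 2) (Fin 2) (ZMod 2), (∀ t ∈ Finset.Icc 1 18, (A t)ᵀ = A t) →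
      tau listingII (groupElement listingII A) = assemble (patternII A)) ∧
    (∀ A : ℕ → Matrix (Fin 2) (Fin 2) (ZMod 2),
      tau listingIII (groupElement listingIII A) = assemble (patternIII A)) ∧
    (∀ A : ℕ → Matrix (Fin 2) (Fin 2) (ZMod 2),
      tau listingIV (groupElement listingIV A) = assemble (patternIV A)) ∧
    codeTable.length = 134 ∧
    ∀ r ∈ codeTable,
      IsSelfDual r.code ∧ IsTypeI r.code ∧
      Module.finrank (ZMod 2) r.code = 36 ∧ HasMinDistance r.code 12 ∧
      HasWeightEnumeratorW721 r.code r.γ r.β ∧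
      Nat.card (automorphismGroup r.code) = r.autOrder := by
  refine ⟨tau_listingI, tau_listingII, tau_listingIII, tau_listingIV, length_codeTable,
    fun r hr => ?_⟩
  exact rowClaim_of_checkRow (List.all_eq_true.1 checkRow_codeTable r hr)
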